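/- Let $M\ge 0$. The FFD algebra with $M$ generators is the complex unital associative algebra generated by $h_1,\dots,h_M$ with the relations $h_j^2=1$, $h_jh_k=-h_kh_j$ for $1\le|j-k|\le 2$, and $h_jh_k=h_kh_j$ for $|j-k|>2$ (and no others). Let $A\mapsto A^T$ be its linear operation that reverses products of generators, $(h_{j_1}\cdots h_{j_n})^T=h_{j_n}\cdots h_{j_1}$. For real $\alpha_1,\dots,\alpha_M$ put $H=\sum_j\alpha_jh_j$, $S=\lfloor (M+2)/3\rfloor$, $$T_M(v)=\sum_{s=0}^{S}(-v)^sQ^{(s)},\qquad Q^{(s)}=\sum_{m_{r+1}>m_r+2}(\alpha_{m_1}h_{m_1})\cdots(\alpha_{m_s}h_{m_s}),$$ and define polynomials $P_m$ in the variable $x=v^2$ by $P_m(x)=P_{m-1}(x)-x\,\alpha_m^2P_{m-3}(x)$, with $P_m=1$ for $m\le 0$. Let $\varphi_1,\dots,\varphi_M$ be arbitrary real angles with $\cos(2\varphi_j)\ne 0$ for all $j$, put $\varphi_0=\varphi_{-1}=0$, $u_j=\cos\varphi_j+i\sin\varphi_j\,h_j$, $G=u_1u_2\cdots u_M$ and $\mathcal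 V=G\cdot G^T$. Then there are unique real $\alpha_1,\dots,\alpha_M$ with $$\tan(2\varphi_{j})=-\alpha_{j}\cos(2\varphi_{j-1})\cos(2\varphi_{j-2}),\qquad j=1,\dots,M,$$ and for these couplings the following hold. 1. $T_M(i)=\mathcal C\,\mathcal V$ with $\mathcal C=\prod_{j=1}^M\frac1{\cos(2\varphi_j)}$. 2. $\mathcal V$ commutes with $H=\sum_j\alpha_jh_j$. 3. $P_M$ has degree $n\le S$ (with $n=S$ if all $\alpha_j\neq0$), and all its roots are real and positive: counted with multiplicity they are $\tilde v_1^2,\dots,\tilde v_n^2$ with $\tilde v_k>0$. 4. In every faithful representation of the FFD algebra by complex matrices (of finite size) in which the $h_j$ are Hermitian, $u_j$ is represented by $e^{i\varphi_jh_j}$ and $\mathcal V$ by a unitary matrix. For any real $\tilde\varepsilon_1,\dots,\tilde\varepsilon_n$ with $\tan\tilde\varepsilon_k=1/\tilde v_k$, the set of eigenvalues of $\mathcal V$ in this representation is exactly the set of the numbers $$s\prod_{k=1}^n e^{\sigma_k i\tilde\varepsilon_k},\qquad \sigma_k\in\{+1,-1\}\ \text{independent},$$ where $s=\pm1$ is the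 sign of $\prod_j\cos(2\varphi_j)\prod_k\cos\tilde\varepsilon_k$. (In particular $s=1$ if $|\varphi_j|<\pi/4$ for all $j$ and $0<\tilde\varepsilon_k<\pi/2$ for all $k$.) 5. If the representation is moreover on a chain of $L$ qubits with every $h_j$ a Pauli string (a tensor product of matrices from $\{1,X,Y,Z\}$), then there is an integer $D\ge1$ such that every complex number $z$ has degeneracy, as an eigenvalue of $\mathcal V$, equal to $D$ times the number of sign choices $\sigma$ for which the above product equals $z$. In this case $\mathcal V$ has a free fermionic spectrum: it is unitary and there are a number $m$ of modes, real $\varepsilon_1,\dots,\varepsilon_m$ and an integer $D'\ge 1$ such that the degeneracy of every $z\in\mathbb C$ as an eigenvalue of $\mathcal V$ is $D'$ times the number of sign choices $\sigma\in\{\pm1\}^m$ with $\prod_{k=1}^m e^{i\sigma_k\varepsilon_k}=z$. -/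

import Mathlib

open scoped Polynomial

/-- The defining relations of the FFD algebra with `M` generators (indexed by `Fin M`):
the generators square to one, generators at distance one or two anticommute, and generators at
distance larger than two commute. -/
inductive FFDRel (M : ℕ) : FreeAlgebra ℂ (Fin M) → FreeAlgebra ℂ (Fin M) → Prop
  | sq (j : Fin M) : FFDRel M (FreeAlgebra.ι ℂ j * FreeAlgebra.ι ℂ j) 1
  | anticomm (j k : Fin M) (hlt : j.val < k.val) (hle : k.val ≤ j.val + 2) :
      FFDRel M (FreeAlgebra.ι ℂ j * FreeAlgebra.ι ℂ k + FreeAlgebra.ι ℂ k * FreeAlgebra.ι ℂ j) 0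
  | comm (j k : Fin M) (hlt : j.val + 2 < k.val) :
      FFDRel M (FreeAlgebra.ι ℂ j * FreeAlgebra.ι ℂ k) (FreeAlgebra.ι ℂ k * FreeAlgebra.ι ℂ j)

/-- The FFD algebra with `M` generators: the complex unital associative algebra presented by the
generators and the relations `FFDRel M`, and no other relations. -/
abbrev FFD (M : ℕ) : Type := RingQuot (FFDRel M)

namespace FFD

noncomputable section

variable {M : ℕ}

/-- The generators `h_j` of the FFD algebra. -/
def h (j : Fin M) : FFD M := RingQuot.mkAlgHom ℂ (FFDRel M) (FreeAlgebra.ι ℂ j)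

theorem h_sq (j : Fin M) : h j * h j = 1 := by
  have := RingQuot.mkAlgHom_rel ℂ (FFDRel.sq j)
  simpa [h] using this

theorem h_anticomm (j k : Fin M) (hlt : j.val < k.val) (hle : k.val ≤ j.val + 2) :
    h j * h k + h k * h j = 0 := by
  have := RingQuot.mkAlgHom_rel ℂ (FFDRel.anticomm j k hlt hle)
  simpa [h] using this

theorem h_comm (j k : Fin M) (hlt : j.val + 2 < k.val) : h j * h k = h k * h j := by
  have := RingQuot.mkAlgHom_rel ℂ (FFDRel.comm j k hlt)
  simpa [h] using this

/-- The algebra homomorphism from the FFD algebra to its opposite algebra that fixes the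
generators. -/
def transposeHom (M : ℕ) : FFD M →ₐ[ℂ] (FFD M)ᵐᵒᵖ :=
  RingQuot.liftAlgHom ℂ ⟨FreeAlgebra.lift ℂ (fun j : Fin M => MulOpposite.op (h j)), by
    intro x y hxy
    induction hxy with
    | sq j => simp [← MulOpposite.op_mul, h_sq]
    | anticomm j k h1 h2 =>
      simp only [map_add, map_mul, FreeAlgebra.lift_ι_apply, ← MulOpposite.op_mul,
        ← MulOpposite.op_add, map_zero]
      rw [add_comm, h_anticomm j k h1 h2, MulOpposite.op_zero]
    | comm j k h1 =>
      simp only [map_mul, FreeAlgebra.lift_ι_apply, ← MulOpposite.op_mul, h_comm j k h1]⟩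

/-- The linear operation `A ↦ Aᵀ` of the FFD algebra, which reverses products of generators. -/
def transpose : FFD M →ₗ[ℂ] FFD M :=
  (MulOpposite.opLinearEquiv ℂ).symm.toLinearMap ∘ₗ (transposeHom M).toLinearMap

theorem transpose_h (j : Fin M) : transpose (h j) = h j := by
  simp [transpose, transposeHom, h]

theorem transpose_mul (A B : FFD M) : transpose (A * B) = transpose B * transpose A := by
  simp [transpose]

/-- The reversal property on arbitrary words in the generators. -/
theorem transpose_word (w : List (Fin M)) :
    transpose (w.map h).prod = (w.reverse.map h).prod := by
  induction w with
  | nil => simp [transpose]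
  | cons a w ih => simp [transpose_mul, transpose_h, ih]

/-- The gate `u_j = cos φ_j + i sin φ_j h_j`, that is, `exp (i φ_j h_j)`. -/
def gate (φ : Fin M → ℝ) (j : Fin M) : FFD M :=
  (Real.cos (φ j) : ℂ) • (1 : FFD M) + (Complex.I * (Real.sin (φ j) : ℂ)) • h j

/-- The ordered product `G = u_1 u_2 ⋯ u_M`. -/
def staircase (φ : Fin M → ℝ) : FFD M := (List.ofFn (gate φ)).prod

/-- The circuit `V = G Gᵀ`. -/
def circuit (φ : Fin M → ℝ) : FFD M := staircase φ * transpose (staircase φ)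

/-- The Hamiltonian `H = ∑ α_j h_j`. -/
def hamiltonian (α : Fin M → ℝ) : FFD M := ∑ j, (α j : ℂ) • h j

/-- The index sets `{m_1 < m_2 < ⋯ < m_s}` with `m_{r+1} > m_r + 2`. -/
def admissible (M s : ℕ) : Finset (Finset (Fin M)) := by
  classical
  exact (Finset.powersetCard s Finset.univ).filter
    (fun A => ∀ a ∈ A, ∀ b ∈ A, a < b → a.val + 2 < b.val)

/-- The charge `Q^(s)`: the sum of all `H_{m_1} H_{m_2} ⋯ H_{m_s}` with `m_{r+1} > m_r + 2`, where
`H_j = α_j h_j`. -/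
def charge (α : Fin M → ℝ) (s : ℕ) : FFD M :=
  ∑ A ∈ admissible M s, ((A.sort (· ≤ ·)).map (fun j => (α j : ℂ) • h j)).prod

/-- The transfer matrix `T_M(v) = ∑_{s=0}^S (-v)^s Q^(s)` with `S = ⌊(M+2)/3⌋`. -/
def transferMatrix (α : Fin M → ℝ) (v : ℂ) : FFD M :=
  ∑ s ∈ Finset.range ((M + 2) / 3 + 1), (-v) ^ s • charge α s

/-- The polynomials `P_m`, in the variable `X = v²`, of a sequence of couplings (`a m` is the
coupling of the generator number `m + 1`):
`P_m = P_{m-1} - X a_m² P_{m-3}`, with `P_m = 1` for `m ≤ 0`. -/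
def polySeq (a : ℕ → ℝ) : ℕ → ℝ[X]
  | 0 => 1
  | 1 => 1 - Polynomial.X * Polynomial.C (a 0 ^ 2)
  | 2 => polySeq a 1 - Polynomial.X * Polynomial.C (a 1 ^ 2)
  | (m + 3) => polySeq a (m + 2) - Polynomial.X * Polynomial.C (a (m + 2) ^ 2) * polySeq a m

/-- The polynomial `P_M` of the couplings `α_1, …, α_M`. -/
def poly (α : Fin M → ℝ) : ℝ[X] := polySeq (fun k => if hk : k < M then α ⟨k, hk⟩ else 0) M

/-- `previous φ j r` is `φ_{j-r}`, with the convention that the angles with nonpositive index are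
zero. -/
def previous (φ : Fin M → ℝ) (j : Fin M) (r : ℕ) : ℝ :=
  if r ≤ j.val then φ ⟨j.val - r, lt_of_le_of_lt (Nat.sub_le _ _) j.isLt⟩ else 0

/-- `tan(2φ_j) = -α_j cos(2φ_{j-1}) cos(2φ_{j-2})` for all `j`, with `φ_0 = φ_{-1} = 0`. -/
def CouplingRelation (φ α : Fin M → ℝ) : Prop :=
  ∀ j, Real.tan (2 * φ j) =
    -α j * Real.cos (2 * previous φ j 1) * Real.cos (2 * previous φ j 2)

/-- The product `∏_k e^{i σ_k ε_k}` for a choice of signs `σ`. -/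
def modeProduct {n : ℕ} (ε : Fin n → ℝ) (σ : Fin n → ℤˣ) : ℂ :=
  ∏ k, Complex.exp (Complex.I * (((σ k : ℤ) : ℂ) * (ε k : ℂ)))

/-- The degeneracy of the number `z` as an eigenvalue of `U`: the dimension of the eigenspace
(zero if `z` is not an eigenvalue). -/
def degeneracy {ι : Type*} [Fintype ι] [DecidableEq ι] (U : Matrix ι ι ℂ) (z : ℂ) : ℕ :=
  Module.finrank ℂ (Module.End.eigenspace (Matrix.toLin' U) z)

/-- A unitary operator has a free fermionic spectrum if, for some real `ε_1, …, ε_n`, its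
eigenvalues are exactly the `2^n` products `∏_k e^{± i ε_k}` with independent signs, all of them
with the same degeneracy `D ≥ 1`. If products for different signs coincide, then their
degeneracies add up. -/
def HasFreeFermionicSpectrum {ι : Type*} [Fintype ι] [DecidableEq ι] (U : Matrix ι ι ℂ) : Prop :=
  U ∈ Matrix.unitaryGroup ι ℂ ∧
    ∃ (n : ℕ) (ε : Fin n → ℝ) (D : ℕ), 0 < D ∧
      ∀ z : ℂ, degeneracy U z = D * Nat.card {σ : Fin n → ℤˣ // modeProduct ε σ = z}

/-- The identity and the Pauli matrices `X`, `Y`, `Z`. -/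
def pauli : Fin 4 → Matrix (Fin 2) (Fin 2) ℂ :=
  ![1, !![0, 1; 1, 0], !![0, -Complex.I; Complex.I, 0], !![1, 0; 0, -1]]

/-- The Pauli string on `L` qubits with the tensor factors `pauli (s k)`. The basis states of
the chain are the maps `Fin L → Fin 2`. -/
def pauliString {L : ℕ} (s : Fin L → Fin 4) : Matrix (Fin L → Fin 2) (Fin L → Fin 2) ℂ :=
  Matrix.of fun x y => ∏ k, pauli (s k) (x k) (y k)

end

end FFD

namespace FFD

/-! ### Transfer matrices: recursion, inversion relation, commutativity. -/

section Recursion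

variable {A : Type*} [Ring A] [Algebra ℂ A]

/-- The relations of the FFD algebra for a sequence of generators `b k = a k • h k` that are scaled
by couplings `a k` (a vanishing tail is allowed). -/
structure IsScaled (b : ℕ → A) (a : ℕ → ℝ) : Prop where
  sq : ∀ k, b k * b k = ((a k : ℂ) ^ 2) • (1 : A)
  anticomm : ∀ j k, j < k → k ≤ j + 2 → b j * b k = -(b k * b j)
  comm : ∀ j k, j + 2 < k → b j * b k = b k * b j

/-- The transfer matrices in recursive form, with the index shifted by two:
`transferSeq b u (m + 2)` belongs to the first `m` generators. -/
noncomputable def transferSeq (b : ℕ → A) (u : ℂ) : ℕ → A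
  | 0 => 1
  | 1 => 1
  | 2 => 1
  | (k + 3) => transferSeq b u (k + 2) - u • (b k * transferSeq b u k)

/-- The polynomials `P_m`, with the index shifted by two. -/
noncomputable def polyShift (a : ℕ → ℝ) : ℕ → ℝ[X]
  | 0 => 1
  | 1 => 1
  | 2 => 1
  | (k + 3) => polyShift a (k + 2) - Polynomial.X * Polynomial.C (a k ^ 2) * polyShift a k

/-- The value of `polyShift a k` at a complex number. -/
noncomputable def polyVal (a : ℕ → ℝ) (x : ℂ) (k : ℕ) : ℂ := Polynomial.aeval x (polyShift a k)

@[simp] lemma polyVal_zero (a : ℕ → ℝ) (x : ℂ) : polyVal a x 0 = 1 := by simp [polyVal, polyShift]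
@[simp] lemma polyVal_one (a : ℕ → ℝ) (x : ℂ) : polyVal a x 1 = 1 := by simp [polyVal, polyShift]
@[simp] lemma polyVal_two (a : ℕ → ℝ) (x : ℂ) : polyVal a x 2 = 1 := by simp [polyVal, polyShift]
lemma polyVal_add_three (a : ℕ → ℝ) (x : ℂ) (k : ℕ) :
    polyVal a x (k + 3) = polyVal a x (k + 2) - x * (a k : ℂ) ^ 2 * polyVal a x k := by
  simp [polyVal, polyShift]

@[simp] lemma transferSeq_zero (b : ℕ → A) (u : ℂ) : transferSeq b u 0 = 1 := rfl
@[simp] lemma transferSeq_one (b : ℕ → A) (u : ℂ) : transferSeq b u 1 = 1 := rfl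
@[simp] lemma transferSeq_two (b : ℕ → A) (u : ℂ) : transferSeq b u 2 = 1 := rfl
lemma transferSeq_add_three (b : ℕ → A) (u : ℂ) (k : ℕ) :
    transferSeq b u (k + 3) = transferSeq b u (k + 2) - u • (b k * transferSeq b u k) := rfl

lemma commute_transferSeq (b : ℕ → A) (u : ℂ) (x : A) (k : ℕ)
    (h : ∀ j, j + 3 ≤ k → Commute x (b j)) : Commute x (transferSeq b u k) := by
  induction k using Nat.strong_induction_on with
  | _ k ih =>
    match k with
    | 0 => simp
    | 1 => simp
    | 2 => simp
    | k + 3 =>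
      rw [transferSeq_add_three]
      exact (ih _ (by omega) fun j hj => h j (by omega)).sub_right
        (((h k le_rfl).mul_right (ih _ (by omega) fun j hj => h j (by omega))).smul_right u)

variable {b : ℕ → A} {a : ℕ → ℝ}

namespace IsScaled

lemma commute_self (hb : IsScaled b a) (u : ℂ) (k : ℕ) :
    transferSeq b u k * b k = b k * transferSeq b u k :=
  (commute_transferSeq b u (b k) k fun j hj => (hb.comm j k (by omega)).symm).symm.eq

/-- `transferSeq b u k` involves only `b 0, …, b (k - 3)` and commutes with `b k`, while the
increment up to `k + 1` carries a factor `b (k - 2)` that anticommutes with it. Moving `b k` across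
therefore reflects the transfer matrix about `transferSeq b u k`; `add_two_mul` is the same with two
increments. -/
lemma succ_mul (hb : IsScaled b a) (u : ℂ) (k : ℕ) :
    transferSeq b u (k + 1) * b k =
      b k * ((2 : ℂ) • transferSeq b u k - transferSeq b u (k + 1)) := by
  match k with
  | 0 => simp [two_smul]
  | 1 => simp [two_smul]
  | j + 2 =>
    have h1 := hb.anticomm j (j + 2) (by omega) (by omega)
    have h2 := hb.commute_self u (j + 2)
    have h3 : transferSeq b u j * b (j + 2) = b (j + 2) * transferSeq b u j :=
      (commute_transferSeq b u _ j fun i hi => (hb.comm i (j + 2) (by omega)).symm).symm.eq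
    have h4 : b j * transferSeq b u j * b (j + 2) = - (b (j + 2) * (b j * transferSeq b u j)) := by
      rw [mul_assoc, h3, ← mul_assoc, h1, neg_mul, mul_assoc]
    rw [transferSeq_add_three, sub_mul, h2, smul_mul_assoc, h4]
    simp only [mul_sub, mul_smul_comm]
    module

lemma add_two_mul (hb : IsScaled b a) (u : ℂ) (k : ℕ) :
    transferSeq b u (k + 2) * b k =
      b k * ((2 : ℂ) • transferSeq b u k - transferSeq b u (k + 2)) := by
  match k with
  | 0 => simp [two_smul]
  | j + 1 =>
    have h1 := hb.anticomm j (j + 1) (by omega) (by omega)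
    have h2 := hb.succ_mul u (j + 1)
    have h3 : transferSeq b u j * b (j + 1) = b (j + 1) * transferSeq b u j :=
      (commute_transferSeq b u _ j fun i hi => (hb.comm i (j + 1) (by omega)).symm).symm.eq
    have h4 : b j * transferSeq b u j * b (j + 1) = - (b (j + 1) * (b j * transferSeq b u j)) := by
      rw [mul_assoc, h3, ← mul_assoc, h1, neg_mul, mul_assoc]
    rw [show j + 1 + 2 = j + 3 from rfl, transferSeq_add_three, sub_mul, h2, smul_mul_assoc, h4]
    simp only [mul_sub, mul_smul_comm]
    module

/-- The inversion relation does not close under the recursion by itself: expanding step `k + 3`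
produces `b k` times a symmetrised product of steps `k` and `k + 2`. The mixed products of three
consecutive steps are thus carried along in the induction. -/
lemma inversion_aux (hb : IsScaled b a) (u : ℂ) (k : ℕ) :
    ((transferSeq b u k * transferSeq b (-u) k = polyVal a (u ^ 2) k • (1 : A)) ∧
    (transferSeq b u (k + 1) * transferSeq b (-u) (k + 1) = polyVal a (u ^ 2) (k + 1) • (1 : A)) ∧
    (transferSeq b u (k + 2) * transferSeq b (-u) (k + 2) = polyVal a (u ^ 2) (k + 2) • (1 : A))) ∧
    (transferSeq b u (k + 1) * transferSeq b (-u) k + transferSeq b u k * transferSeq b (-u) (k + 1)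
      = (2 * polyVal a (u ^ 2) k) • (1 : A)) ∧
    (transferSeq b u (k + 2) * transferSeq b (-u) (k + 1) +
      transferSeq b u (k + 1) * transferSeq b (-u) (k + 2)
      = (2 * polyVal a (u ^ 2) (k + 1)) • (1 : A)) ∧
    (transferSeq b u (k + 2) * transferSeq b (-u) k + transferSeq b u k * transferSeq b (-u) (k + 2)
      = (2 * polyVal a (u ^ 2) k) • (1 : A)) := by
  induction k with
  | zero => norm_num [two_smul]
  | succ k ih =>
    obtain ⟨⟨P0, P1, P2⟩, X1, X1m, X2⟩ := ih
    have c0 := hb.commute_self u k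
    have c1 := hb.succ_mul u k
    have c2 := hb.add_two_mul u k
    have sq := hb.sq k
    refine ⟨⟨P1, P2, ?_⟩, X1m, ?_, ?_⟩ <;>
    simp only [show k + 1 + 2 = k + 3 from rfl, show k + 1 + 1 = k + 2 from rfl,
      transferSeq_add_three, polyVal_add_three] at *
    all_goals
      generalize transferSeq b u k = s0 at *
      generalize transferSeq b u (k + 1) = s1 at *
      generalize transferSeq b u (k + 2) = s2 at *
      generalize transferSeq b (-u) k = r0 at *
      generalize transferSeq b (-u) (k + 1) = r1 at *
      generalize transferSeq b (-u) (k + 2) = r2 at *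
      generalize polyVal a (u ^ 2) k = p0 at *
      generalize polyVal a (u ^ 2) (k + 1) = p1 at *
      generalize polyVal a (u ^ 2) (k + 2) = p2 at *
      generalize b k = d at *
    · have e : d * s0 * (d * r0) = ((a k : ℂ) ^ 2 * p0) • (1 : A) := by
        rw [← c0, mul_assoc, ← mul_assoc d d, sq, smul_mul_assoc, one_mul, mul_smul_comm, P0,
          smul_smul]
      have e2 : s2 * (d * r0) = (2 * p0) • d - d * (s2 * r0) := by
        rw [← mul_assoc, c2, mul_assoc, sub_mul, smul_mul_assoc, P0, mul_sub, smul_smul,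
          mul_smul_comm, mul_one]
      have X : d * (s2 * r0) + d * (s0 * r2) = (2 * p0) • d := by
        rw [← mul_add, X2, mul_smul_comm, mul_one]
      simp only [mul_sub, sub_mul, smul_mul_assoc, mul_smul_comm, e, e2, P2, mul_assoc] at *
      linear_combination (norm := module) (-u) • X
    · have e : s2 * (d * r0) = (2 * p0) • d - d * (s2 * r0) := by
        rw [← mul_assoc, c2, mul_assoc, sub_mul, smul_mul_assoc, P0, mul_sub, smul_smul,
          mul_smul_comm, mul_one]
      have X : d * (s2 * r0) + d * (s0 * r2) = (2 * p0) • d := by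
        rw [← mul_add, X2, mul_smul_comm, mul_one]
      simp only [mul_sub, sub_mul, smul_mul_assoc, mul_smul_comm, e, P2, mul_assoc] at *
      linear_combination (norm := module) (-u) • X
    · have e : s1 * (d * r0) = (2 * p0) • d - d * (s1 * r0) := by
        rw [← mul_assoc, c1, mul_assoc, sub_mul, smul_mul_assoc, P0, mul_sub, smul_smul,
          mul_smul_comm, mul_one]
      have X : d * (s1 * r0) + d * (s0 * r1) = (2 * p0) • d := by
        rw [← mul_add, X1, mul_smul_comm, mul_one]
      simp only [mul_sub, sub_mul, smul_mul_assoc, mul_smul_comm, e, mul_assoc] at *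
      linear_combination (norm := module) X1m - u • X

/-- The inversion relation `T_m(u) T_m(-u) = P_m(u²)`. -/
lemma inversion (hb : IsScaled b a) (u : ℂ) (k : ℕ) :
    transferSeq b u k * transferSeq b (-u) k = polyVal a (u ^ 2) k • (1 : A) :=
  (hb.inversion_aux u k).1.1

lemma succ_inversion (hb : IsScaled b a) (u : ℂ) (k : ℕ) :
    transferSeq b u (k + 1) * transferSeq b (-u) k + transferSeq b u k * transferSeq b (-u) (k + 1)
      = (2 * polyVal a (u ^ 2) k) • (1 : A) :=
  (hb.inversion_aux u k).2.1

/-- The exchange relations between consecutive transfer matrices with two parameters. -/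
structure Exchange (b : ℕ → A) (u w : ℂ) (k : ℕ) : Prop where
  comm₀ : transferSeq b u k * transferSeq b w k = transferSeq b w k * transferSeq b u k
  comm₁ : transferSeq b u (k + 1) * transferSeq b w (k + 1) =
    transferSeq b w (k + 1) * transferSeq b u (k + 1)
  comm₂ : transferSeq b u (k + 2) * transferSeq b w (k + 2) =
    transferSeq b w (k + 2) * transferSeq b u (k + 2)
  anti₁ : u • (transferSeq b u k * transferSeq b w (k + 1) +
      transferSeq b w (k + 1) * transferSeq b u k) -
    w • (transferSeq b w k * transferSeq b u (k + 1) +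
      transferSeq b u (k + 1) * transferSeq b w k) =
    (2 * (u - w)) • (transferSeq b u k * transferSeq b w k)
  anti₂ : u • (transferSeq b u (k + 1) * transferSeq b w (k + 2) +
      transferSeq b w (k + 2) * transferSeq b u (k + 1)) -
    w • (transferSeq b w (k + 1) * transferSeq b u (k + 2) +
      transferSeq b u (k + 2) * transferSeq b w (k + 1)) =
    (2 * (u - w)) • (transferSeq b u (k + 1) * transferSeq b w (k + 1))
  anti₃ : u • (transferSeq b u k * transferSeq b w (k + 2) +
      transferSeq b w (k + 2) * transferSeq b u k) -
    w • (transferSeq b w k * transferSeq b u (k + 2) +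
      transferSeq b u (k + 2) * transferSeq b w k) =
    (2 * (u - w)) • (transferSeq b u k * transferSeq b w k)
  bracket₁ : transferSeq b w k * transferSeq b u (k + 1) -
      transferSeq b u (k + 1) * transferSeq b w k =
    transferSeq b u k * transferSeq b w (k + 1) - transferSeq b w (k + 1) * transferSeq b u k
  bracket₂ : transferSeq b w (k + 1) * transferSeq b u (k + 2) -
      transferSeq b u (k + 2) * transferSeq b w (k + 1) =
    transferSeq b u (k + 1) * transferSeq b w (k + 2) -
      transferSeq b w (k + 2) * transferSeq b u (k + 1)
  bracket₃ : transferSeq b w k * transferSeq b u (k + 2) -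
      transferSeq b u (k + 2) * transferSeq b w k =
    transferSeq b u k * transferSeq b w (k + 2) - transferSeq b w (k + 2) * transferSeq b u k

lemma exchange (hb : IsScaled b a) (u w : ℂ) (k : ℕ) : Exchange b u w k := by
  induction k with
  | zero => constructor <;> simp <;> module
  | succ k ih =>
    obtain ⟨C0, C1, C2, J1, J1', J2, K1, K1m, K2⟩ := ih
    have c0 := hb.commute_self u k
    have c1 := hb.succ_mul u k
    have c2 := hb.add_two_mul u k
    have d0 := hb.commute_self w k
    have d1 := hb.succ_mul w k
    have d2 := hb.add_two_mul w k
    have sq := hb.sq k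
    -- Five relations are new. After `b k` is moved to the left, the new commutator uses an old
    -- weighted anticommutator, the new anticommutators use old brackets, and the new brackets use
    -- old anticommutators; so the three families close together.
    refine ⟨C1, C2, ?_, J1', ?_, ?_, K1m, ?_, ?_⟩ <;>
    simp only [show k + 1 + 2 = k + 3 from rfl, show k + 1 + 1 = k + 2 from rfl,
      transferSeq_add_three] at *
    all_goals
      generalize transferSeq b u k = s0 at *
      generalize transferSeq b u (k + 1) = s1 at *
      generalize transferSeq b u (k + 2) = s2 at *
      generalize transferSeq b w k = r0 at *
      generalize transferSeq b w (k + 1) = r1 at *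
      generalize transferSeq b w (k + 2) = r2 at *
      generalize b k = d at *
      have mulc0 : ∀ x, s0 * (d * x) = d * (s0 * x) := fun x => by
        rw [← mul_assoc, c0, mul_assoc]
      have muld0 : ∀ x, r0 * (d * x) = d * (r0 * x) := fun x => by
        rw [← mul_assoc, d0, mul_assoc]
      have mulc1 : ∀ x, s1 * (d * x) = (2 : ℂ) • (d * (s0 * x)) - d * (s1 * x) := fun x => by
        rw [← mul_assoc, c1]; simp only [mul_assoc, sub_mul, mul_sub, smul_mul_assoc, mul_smul_comm]
      have muld1 : ∀ x, r1 * (d * x) = (2 : ℂ) • (d * (r0 * x)) - d * (r1 * x) := fun x => by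
        rw [← mul_assoc, d1]; simp only [mul_assoc, sub_mul, mul_sub, smul_mul_assoc, mul_smul_comm]
      have mulc2 : ∀ x, s2 * (d * x) = (2 : ℂ) • (d * (s0 * x)) - d * (s2 * x) := fun x => by
        rw [← mul_assoc, c2]; simp only [mul_assoc, sub_mul, mul_sub, smul_mul_assoc, mul_smul_comm]
      have muld2 : ∀ x, r2 * (d * x) = (2 : ℂ) • (d * (r0 * x)) - d * (r2 * x) := fun x => by
        rw [← mul_assoc, d2]; simp only [mul_assoc, sub_mul, mul_sub, smul_mul_assoc, mul_smul_comm]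
      have J1d := congrArg (d * ·) J1
      have J2d := congrArg (d * ·) J2
      have K1d := congrArg (d * ·) K1
      have K2d := congrArg (d * ·) K2
      have C0d := congrArg (d * ·) C0
      have C0d' := congrArg (d * ·) C0d
      simp only [mul_add, mul_sub, sub_mul, smul_mul_assoc, mul_smul_comm, mul_assoc, mulc0, muld0,
        mulc1, muld1, mulc2, muld2] at J1d J2d K1d K2d C0d C0d' ⊢
    · linear_combination (norm := module) C2 + (u * w) • C0d' - J2d - (2 * u) • C0d
    · linear_combination (norm := module) (w - u) • C2 - (u * w) • ((2 : ℂ) • C0d + K2d)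
    · linear_combination (norm := module) J1' - (u * w) • ((2 : ℂ) • C0d + K1d)
    · linear_combination (norm := module) (-2 : ℂ) • C2 + J2d + (2 * u) • C0d
    · linear_combination (norm := module) K1m + J1d + (2 * u) • C0d

/-- The transfer matrices with different parameters commute. -/
lemma commute_transferSeq (hb : IsScaled b a) (u w : ℂ) (k : ℕ) :
    Commute (transferSeq b u k) (transferSeq b w k) :=
  (hb.exchange u w k).comm₀

end IsScaled
end Recursion

/-! ### Transfer matrices as polynomials in the spectral parameter; edge operators. -/

section TransferPoly

variable {A : Type*} [Ring A]

/-- The polynomial in the spectral parameter whose values are `transferSeq b u k`. -/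
noncomputable def transferPoly (b : ℕ → A) : ℕ → A[X]
  | 0 => 1
  | 1 => 1
  | 2 => 1
  | (k + 3) => transferPoly b (k + 2) - Polynomial.C (b k) * transferPoly b k * Polynomial.X

lemma transferPoly_add_three (b : ℕ → A) (k : ℕ) : transferPoly b (k + 3) =
    transferPoly b (k + 2) - Polynomial.C (b k) * transferPoly b k * Polynomial.X := rfl

/-- Induction along the three-step recursion. -/
lemma three_step_induction {p : ℕ → Prop} (h0 : p 0) (h1 : p 1) (h2 : p 2)
    (h : ∀ k, p k → p (k + 2) → p (k + 3)) (k : ℕ) : p k := by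
  induction k using Nat.strong_induction_on with
  | _ k ih =>
    match k with
    | 0 => exact h0
    | 1 => exact h1
    | 2 => exact h2
    | k + 3 => exact h k (ih _ (by omega)) (ih _ (by omega))

lemma coeff_zero_transferPoly (b : ℕ → A) (k : ℕ) : (transferPoly b k).coeff 0 = 1 := by
  induction k using three_step_induction with
  | h0 => simp [transferPoly]
  | h1 => simp [transferPoly]
  | h2 => simp [transferPoly]
  | h k h1 h2 => simp [transferPoly_add_three, h2]

lemma coeff_succ_transferPoly (b : ℕ → A) (k s : ℕ) : (transferPoly b (k + 3)).coeff (s + 1) =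
    (transferPoly b (k + 2)).coeff (s + 1) - b k * (transferPoly b k).coeff s := by
  simp [transferPoly_add_three]

lemma natDegree_transferPoly (b : ℕ → A) (k : ℕ) : (transferPoly b k).natDegree ≤ k / 3 := by
  induction k using three_step_induction with
  | h0 => simp [transferPoly]
  | h1 => simp [transferPoly]
  | h2 => simp [transferPoly]
  | h k h1 h2 =>
    rw [transferPoly_add_three]
    refine (Polynomial.natDegree_sub_le _ _).trans (max_le (h2.trans (by omega)) ?_)
    refine Polynomial.natDegree_mul_le.trans ?_
    have := Polynomial.natDegree_X_le (R := A)
    have := (Polynomial.natDegree_C_mul_le (b k) (transferPoly b k))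
    omega

lemma commute_coeff_transferPoly (b : ℕ → A) (x : A) (k : ℕ)
    (h : ∀ j, j + 3 ≤ k → Commute x (b j)) (s : ℕ) : Commute x ((transferPoly b k).coeff s) := by
  induction k using three_step_induction generalizing s with
  | h0 => simp only [transferPoly, Polynomial.coeff_one]; split_ifs <;> simp
  | h1 => simp only [transferPoly, Polynomial.coeff_one]; split_ifs <;> simp
  | h2 => simp only [transferPoly, Polynomial.coeff_one]; split_ifs <;> simp
  | h k h1 h2 =>
    cases s with
    | zero => simp [coeff_zero_transferPoly]
    | succ s =>
      rw [coeff_succ_transferPoly]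
      exact (h2 (fun j hj => h j (by omega)) _).sub_right
        ((h k le_rfl).mul_right (h1 (fun j hj => h j (by omega)) _))

variable [Algebra ℂ A]

lemma eval_transferPoly (b : ℕ → A) (u : ℂ) (k : ℕ) :
    (transferPoly b k).eval (algebraMap ℂ A u) = transferSeq b u k := by
  induction k using three_step_induction with
  | h0 => simp [transferPoly]
  | h1 => simp [transferPoly]
  | h2 => simp [transferPoly]
  | h k h1 h2 =>
    rw [transferPoly_add_three, Polynomial.eval_sub, Polynomial.eval_mul_X, Polynomial.eval_C_mul,
      h1, h2, transferSeq_add_three, ← Algebra.commutes, ← Algebra.smul_def]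

lemma coeff_transferPoly_mem (b : ℕ → A) (S : Subalgebra ℂ A) (hS : ∀ j, b j ∈ S) (k s : ℕ) :
    (transferPoly b k).coeff s ∈ S := by
  induction k using three_step_induction generalizing s with
  | h0 => simp only [transferPoly, Polynomial.coeff_one]; split_ifs; exacts [one_mem _, zero_mem _]
  | h1 => simp only [transferPoly, Polynomial.coeff_one]; split_ifs; exacts [one_mem _, zero_mem _]
  | h2 => simp only [transferPoly, Polynomial.coeff_one]; split_ifs; exacts [one_mem _, zero_mem _]
  | h k h1 h2 =>
    cases s with
    | zero => simp [coeff_zero_transferPoly]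
    | succ s =>
      rw [coeff_succ_transferPoly]
      exact sub_mem (h2 _) (mul_mem (hS k) (h1 _))

/-- A polynomial with coefficients in an algebra over a field vanishes if it has more zeros among
the scalars than its degree. -/
lemma eq_zero_of_eval_eq_zero {K B : Type*} [Field K] [Ring B] [Algebra K B] (F : B[X])
    (s : Finset K) (hs : F.natDegree < s.card)
    (h : ∀ u ∈ s, F.eval (algebraMap K B u) = 0) : F = 0 := by
  ext n
  rw [Polynomial.coeff_zero, ← Module.forall_dual_apply_eq_zero_iff K]
  intro f
  -- A linear functional applied to the coefficients reduces the claim to root counting over the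
  -- field.
  let g : K[X] := ∑ i ∈ Finset.range (F.natDegree + 1), Polynomial.monomial i (f (F.coeff i))
  have hdeg : g.natDegree < s.card := by
    refine lt_of_le_of_lt ?_ hs
    refine Polynomial.natDegree_sum_le_of_forall_le _ _ fun i hi => ?_
    exact (Polynomial.natDegree_monomial_le _).trans (by simp at hi; omega)
  have hg : g = 0 := by
    refine Polynomial.eq_zero_of_natDegree_lt_card_of_eval_eq_zero' g s (fun u hu => ?_) hdeg
    have := congrArg f (h u hu)
    rw [Polynomial.eval_eq_sum_range, map_sum, map_zero] at this
    rw [Polynomial.eval_finsetSum, ← this]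
    refine Finset.sum_congr rfl fun i _ => ?_
    rw [Polynomial.eval_monomial, ← map_pow, ← Algebra.commutes, ← Algebra.smul_def, map_smul,
      smul_eq_mul, mul_comm]
  by_cases hn : n ≤ F.natDegree
  · have := congrArg (fun p => p.coeff n) hg
    simpa [g, Polynomial.finsetSum_coeff, Polynomial.coeff_monomial, Nat.lt_succ_of_le hn] using this
  · rw [Polynomial.coeff_eq_zero_of_natDegree_lt (by omega), map_zero]

lemma eq_zero_of_forall_eval_eq_zero {K B : Type*} [Field K] [Infinite K] [Ring B] [Algebra K B]
    (F : B[X]) (h : ∀ u : K, F.eval (algebraMap K B u) = 0) : F = 0 := by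
  obtain ⟨s, hs⟩ := Infinite.exists_subset_card_eq K (F.natDegree + 1)
  exact eq_zero_of_eval_eq_zero F s (by omega) fun u _ => h u

/-- If all scalar values of two polynomials commute, then so do the coefficients. -/
lemma commute_coeff_of_commute_eval {K B : Type*} [Field K] [Infinite K] [Ring B] [Algebra K B]
    (F G : B[X])
    (h : ∀ u w : K, Commute (F.eval (algebraMap K B u)) (G.eval (algebraMap K B w))) (i j : ℕ) :
    Commute (F.coeff i) (G.coeff j) := by
  have key : ∀ (F : B[X]) (x : B), (∀ u : K, Commute (F.eval (algebraMap K B u)) x) →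
      ∀ i, Commute (F.coeff i) x := by
    intro F x hx i
    have h0 := eq_zero_of_forall_eval_eq_zero (K := K) (F * Polynomial.C x - Polynomial.C x * F)
      fun u => by
        have e : (F * Polynomial.C x).eval (algebraMap K B u) =
            F.eval (algebraMap K B u) * x :=
          Polynomial.eval_mul_C_of_commute (Algebra.commutes u x).symm
        rw [Polynomial.eval_sub, e, Polynomial.eval_C_mul, (hx u).eq, sub_self]
    have := congrArg (fun p => p.coeff i) h0
    simpa [sub_eq_zero, Commute, SemiconjBy] using this
  exact key F _ (fun u => (key G _ (fun w => (h u w).symm) j).symm) i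

variable {b : ℕ → A} {a : ℕ → ℝ}

lemma IsScaled.commute_coeff (hb : IsScaled b a) (k i j : ℕ) :
    Commute ((transferPoly b k).coeff i) ((transferPoly b k).coeff j) :=
  commute_coeff_of_commute_eval (K := ℂ) _ _ (fun u w => by
    simpa only [eval_transferPoly] using hb.commute_transferSeq u w k) i j

/-- An edge operator for the generators `b 0, …, b m`. -/
structure IsEdge (b : ℕ → A) (m : ℕ) (χ : A) : Prop where
  sq : χ * χ = 1
  comm : ∀ j, j < m → Commute χ (b j)
  anticomm : χ * b m = -(b m * χ)

namespace IsScaled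

/-- Conjugation by `χ` flips `b m` and nothing else, so only the increment from step `m + 2` to `m +
3` changes sign. -/
lemma edge_conj {m : ℕ} {χ : A} (hχ : IsEdge b m χ) (u : ℂ) :
    χ * transferSeq b u (m + 3) * χ =
      (2 : ℂ) • transferSeq b u (m + 2) - transferSeq b u (m + 3) := by
  have h1 : χ * transferSeq b u (m + 2) = transferSeq b u (m + 2) * χ :=
    (FFD.commute_transferSeq b u χ (m + 2) fun j hj => hχ.comm j (by omega)).eq
  have h2 : χ * transferSeq b u m = transferSeq b u m * χ :=
    (FFD.commute_transferSeq b u χ m fun j hj => hχ.comm j (by omega)).eq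
  have h3 : χ * (b m * transferSeq b u m) * χ = - (b m * transferSeq b u m) := by
    rw [← mul_assoc, hχ.anticomm, neg_mul, neg_mul, mul_assoc, mul_assoc, ← mul_assoc χ, h2,
      mul_assoc, hχ.sq, mul_one]
  rw [transferSeq_add_three, mul_sub, sub_mul, h1, mul_assoc, hχ.sq, mul_one, mul_smul_comm,
    smul_mul_assoc, h3]
  module

/-- By `edge_conj` both summands reduce to mixed products of neighbouring steps, whose
symmetrisation is scalar by `succ_inversion`. At a zero of the last polynomial the scalar is four
times its predecessor; this nonzero value later makes the sector traces equal. -/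
lemma edge_anticomm (hb : IsScaled b a) {m : ℕ} {χ : A} (hχ : IsEdge b m χ) (u : ℂ) :
    transferSeq b u (m + 3) * χ * transferSeq b (-u) (m + 3) * χ +
      χ * transferSeq b u (m + 3) * χ * transferSeq b (-u) (m + 3) =
    (4 * polyVal a (u ^ 2) (m + 2) - 2 * polyVal a (u ^ 2) (m + 3)) • (1 : A) := by
  rw [edge_conj hχ, mul_assoc, mul_assoc, ← mul_assoc χ, edge_conj hχ, mul_sub, sub_mul,
    hb.inversion, mul_smul_comm, smul_mul_assoc]
  have := hb.succ_inversion u (m + 2)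
  linear_combination (norm := module) (2 : ℂ) • this

lemma edge_exchange (hb : IsScaled b a) {m : ℕ} {χ : A} (hχ : IsEdge b m χ) (u : ℂ) :
    transferSeq b u (m + 3) * (χ + u • (b m * χ)) =
      (χ - u • (b m * χ)) * transferSeq b u (m + 3) := by
  have h1 : χ * transferSeq b u (m + 2) = transferSeq b u (m + 2) * χ :=
    (FFD.commute_transferSeq b u χ (m + 2) fun j hj => hχ.comm j (by omega)).eq
  have h2 : χ * transferSeq b u m = transferSeq b u m * χ :=
    (FFD.commute_transferSeq b u χ m fun j hj => hχ.comm j (by omega)).eq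
  have h3 := hb.add_two_mul u m
  have h4 := hb.commute_self u m
  have h5 := hχ.anticomm
  have h6 := hb.sq m
  rw [transferSeq_add_three]
  generalize transferSeq b u (m + 2) = s at *
  generalize transferSeq b u m = t at *
  generalize b m = d at *
  have e1 : s * (d * χ) = (2 : ℂ) • (d * (t * χ)) - d * (s * χ) := by
    rw [← mul_assoc, h3]; simp only [mul_assoc, sub_mul, mul_sub, smul_mul_assoc, mul_smul_comm]
  have e2 : t * (d * χ) = d * (t * χ) := by rw [← mul_assoc, h4, mul_assoc]
  have e3 : χ * (d * t) = - (d * (t * χ)) := by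
    rw [← mul_assoc, h5, neg_mul, mul_assoc, h2]
  simp only [mul_add, sub_mul, mul_sub, mul_smul_comm, smul_mul_assoc, mul_assoc, e1, e2, h1, e3]
  simp only [mul_neg]
  module

/-- The coefficient of degree one is minus the Hamiltonian. Thus `b m * χ` in `edge_exchange` can be
replaced by a commutator with a member of the commuting family, which acts as a scalar between two
sectors. -/
lemma edge_commutator {m : ℕ} {χ : A} (hχ : IsEdge b m χ) :
    (transferPoly b (m + 3)).coeff 1 * χ - χ * (transferPoly b (m + 3)).coeff 1 =
      -((2 : ℂ) • (b m * χ)) := by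
  have h1 := (commute_coeff_transferPoly b χ (m + 2) (fun j hj => hχ.comm j (by omega)) 1).eq
  rw [coeff_succ_transferPoly, coeff_zero_transferPoly, mul_one, sub_mul, mul_sub, h1, hχ.anticomm,
    two_smul]
  abel

end IsScaled

end TransferPoly

/-! ### The polynomials `P_m`: degree, real positive roots, simplicity. -/

section PolyShift

open Polynomial in
lemma polyShift_add_three (a : ℕ → ℝ) (k : ℕ) :
    polyShift a (k + 3) = polyShift a (k + 2) - X * C (a k ^ 2) * polyShift a k := rfl

lemma polySeq_eq_polyShift (a : ℕ → ℝ) (m : ℕ) : polySeq a m = polyShift a (m + 2) := by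
  induction m using three_step_induction with
  | h0 => simp [polySeq, polyShift]
  | h1 => simp [polySeq, polyShift]
  | h2 => simp [polySeq, polyShift]
  | h k h1 h2 => rw [polySeq, h1, h2, polyShift_add_three a (k + 2)]

/-- The first summand on the right is strictly positive in the upper half plane unless the previous
polynomial vanishes; this drives `polyVal_ne_zero`. -/
lemma im_star_mul_polyVal_succ (a : ℕ → ℝ) (x : ℂ) (k : ℕ) :
    (star (polyVal a x (k + 3)) * (x * polyVal a x (k + 2))).im =
      x.im * Complex.normSq (polyVal a x (k + 2)) +
        a k ^ 2 * Complex.normSq x * (star (polyVal a x (k + 2)) * polyVal a x k).im := by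
  rw [polyVal_add_three]
  simp [Complex.normSq_apply, pow_two]
  ring

/-- The recursion keeps the Herglotz property: the quotients of nearby polynomials have definite
imaginary parts in the upper half plane. -/
lemma herglotz (a : ℕ → ℝ) (x : ℂ) (hx : 0 < x.im) (k : ℕ) :
    0 ≤ (star (polyVal a x (k + 1)) * polyVal a x k).im ∧
    0 ≤ (star (polyVal a x (k + 2)) * polyVal a x (k + 1)).im ∧
    0 ≤ (star (polyVal a x (k + 2)) * polyVal a x k).im ∧
    0 ≤ (star (polyVal a x (k + 1)) * (x * polyVal a x k)).im ∧
    0 ≤ (star (polyVal a x (k + 2)) * (x * polyVal a x (k + 1))).im ∧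
    0 ≤ (star (polyVal a x (k + 2)) * (x * polyVal a x k)).im := by
  -- Each new imaginary part is a combination of old ones with nonnegative coefficients, plus a
  -- nonnegative term in one case. The versions with and without the factor `x` feed each other.
  induction k with
  | zero => simp [hx.le]
  | succ k ih =>
    obtain ⟨w1, w1', w2, v1, v1', v2⟩ := ih
    have e1 : (star (polyVal a x (k + 3)) * polyVal a x (k + 2)).im =
        a k ^ 2 * (star (polyVal a x (k + 2)) * (x * polyVal a x k)).im := by
      rw [polyVal_add_three]
      simp [pow_two]
      ring
    have e2 : (star (polyVal a x (k + 3)) * polyVal a x (k + 1)).im =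
        (star (polyVal a x (k + 2)) * polyVal a x (k + 1)).im +
        a k ^ 2 * (star (polyVal a x (k + 1)) * (x * polyVal a x k)).im := by
      rw [polyVal_add_three]
      simp [pow_two]
      ring
    have e3 : (star (polyVal a x (k + 3)) * (x * polyVal a x (k + 1))).im =
        (star (polyVal a x (k + 2)) * (x * polyVal a x (k + 1))).im +
        a k ^ 2 * Complex.normSq x * (star (polyVal a x (k + 1)) * polyVal a x k).im := by
      rw [polyVal_add_three]
      simp [Complex.normSq_apply, pow_two]
      ring
    have hn := Complex.normSq_nonneg x
    have hn' := Complex.normSq_nonneg (polyVal a x (k + 2))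
    have e4 := im_star_mul_polyVal_succ a x k
    refine ⟨w1', ?_, ?_, v1', ?_, ?_⟩ <;>
      simp only [show k + 1 + 2 = k + 3 from rfl, show k + 1 + 1 = k + 2 from rfl, e1, e2, e3, e4]
      <;> positivity

lemma polyVal_ne_zero (a : ℕ → ℝ) (x : ℂ) (hx : 0 < x.im) (k : ℕ) : polyVal a x k ≠ 0 := by
  have step : ∀ k, polyVal a x (k + 2) ≠ 0 := by
    intro k
    induction k with
    | zero => simp
    | succ k ih =>
      intro h0
      have e := im_star_mul_polyVal_succ a x k
      have h1 := (herglotz a x hx k).2.2.1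
      rw [show k + 1 + 2 = k + 3 from rfl] at h0
      rw [h0] at e
      have := Complex.normSq_pos.2 ih
      have := Complex.normSq_nonneg x
      have h2 : 0 < x.im * Complex.normSq (polyVal a x (k + 2)) := by positivity
      have h3 : 0 ≤ a k ^ 2 * Complex.normSq x * (star (polyVal a x (k + 2)) * polyVal a x k).im := by
        positivity
      simp only [star_zero, zero_mul, Complex.zero_im] at e
      linarith
  match k with
  | 0 => simp
  | 1 => simp
  | k + 2 => exact step k

open Polynomial in
lemma polyVal_conj (a : ℕ → ℝ) (x : ℂ) (k : ℕ) :
    polyVal a (starRingEnd ℂ x) k = starRingEnd ℂ (polyVal a x k) := by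
  rw [polyVal, polyVal, ← Polynomial.aeval_conj]

lemma polyVal_ne_zero_of_im_ne_zero (a : ℕ → ℝ) (x : ℂ) (hx : x.im ≠ 0) (k : ℕ) :
    polyVal a x k ≠ 0 := by
  rcases lt_or_gt_of_ne hx with h | h
  · have := polyVal_ne_zero a (starRingEnd ℂ x) (by simpa using h) k
    rw [polyVal_conj] at this
    exact fun h0 => this (by simp [h0])
  · exact polyVal_ne_zero a x h k

/-- For `x ≤ 0` the recursion only adds nonnegative terms; hence no root is nonpositive. -/
lemma one_le_eval_polyShift (a : ℕ → ℝ) (x : ℝ) (hx : x ≤ 0) (k : ℕ) :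
    1 ≤ (polyShift a k).eval x := by
  induction k using three_step_induction with
  | h0 => simp [polyShift]
  | h1 => simp [polyShift]
  | h2 => simp [polyShift]
  | h k h1 h2 =>
    have : 0 ≤ (-x) * a k ^ 2 * (polyShift a k).eval x := by
      have : 0 ≤ -x := by linarith
      positivity
    simp only [polyShift_add_three, Polynomial.eval_sub, Polynomial.eval_mul, Polynomial.eval_X,
      Polynomial.eval_C]
    linarith

lemma coeff_zero_polyShift (a : ℕ → ℝ) (k : ℕ) : (polyShift a k).coeff 0 = 1 := by
  induction k using three_step_induction with
  | h0 => simp [polyShift]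
  | h1 => simp [polyShift]
  | h2 => simp [polyShift]
  | h k h1 h2 => simp [polyShift_add_three, h2, mul_assoc]

lemma polyShift_ne_zero (a : ℕ → ℝ) (k : ℕ) : polyShift a k ≠ 0 := fun h => by
  simpa [h] using coeff_zero_polyShift a k

lemma natDegree_polyShift_le (a : ℕ → ℝ) (k : ℕ) : (polyShift a k).natDegree ≤ k / 3 := by
  induction k using three_step_induction with
  | h0 => simp [polyShift]
  | h1 => simp [polyShift]
  | h2 => simp [polyShift]
  | h k h1 h2 =>
    rw [polyShift_add_three]
    refine (Polynomial.natDegree_sub_le _ _).trans (max_le (h2.trans (by omega)) ?_)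
    refine Polynomial.natDegree_mul_le.trans ?_
    have := Polynomial.natDegree_mul_C_le (Polynomial.X : ℝ[X]) (a k ^ 2)
    have := Polynomial.natDegree_X_le (R := ℝ)
    omega

/-- Coefficients alternate in sign with the degree, so the two terms of the recursion cannot cancel
at the top degree `k / 3`. -/
lemma top_coeff_polyShift (a : ℕ → ℝ) (k : ℕ) :
    0 ≤ (-1) ^ (k / 3) * (polyShift a k).coeff (k / 3) ∧
      ((∀ j, j + 3 ≤ k → a j ≠ 0) → 0 < (-1) ^ (k / 3) * (polyShift a k).coeff (k / 3)) := by
  induction k using three_step_induction with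
  | h0 => simp [polyShift]
  | h1 => simp [polyShift]
  | h2 => simp [polyShift]
  | h k h1 h2 =>
    have e : (polyShift a (k + 3)).coeff ((k + 3) / 3) = (polyShift a (k + 2)).coeff ((k + 3) / 3) -
        a k ^ 2 * (polyShift a k).coeff (k / 3) := by
      rw [show (k + 3) / 3 = k / 3 + 1 by omega, polyShift_add_three, Polynomial.coeff_sub,
        mul_assoc, Polynomial.coeff_X_mul, Polynomial.coeff_C_mul]
    have h3 : 0 ≤ (-1) ^ ((k + 3) / 3) * (polyShift a (k + 2)).coeff ((k + 3) / 3) := by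
      by_cases hk : (k + 3) / 3 = (k + 2) / 3
      · rw [hk]; exact h2.1
      · rw [Polynomial.coeff_eq_zero_of_natDegree_lt, mul_zero]
        have := natDegree_polyShift_le a (k + 2)
        omega
    have e2 : (-1) ^ ((k + 3) / 3) * (polyShift a (k + 3)).coeff ((k + 3) / 3) =
        (-1) ^ ((k + 3) / 3) * (polyShift a (k + 2)).coeff ((k + 3) / 3) +
        a k ^ 2 * ((-1) ^ (k / 3) * (polyShift a k).coeff (k / 3)) := by
      rw [e, show (k + 3) / 3 = k / 3 + 1 by omega]; ring
    rw [e2]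
    refine ⟨add_nonneg h3 (mul_nonneg (sq_nonneg _) h1.1), fun h => ?_⟩
    have := h k le_rfl
    have := h1.2 fun j hj => h j (by omega)
    positivity

lemma natDegree_polyShift (a : ℕ → ℝ) (k : ℕ) (h : ∀ j, j + 3 ≤ k → a j ≠ 0) :
    (polyShift a k).natDegree = k / 3 := by
  refine le_antisymm (natDegree_polyShift_le a k) (Polynomial.le_natDegree_of_ne_zero fun h0 => ?_)
  have := (top_coeff_polyShift a k).2 h
  simp [h0] at this

/-- Every complex root is real by `polyVal_ne_zero_of_im_ne_zero`, so the splitting over `ℂ`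
descends to `ℝ`. -/
lemma splits_polyShift (a : ℕ → ℝ) (k : ℕ) : (polyShift a k).Splits := by
  refine Polynomial.Splits.of_splits_map (algebraMap ℝ ℂ) (IsAlgClosed.splits _) fun z hz => ?_
  have h0 : polyVal a z k = 0 := by
    have := Polynomial.isRoot_of_mem_roots hz
    rwa [Polynomial.IsRoot.def, Polynomial.eval_map_algebraMap] at this
  have him : z.im = 0 := by
    by_contra h
    exact polyVal_ne_zero_of_im_ne_zero a z h k h0
  exact ⟨z.re, by apply Complex.ext <;> simp [him]⟩

lemma roots_polyShift_pos (a : ℕ → ℝ) (k : ℕ) (x : ℝ) (hx : x ∈ (polyShift a k).roots) : 0 < x := by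
  by_contra h
  have h1 := one_le_eval_polyShift a x (not_lt.1 h) k
  have h2 : (polyShift a k).eval x = 0 := Polynomial.isRoot_of_mem_roots hx
  linarith

/-- A split polynomial with constant coefficient one as a product over its roots. -/
lemma eval_eq_prod_of_splits {K : Type*} [Field K] (p : K[X]) (hp : p.Splits)
    (h0 : p.coeff 0 = 1) (x : K) : p.eval x = (p.roots.map fun r => 1 - r⁻¹ * x).prod := by
  have h1 := hp.eval_eq_prod_roots x
  have h2 := hp.eval_eq_prod_roots 0
  rw [← Polynomial.coeff_zero_eq_eval_zero, h0] at h2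
  have hr : ∀ r ∈ p.roots, r ≠ 0 := by
    rintro r hr rfl
    have : p.eval 0 = 0 := Polynomial.isRoot_of_mem_roots hr
    rw [← Polynomial.coeff_zero_eq_eval_zero, h0] at this
    exact one_ne_zero this
  have h3 : (p.roots.map fun r => x - r).prod =
      (p.roots.map fun r => 0 - r).prod * (p.roots.map fun r => 1 - r⁻¹ * x).prod := by
    rw [← Multiset.prod_map_mul]
    congr 1
    refine Multiset.map_congr rfl fun r hr' => ?_
    field_simp [hr r hr']
    ring
  rw [h1, h3, ← mul_assoc, ← h2, one_mul]

/-- The roots of `P_M` in the form `v_k²`. -/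
lemma exists_roots_polyShift (a : ℕ → ℝ) (k : ℕ) :
    ∃ (n : ℕ) (v : Fin n → ℝ), (polyShift a k).natDegree = n ∧ (∀ i, 0 < v i) ∧
      (polyShift a k).roots = Finset.univ.val.map (fun i => v i ^ 2) ∧
      ∀ x : ℂ, polyVal a x k = ∏ i, (1 - x * ((v i : ℂ)⁻¹) ^ 2) := by
  have hc : (polyShift a k).roots.toList.length = (polyShift a k).natDegree := by
    rw [Multiset.length_toList, (splits_polyShift a k).natDegree_eq_card_roots]
  let r : Fin (polyShift a k).natDegree → ℝ := fun i => (polyShift a k).roots.toList.get (i.cast hc.symm)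
  have hr : Finset.univ.val.map r = (polyShift a k).roots := by
    conv_rhs => rw [← Multiset.coe_toList (polyShift a k).roots]
    have : List.ofFn r = (polyShift a k).roots.toList := by
      refine List.ext_get (by simp [hc]) fun i h1 h2 => by simp [r]
    rw [← this, Fin.univ_val_map]
  have hpos : ∀ i, 0 < r i := fun i => roots_polyShift_pos a k _ (by
    rw [← hr]; exact Multiset.mem_map_of_mem r (Finset.mem_univ i))
  refine ⟨_, fun i => √(r i), rfl, fun i => Real.sqrt_pos.2 (hpos i), ?_, fun x => ?_⟩
  · rw [← hr]
    exact Multiset.map_congr rfl fun i _ => (Real.sq_sqrt (hpos i).le).symm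
  · have hs : ((polyShift a k).map (algebraMap ℝ ℂ)).Splits := (splits_polyShift a k).map _
    rw [polyVal, ← Polynomial.eval_map_algebraMap, eval_eq_prod_of_splits _ hs (by
      simp [coeff_zero_polyShift]), (splits_polyShift a k).roots_map, ← hr, Multiset.map_map,
      Multiset.map_map]
    change ∏ i, _ = _
    refine Finset.prod_congr rfl fun i _ => ?_
    have : ((√(r i) : ℝ) : ℂ)⁻¹ ^ 2 = ((r i : ℝ) : ℂ)⁻¹ := by
      rw [inv_pow, ← Complex.ofReal_pow, Real.sq_sqrt (hpos i).le]
    simp [this, mul_comm]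

lemma polyVal_ofReal (a : ℕ → ℝ) (x : ℝ) (k : ℕ) :
    polyVal a (x : ℂ) k = (((polyShift a k).eval x : ℝ) : ℂ) := by
  rw [polyVal, ← Complex.coe_algebraMap, Polynomial.aeval_algebraMap_apply,
    Polynomial.coe_aeval_eq_eval]

/-- The Wronskian of `f` and `g` at `x`. -/
noncomputable def wronsk (f g : ℝ[X]) (x : ℝ) : ℝ :=
  f.eval x * g.derivative.eval x - f.derivative.eval x * g.eval x

/-! ### Wronskians on the real line. -/

section Wronskian

open Polynomial

variable (a : ℕ → ℝ) (x : ℝ) (k : ℕ)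

lemma wronsk_succ : wronsk (polyShift a (k + 3)) (polyShift a (k + 2)) x =
    a k ^ 2 * wronsk (polyShift a (k + 2)) (X * polyShift a k) x := by
  simp [wronsk, polyShift_add_three, -map_pow]; ring

lemma wronsk_add_two : wronsk (polyShift a (k + 3)) (polyShift a (k + 1)) x =
    wronsk (polyShift a (k + 2)) (polyShift a (k + 1)) x +
      a k ^ 2 * wronsk (polyShift a (k + 1)) (X * polyShift a k) x := by
  simp [wronsk, polyShift_add_three, -map_pow]; ring

lemma wronsk_X_succ : wronsk (polyShift a (k + 3)) (X * polyShift a (k + 2)) x =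
    (polyShift a (k + 2)).eval x ^ 2 +
      a k ^ 2 * x ^ 2 * wronsk (polyShift a (k + 2)) (polyShift a k) x := by
  simp [wronsk, polyShift_add_three, -map_pow]; ring

lemma wronsk_X_add_two : wronsk (polyShift a (k + 3)) (X * polyShift a (k + 1)) x =
    wronsk (polyShift a (k + 2)) (X * polyShift a (k + 1)) x +
      a k ^ 2 * x ^ 2 * wronsk (polyShift a (k + 1)) (polyShift a k) x := by
  simp [wronsk, polyShift_add_three, -map_pow]; ring

/-- The counterpart of `herglotz` on the real axis: where the denominator is nonzero, the Wronskian
has the sign of the derivative of the quotient `g / f`, and the same six quantities close under the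
recursion. Strict positivity excludes common roots of consecutive polynomials and double roots. -/
lemma wronsk_nonneg :
    0 ≤ wronsk (polyShift a (k + 1)) (polyShift a k) x ∧
    0 ≤ wronsk (polyShift a (k + 2)) (polyShift a (k + 1)) x ∧
    0 ≤ wronsk (polyShift a (k + 2)) (polyShift a k) x ∧
    0 ≤ wronsk (polyShift a (k + 1)) (X * polyShift a k) x ∧
    0 ≤ wronsk (polyShift a (k + 2)) (X * polyShift a (k + 1)) x ∧
    0 ≤ wronsk (polyShift a (k + 2)) (X * polyShift a k) x := by
  induction k with
  | zero => simp [wronsk, polyShift]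
  | succ k ih =>
    obtain ⟨w1, w1', w2, v1, v1', v2⟩ := ih
    refine ⟨w1', ?_, ?_, v1', ?_, ?_⟩ <;>
      simp only [show k + 1 + 2 = k + 3 from rfl, show k + 1 + 1 = k + 2 from rfl, wronsk_succ,
        wronsk_add_two, wronsk_X_succ, wronsk_X_add_two]
      <;> positivity

lemma wronsk_X_pos (hx : x ≠ 0) (h : ∀ j, j + 2 ≤ k → a j ≠ 0) :
    0 < wronsk (polyShift a (k + 1)) (X * polyShift a k) x := by
  induction k using three_step_induction with
  | h0 => simp [wronsk, polyShift]
  | h1 => simp [wronsk, polyShift]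
  | h2 =>
    rw [wronsk_X_succ]
    simp [polyShift, wronsk]
  | h k h1 h2 =>
    rw [show k + 3 + 1 = k + 1 + 3 from rfl, wronsk_X_succ, show k + 1 + 2 = k + 3 from rfl,
      wronsk_add_two]
    have := h1 fun j hj => h j (by omega)
    have := h k (by omega)
    have := h (k + 1) le_rfl
    have := (wronsk_nonneg a x k).2.1
    positivity

lemma wronsk_pos (hx : x ≠ 0) (h : ∀ j, j ≤ k → a j ≠ 0) :
    0 < wronsk (polyShift a (k + 3)) (polyShift a (k + 2)) x := by
  have h0 := h k le_rfl
  rw [wronsk_succ]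
  cases k with
  | zero => simp only [wronsk, polyShift, mul_one, eval_one, derivative_X, derivative_one, eval_zero,
      zero_mul, sub_zero]; positivity
  | succ k =>
    rw [wronsk_X_add_two]
    have := wronsk_X_pos a x (k + 1) hx fun j hj => h j (by omega)
    have := (wronsk_nonneg a x k).1
    positivity

end Wronskian

/-- For nonvanishing couplings, `P_M` and `P_{M-1}` have no common root. -/
lemma polyShift_eval_ne_zero (a : ℕ → ℝ) (k : ℕ) (h : ∀ j, j ≤ k → a j ≠ 0) (x : ℝ)
    (hx : x ∈ (polyShift a (k + 3)).roots) : (polyShift a (k + 2)).eval x ≠ 0 := by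
  have h1 := wronsk_pos a x k (roots_polyShift_pos a _ x hx).ne' h
  have h2 : (polyShift a (k + 3)).eval x = 0 := Polynomial.isRoot_of_mem_roots hx
  intro h3
  simp [wronsk, h2, h3] at h1

/-- For nonvanishing couplings, the roots of `P_M` are simple. -/
lemma nodup_roots_polyShift (a : ℕ → ℝ) (k : ℕ) (h : ∀ j, j ≤ k → a j ≠ 0) :
    (polyShift a (k + 3)).roots.Nodup := by
  rw [Multiset.nodup_iff_count_le_one]
  intro x
  by_contra! hc
  rw [Polynomial.count_roots] at hc
  have hx : x ∈ (polyShift a (k + 3)).roots := by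
    rw [← Multiset.count_pos, Polynomial.count_roots]; omega
  have h1 := wronsk_pos a x k (roots_polyShift_pos a _ x hx).ne' h
  have h2 : (polyShift a (k + 3)).eval x = 0 := Polynomial.isRoot_of_mem_roots hx
  have h3 := ((Polynomial.one_lt_rootMultiplicity_iff_isRoot (polyShift_ne_zero a _)).1 hc).2
  rw [Polynomial.IsRoot.def] at h3
  simp [wronsk, h2, h3] at h1

end PolyShift

/-! ### Decomposition of a commuting family into sectors labelled by signs. -/

section SignSectors

variable {n : ℕ}

/-- The polynomial `∏_k (1 - σ_k ε_k X)`. -/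
noncomputable def signPoly (ε : Fin n → ℂ) (σ : Fin n → ℤˣ) : ℂ[X] :=
  ∏ k, (1 - Polynomial.C (((σ k : ℤ) : ℂ) * ε k) * Polynomial.X)

lemma eval_signPoly (ε : Fin n → ℂ) (σ : Fin n → ℤˣ) (w : ℂ) :
    (signPoly ε σ).eval w = ∏ k, (1 - ((σ k : ℤ) : ℂ) * ε k * w) := by
  simp [signPoly, Polynomial.eval_prod]

lemma natDegree_signPoly (ε : Fin n → ℂ) (σ : Fin n → ℤˣ) : (signPoly ε σ).natDegree ≤ n := by
  refine (Polynomial.natDegree_prod_le _ _).trans ?_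
  calc _ ≤ ∑ _k : Fin n, 1 := Finset.sum_le_sum fun k _ => by
        compute_degree
    _ = n := by simp

/-- The mode parameters are nonzero and their squares are pairwise distinct. -/
structure IsGeneric (ε : Fin n → ℂ) : Prop where
  ne_zero : ∀ k, ε k ≠ 0
  eq_of_sq : ∀ k l, ε k ^ 2 = ε l ^ 2 → k = l

lemma unit_cast_sq (s : ℤˣ) : ((s : ℤ) : ℂ) * ((s : ℤ) : ℂ) = 1 := by
  rcases Int.units_eq_one_or s with rfl | rfl <;> simp

lemma unit_cast_ne_zero (s : ℤˣ) : ((s : ℤ) : ℂ) ≠ 0 := by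
  rcases Int.units_eq_one_or s with rfl | rfl <;> simp

lemma unit_cast_inj {s t : ℤˣ} (h : ((s : ℤ) : ℂ) = ((t : ℤ) : ℂ)) : s = t :=
  Units.ext (by exact_mod_cast h)

namespace IsGeneric

variable {ε : Fin n → ℂ}

lemma point_eq (hε : IsGeneric ε) {s t : ℤˣ} {k l : Fin n}
    (h : ((s : ℤ) : ℂ) * (ε k)⁻¹ = ((t : ℤ) : ℂ) * (ε l)⁻¹) : k = l ∧ s = t := by
  have hk := hε.ne_zero k
  have hl := hε.ne_zero l
  have h1 : k = l := by
    apply hε.eq_of_sq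
    have := congrArg (· ^ 2) h
    simp only [mul_pow, pow_two (((_ : ℤˣ) : ℤ) : ℂ), unit_cast_sq, one_mul, inv_pow,
      inv_inj] at this
    exact this
  subst h1
  exact ⟨rfl, unit_cast_inj (mul_right_cancel₀ (inv_ne_zero hk) h)⟩

lemma eval_signPoly_eq_zero (hε : IsGeneric ε) (σ : Fin n → ℤˣ) (s : ℤˣ) (k : Fin n) :
    (signPoly ε σ).eval (((s : ℤ) : ℂ) * (ε k)⁻¹) = 0 ↔ σ k = s := by
  rw [eval_signPoly, Finset.prod_eq_zero_iff]
  constructor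
  · rintro ⟨l, -, hl⟩
    have h1 : ((σ l : ℤ) : ℂ) * ε l * (((s : ℤ) : ℂ) * (ε k)⁻¹) = 1 := (sub_eq_zero.1 hl).symm
    have h2 : ((s : ℤ) : ℂ) * (ε k)⁻¹ = ((σ l : ℤ) : ℂ) * (ε l)⁻¹ := by
      have := unit_cast_sq (σ l)
      have := hε.ne_zero l
      rw [← mul_right_inj' (unit_cast_ne_zero (σ l)), ← mul_right_inj' this]
      rw [← mul_assoc, mul_comm (ε l), h1]
      field_simp
      rw [pow_two, unit_cast_sq]
    obtain ⟨rfl, h⟩ := hε.point_eq h2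
    exact h.symm
  · rintro rfl
    refine ⟨k, Finset.mem_univ k, ?_⟩
    have := hε.ne_zero k
    have h := unit_cast_sq (σ k)
    field_simp
    rw [pow_two, h, sub_self]

end IsGeneric

section Commutative

variable {C : Type*} [CommRing C] [Algebra ℂ C] {ε : Fin n → ℂ} {F : C[X]}

/-- A commuting family `T(u) = F(u)` of degree `n` with `T(u) T(-u) = ∏_k (1 - u² ε_k²)`. -/
structure IsFamily (ε : Fin n → ℂ) (F : C[X]) : Prop where
  degree : F.natDegree ≤ n
  coeff_zero : F.coeff 0 = 1
  inversion : ∀ u : ℂ, F.eval (algebraMap ℂ C u) * F.eval (algebraMap ℂ C (-u)) =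
    algebraMap ℂ C (∏ k, (1 - u ^ 2 * ε k ^ 2))

/-- The unnormalised projections to the sectors. -/
noncomputable def sector (ε : Fin n → ℂ) (F : C[X]) (σ : Fin n → ℤˣ) : C :=
  ∏ k, F.eval (algebraMap ℂ C (-(((σ k : ℤ) : ℂ) * (ε k)⁻¹)))

/-- Interpolation: both sides have degree at most `n` and agree at the `n + 1` points `0` and `σ_k /
ε_k`. At the latter points the factor `F(-σ_k / ε_k)` of the sector completes `F(σ_k / ε_k)` to an
instance of the inversion relation, which vanishes there. -/
lemma IsFamily.mul_sector (hε : IsGeneric ε) (hF : IsFamily ε F) (σ : Fin n → ℤˣ) :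
    F * Polynomial.C (sector ε F σ) =
      (signPoly ε σ).map (algebraMap ℂ C) * Polynomial.C (sector ε F σ) := by
  rw [← sub_eq_zero]
  let pt : Fin n → ℂ := fun k => ((σ k : ℤ) : ℂ) * (ε k)⁻¹
  have hinj : Function.Injective pt := fun k l h => (hε.point_eq h).1
  have hcard : (insert 0 (Finset.univ.image pt)).card = n + 1 := by
    rw [Finset.card_insert_of_notMem, Finset.card_image_of_injective _ hinj, Finset.card_fin]
    simp only [Finset.mem_image, Finset.mem_univ, true_and, not_exists]
    intro k hk
    exact mul_ne_zero (unit_cast_ne_zero _) (inv_ne_zero (hε.ne_zero k)) hk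
  refine eq_zero_of_eval_eq_zero (K := ℂ) _ (insert 0 (Finset.univ.image pt)) ?_ ?_
  · rw [hcard, Nat.lt_succ_iff, ← sub_mul]
    refine (Polynomial.natDegree_mul_C_le _ _).trans ((Polynomial.natDegree_sub_le _ _).trans ?_)
    exact max_le hF.degree (Polynomial.natDegree_map_le.trans (natDegree_signPoly ε σ))
  · intro u hu
    rw [Finset.mem_insert, Finset.mem_image] at hu
    rcases hu with rfl | ⟨k, -, rfl⟩
    · rw [map_zero, ← Polynomial.coeff_zero_eq_eval_zero, Polynomial.coeff_sub,
        Polynomial.coeff_mul_C, Polynomial.coeff_mul_C, hF.coeff_zero, Polynomial.coeff_map,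
        Polynomial.coeff_zero_eq_eval_zero (signPoly ε σ), eval_signPoly]
      simp
    · have h1 : F.eval (algebraMap ℂ C (pt k)) * sector ε F σ = 0 := by
        rw [sector, ← Finset.mul_prod_erase _ _ (Finset.mem_univ k), ← mul_assoc, hF.inversion,
          Finset.prod_eq_zero (Finset.mem_univ k), map_zero, zero_mul]
        have := hε.ne_zero k
        simp only [pt, mul_pow, pow_two (((_ : ℤˣ) : ℤ) : ℂ), unit_cast_sq]
        field_simp
        ring
      rw [Polynomial.eval_sub, Polynomial.eval_mul, Polynomial.eval_mul, Polynomial.eval_C, h1,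
        Polynomial.eval_map, Polynomial.eval₂_at_apply, (hε.eval_signPoly_eq_zero σ _ k).2 rfl]
      simp

lemma IsFamily.eval_mul_sector (hε : IsGeneric ε) (hF : IsFamily ε F) (σ : Fin n → ℤˣ) (w : ℂ) :
    F.eval (algebraMap ℂ C w) * sector ε F σ = (signPoly ε σ).eval w • sector ε F σ := by
  have := congrArg (Polynomial.eval (algebraMap ℂ C w)) (hF.mul_sector hε σ)
  rwa [Polynomial.eval_mul, Polynomial.eval_mul, Polynomial.eval_C, Polynomial.eval_map,
    Polynomial.eval₂_at_apply, ← Algebra.smul_def] at this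

/-- `1 / ε_k` is a simple zero of the right side of the inversion relation. Differentiating the
relation there writes a nonzero scalar as a combination of `F(1 / ε_k)` and `F(-1 / ε_k)`, so
nothing nonzero is annihilated by both. -/
lemma IsFamily.eq_zero_of_mul (hε : IsGeneric ε) (hF : IsFamily ε F) (k : Fin n) (y : C)
    (h1 : y * F.eval (algebraMap ℂ C ((ε k)⁻¹)) = 0)
    (h2 : y * F.eval (algebraMap ℂ C (-(ε k)⁻¹)) = 0) : y = 0 := by
  let p : ℂ[X] := ∏ k, (1 - Polynomial.X ^ 2 * Polynomial.C (ε k ^ 2))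
  have h0 : F * F.comp (-Polynomial.X) - p.map (algebraMap ℂ C) = 0 := by
    refine eq_zero_of_forall_eval_eq_zero (K := ℂ) _ fun u => ?_
    have := hF.inversion u
    rw [map_neg] at this
    rw [Polynomial.eval_sub, Polynomial.eval_mul, Polynomial.eval_comp, Polynomial.eval_neg,
      Polynomial.eval_X, this, Polynomial.eval_map, Polynomial.eval₂_at_apply]
    simp [p, Polynomial.eval_prod]
  have h3 := congrArg (fun q => (Polynomial.derivative q).eval (algebraMap ℂ C ((ε k)⁻¹))) h0
  simp only [Polynomial.derivative_sub, Polynomial.derivative_mul, Polynomial.derivative_comp,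
    Polynomial.derivative_neg, Polynomial.derivative_X, Polynomial.eval_sub, Polynomial.eval_add,
    Polynomial.eval_mul, Polynomial.eval_comp, Polynomial.eval_neg, Polynomial.eval_X,
    Polynomial.eval_one, Polynomial.derivative_map, Polynomial.derivative_zero,
    Polynomial.eval_zero, Polynomial.eval_map, Polynomial.eval₂_at_apply] at h3
  rw [map_neg] at h2
  have hp : p.derivative.eval ((ε k)⁻¹) ≠ 0 := by
    have hk := hε.ne_zero k
    simp only [p]
    rw [← Finset.mul_prod_erase _ _ (Finset.mem_univ k), Polynomial.derivative_mul,
      Polynomial.eval_add, Polynomial.eval_mul, Polynomial.eval_mul]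
    have e1 : (1 - Polynomial.X ^ 2 * Polynomial.C (ε k ^ 2)).eval ((ε k)⁻¹) = 0 := by
      simp [hk]
    have e2 : (1 - Polynomial.X ^ 2 * Polynomial.C (ε k ^ 2)).derivative.eval ((ε k)⁻¹) ≠ 0 := by
      simp [hk, -map_pow]
    rw [e1, zero_mul, add_zero, Polynomial.eval_prod]
    refine mul_ne_zero e2 (Finset.prod_ne_zero_iff.2 fun l hl h => ?_)
    have : ε k ^ 2 = ε l ^ 2 := by
      simp only [Polynomial.eval_sub, Polynomial.eval_one, Polynomial.eval_mul,
        Polynomial.eval_pow, Polynomial.eval_X, Polynomial.eval_C] at h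
      field_simp at h
      linear_combination h
    exact (Finset.ne_of_mem_erase hl) (hε.eq_of_sq k l this).symm
  have h4 : p.derivative.eval ((ε k)⁻¹) • y = 0 := by
    rw [Algebra.smul_def]
    linear_combination -y * h3 + (Polynomial.derivative F).eval (algebraMap ℂ C (ε k)⁻¹) * h2
      - (Polynomial.derivative F).eval (-algebraMap ℂ C (ε k)⁻¹) * h1
  exact (smul_eq_zero.1 h4).resolve_left hp

lemma IsFamily.eq_zero_of_sector (hε : IsGeneric ε) (hF : IsFamily ε F) (y : C)
    (h : ∀ σ, y * sector ε F σ = 0) : y = 0 := by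
  have key : ∀ (s : Finset (Fin n)) (y : C), (∀ σ : Fin n → ℤˣ,
      y * ∏ k ∈ s, F.eval (algebraMap ℂ C (-(((σ k : ℤ) : ℂ) * (ε k)⁻¹))) = 0) → y = 0 := by
    intro s
    induction s using Finset.induction_on with
    | empty => intro y hy; simpa using hy 1
    | insert k s hk ih =>
      intro y hy
      -- Splitting off mode `k`: both signs of `k` are available with every choice of signs on `s`,
      -- so the induction hypothesis applies to `y` times either factor.
      have step : ∀ t : ℤˣ, y * F.eval (algebraMap ℂ C (-(((t : ℤ) : ℂ) * (ε k)⁻¹))) = 0 := by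
        intro t
        refine ih _ fun σ => ?_
        have := hy (Function.update σ k t)
        rw [Finset.prod_insert hk, Function.update_self, ← mul_assoc] at this
        rw [← this]
        congr 1
        refine Finset.prod_congr rfl fun l hl => ?_
        rw [Function.update_of_ne (ne_of_mem_of_not_mem hl hk)]
      exact hF.eq_zero_of_mul hε k y (by simpa using step (-1)) (by simpa using step 1)
  exact key Finset.univ y h

/-- The normalised sector projections. -/
noncomputable def sectorProj (ε : Fin n → ℂ) (F : C[X]) (σ : Fin n → ℤˣ) : C :=
  (∏ k, (signPoly ε σ).eval (-(((σ k : ℤ) : ℂ) * (ε k)⁻¹)))⁻¹ • sector ε F σ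

lemma IsFamily.sector_mul (hε : IsGeneric ε) (hF : IsFamily ε F) (σ τ : Fin n → ℤˣ) :
    sector ε F σ * sector ε F τ =
      (∏ k, (signPoly ε τ).eval (-(((σ k : ℤ) : ℂ) * (ε k)⁻¹))) • sector ε F τ := by
  have key : ∀ s : Finset (Fin n),
      (∏ k ∈ s, F.eval (algebraMap ℂ C (-(((σ k : ℤ) : ℂ) * (ε k)⁻¹)))) * sector ε F τ =
      (∏ k ∈ s, (signPoly ε τ).eval (-(((σ k : ℤ) : ℂ) * (ε k)⁻¹))) • sector ε F τ := by
    intro s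
    induction s using Finset.induction_on with
    | empty => simp
    | insert k s hk ih =>
      rw [Finset.prod_insert hk, Finset.prod_insert hk, mul_assoc, ih, mul_smul_comm,
        hF.eval_mul_sector hε, smul_smul, mul_comm]
  exact key Finset.univ

lemma IsGeneric.eval_neg_eq_zero (hε : IsGeneric ε) (σ : Fin n → ℤˣ) (s : ℤˣ) (k : Fin n) :
    (signPoly ε σ).eval (-(((s : ℤ) : ℂ) * (ε k)⁻¹)) = 0 ↔ σ k = -s := by
  rw [← hε.eval_signPoly_eq_zero σ (-s) k]
  simp

lemma IsGeneric.norm_ne_zero (hε : IsGeneric ε) (σ : Fin n → ℤˣ) :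
    ∏ k, (signPoly ε σ).eval (-(((σ k : ℤ) : ℂ) * (ε k)⁻¹)) ≠ 0 := by
  refine Finset.prod_ne_zero_iff.2 fun k _ h => ?_
  exact units_ne_neg_self _ ((hε.eval_neg_eq_zero σ _ k).1 h)

lemma IsFamily.sectorProj_sq (hε : IsGeneric ε) (hF : IsFamily ε F) (σ : Fin n → ℤˣ) :
    sectorProj ε F σ * sectorProj ε F σ = sectorProj ε F σ := by
  have := hε.norm_ne_zero σ
  rw [sectorProj, smul_mul_smul_comm, hF.sector_mul hε, smul_smul]
  congr 1
  field_simp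

lemma IsFamily.eval_mul_sectorProj (hε : IsGeneric ε) (hF : IsFamily ε F) (σ : Fin n → ℤˣ)
    (w : ℂ) : F.eval (algebraMap ℂ C w) * sectorProj ε F σ =
      (signPoly ε σ).eval w • sectorProj ε F σ := by
  rw [sectorProj, mul_smul_comm, hF.eval_mul_sector hε, smul_comm]

lemma IsFamily.coeff_one_mul_sectorProj (hε : IsGeneric ε) (hF : IsFamily ε F) (σ : Fin n → ℤˣ) :
    F.coeff 1 * sectorProj ε F σ = (signPoly ε σ).coeff 1 • sectorProj ε F σ := by
  have := congrArg (fun p => p.coeff 1) (hF.mul_sector hε σ)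
  simp only [Polynomial.coeff_mul_C, Polynomial.coeff_map] at this
  rw [sectorProj, mul_smul_comm, this, ← Algebra.smul_def, smul_comm]

/-- Every sector annihilates `1 - ∑ σ, sectorProj ε F σ`, because sectors for different signs
multiply to zero; `eq_zero_of_sector` then makes it vanish. -/
lemma IsFamily.sum_sectorProj (hε : IsGeneric ε) (hF : IsFamily ε F) :
    ∑ σ, sectorProj ε F σ = 1 := by
  symm
  rw [← sub_eq_zero]
  refine hF.eq_zero_of_sector hε _ fun τ => ?_
  rw [sub_mul, one_mul, Finset.sum_mul, Finset.sum_eq_single τ, sub_eq_zero]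
  · rw [sectorProj, smul_mul_assoc, hF.sector_mul hε, smul_smul, inv_mul_cancel₀, one_smul]
    exact hε.norm_ne_zero τ
  · intro σ _ hne
    rw [sectorProj, smul_mul_assoc, hF.sector_mul hε]
    obtain ⟨k, hk⟩ := Function.ne_iff.1 hne
    rw [smul_comm, Finset.prod_eq_zero (Finset.mem_univ k), zero_smul]
    rw [hε.eval_neg_eq_zero]
    rcases Int.units_eq_one_or (σ k) with h | h <;>
      rcases Int.units_eq_one_or (τ k) with h' | h' <;> simp_all
  · simp

end Commutative

/-! ### Edge operators force equal traces of all sectors. -/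

section EdgeTrace

variable {C A : Type*} [CommRing C] [Algebra ℂ C] [Ring A] [Algebra ℂ A] {ε : Fin n → ℂ} {F : C[X]}

/-- An edge operator `χ` for a commuting family in a larger algebra. -/
structure IsEdgeFor (ε : Fin n → ℂ) (F : C[X]) (ι : C →ₐ[ℂ] A) (χ : A) (g : ℂ → ℂ) : Prop where
  exchange : ∀ u : ℂ, ι (F.eval (algebraMap ℂ C u)) *
      (χ - (u / 2) • (ι (F.coeff 1) * χ - χ * ι (F.coeff 1))) =
    (χ + (u / 2) • (ι (F.coeff 1) * χ - χ * ι (F.coeff 1))) * ι (F.eval (algebraMap ℂ C u))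
  anticomm : ∀ u : ℂ, ι (F.eval (algebraMap ℂ C u)) * χ * ι (F.eval (algebraMap ℂ C (-u))) * χ +
    χ * ι (F.eval (algebraMap ℂ C u)) * χ * ι (F.eval (algebraMap ℂ C (-u))) = g u • (1 : A)
  even : ∀ u, g (-u) = g u
  ne_zero : ∀ k, g ((ε k)⁻¹) ≠ 0

variable {ι : C →ₐ[ℂ] A} {χ : A} {g : ℂ → ℂ}

namespace IsEdgeFor

lemma eval_mul (hε : IsGeneric ε) (hF : IsFamily ε F) (σ : Fin n → ℤˣ) (w : ℂ) :
    ι (F.eval (algebraMap ℂ C w)) * ι (sectorProj ε F σ) =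
      (signPoly ε σ).eval w • ι (sectorProj ε F σ) := by
  rw [← map_mul, hF.eval_mul_sectorProj hε, map_smul]

lemma mul_eval (hε : IsGeneric ε) (hF : IsFamily ε F) (σ : Fin n → ℤˣ) (w : ℂ) :
    ι (sectorProj ε F σ) * ι (F.eval (algebraMap ℂ C w)) =
      (signPoly ε σ).eval w • ι (sectorProj ε F σ) := by
  rw [← map_mul, mul_comm, hF.eval_mul_sectorProj hε, map_smul]

/-- Off-diagonal blocks of the edge operator connect sectors that differ by a single sign. -/
lemma eq_update (hε : IsGeneric ε) (hF : IsFamily ε F) (hχ : IsEdgeFor ε F ι χ g)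
    (σ τ : Fin n → ℤˣ) (k : Fin n) (hk : τ k ≠ σ k)
    (h : ι (sectorProj ε F τ) * χ * ι (sectorProj ε F σ) ≠ 0) :
    τ = Function.update σ k (-σ k) := by
  set D : ℂ := (signPoly ε τ).coeff 1 - (signPoly ε σ).coeff 1 with hD
  have hcτ : ι (sectorProj ε F τ) * ι (F.coeff 1) =
      (signPoly ε τ).coeff 1 • ι (sectorProj ε F τ) := by
    rw [← map_mul, mul_comm, hF.coeff_one_mul_sectorProj hε, map_smul]
  have hcσ : ι (F.coeff 1) * ι (sectorProj ε F σ) =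
      (signPoly ε σ).coeff 1 • ι (sectorProj ε F σ) := by
    rw [← map_mul, hF.coeff_one_mul_sectorProj hε, map_smul]
  -- The exchange relation between the projections to `τ` and `σ`: everything acts as a scalar on
  -- the block of `χ`, and that block is nonzero.
  have key : ∀ u : ℂ, (signPoly ε τ).eval u * (1 - u / 2 * D) =
      (1 + u / 2 * D) * (signPoly ε σ).eval u := by
    intro u
    have h1 := congrArg (fun x => ι (sectorProj ε F τ) * x * ι (sectorProj ε F σ)) (hχ.exchange u)
    have h2 : ι (sectorProj ε F τ) * (ι (F.coeff 1) * χ - χ * ι (F.coeff 1)) *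
        ι (sectorProj ε F σ) = D • (ι (sectorProj ε F τ) * χ * ι (sectorProj ε F σ)) := by
      rw [mul_sub, sub_mul, ← mul_assoc, hcτ, smul_mul_assoc, smul_mul_assoc,
        mul_assoc _ (χ * _), mul_assoc χ, hcσ, mul_smul_comm, mul_smul_comm, ← mul_assoc,
        ← sub_smul]
    have h3 : ∀ x : A, ι (sectorProj ε F τ) * (ι (F.eval (algebraMap ℂ C u)) * x) *
        ι (sectorProj ε F σ) =
        (signPoly ε τ).eval u • (ι (sectorProj ε F τ) * x * ι (sectorProj ε F σ)) := by
      intro x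
      rw [← mul_assoc, mul_eval hε hF, smul_mul_assoc, smul_mul_assoc]
    have h4 : ∀ x : A, ι (sectorProj ε F τ) * (x * ι (F.eval (algebraMap ℂ C u))) *
        ι (sectorProj ε F σ) =
        (signPoly ε σ).eval u • (ι (sectorProj ε F τ) * x * ι (sectorProj ε F σ)) := by
      intro x
      rw [mul_assoc, mul_assoc, eval_mul hε hF, mul_smul_comm, mul_smul_comm, mul_assoc]
    simp only [h3, h4] at h1
    simp only [mul_sub, sub_mul, mul_add, add_mul, mul_smul_comm, smul_mul_assoc] at h1 h2
    rw [h2] at h1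
    have h5 : ((signPoly ε τ).eval u * (1 - u / 2 * D) - (1 + u / 2 * D) * (signPoly ε σ).eval u) •
        (ι (sectorProj ε F τ) * χ * ι (sectorProj ε F σ)) = 0 := by
      linear_combination (norm := module) h1
    exact sub_eq_zero.1 ((smul_eq_zero.1 h5).resolve_right h)
  set p : ℂ := ((σ k : ℤ) : ℂ) * (ε k)⁻¹ with hp
  have hp0 : p ≠ 0 := mul_ne_zero (unit_cast_ne_zero _) (inv_ne_zero (hε.ne_zero k))
  have hσ : (signPoly ε σ).eval p = 0 := (hε.eval_signPoly_eq_zero σ _ k).2 rfl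
  have hτ : (signPoly ε τ).eval p ≠ 0 := fun h0 => hk ((hε.eval_signPoly_eq_zero τ _ k).1 h0)
  -- At `u = p` the right side of `key` vanishes and the sign polynomial of `τ` does not. This fixes
  -- `D`, so `p` is the only point where the linear factor on the left vanishes.
  have hDp : 1 - p / 2 * D = 0 := by
    have := key p
    rw [hσ, mul_zero] at this
    exact (mul_eq_zero.1 this).resolve_left hτ
  funext l
  by_cases hl : l = k
  · subst hl
    rw [Function.update_self]
    rcases Int.units_eq_one_or (σ l) with h | h <;>
      rcases Int.units_eq_one_or (τ l) with h' | h' <;> simp_all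
  · rw [Function.update_of_ne hl]
    -- For `l ≠ k` the linear factor is nonzero at the zero `σ_l / ε_l`, so `τ` shares this zero and
    -- `τ l = σ l`.
    have h1 := key (((σ l : ℤ) : ℂ) * (ε l)⁻¹)
    rw [(hε.eval_signPoly_eq_zero σ _ l).2 rfl, mul_zero] at h1
    refine (hε.eval_signPoly_eq_zero τ _ l).1 ((mul_eq_zero.1 h1).resolve_right fun h2 => ?_)
    have hD0 : D ≠ 0 := by
      rintro h0
      simp [h0] at hDp
    have h3 : ((σ l : ℤ) : ℂ) * (ε l)⁻¹ = p := by
      have : (((σ l : ℤ) : ℂ) * (ε l)⁻¹ - p) * D = 0 := by linear_combination 2 * (hDp - h2)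
      exact sub_eq_zero.1 ((mul_eq_zero.1 this).resolve_right hD0)
    exact hl (hε.point_eq h3).1

/-- The diagonal block of `χ P χ`, where `P` projects to the sector with one sign flipped. -/
lemma compress (hε : IsGeneric ε) (hF : IsFamily ε F) (hχ : IsEdgeFor ε F ι χ g)
    (σ : Fin n → ℤˣ) (k : Fin n) :
    ((signPoly ε σ).eval (-(((σ k : ℤ) : ℂ) * (ε k)⁻¹)) *
      (signPoly ε (Function.update σ k (-σ k))).eval (((σ k : ℤ) : ℂ) * (ε k)⁻¹)) •
      (ι (sectorProj ε F σ) * χ * ι (sectorProj ε F (Function.update σ k (-σ k))) * χ *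
        ι (sectorProj ε F σ)) = g ((ε k)⁻¹) • ι (sectorProj ε F σ) := by
  set p : ℂ := ((σ k : ℤ) : ℂ) * (ε k)⁻¹ with hp
  set E := ι (sectorProj ε F σ) with hE
  have hEE : E * E = E := by rw [hE, ← map_mul, hF.sectorProj_sq hε]
  have hg : g p = g ((ε k)⁻¹) := by
    rcases Int.units_eq_one_or (σ k) with h | h <;> simp [hp, h, hχ.even]
  have h0 : E * ι (F.eval (algebraMap ℂ C p)) = 0 := by
    rw [hE, mul_eval hε hF, (hε.eval_signPoly_eq_zero σ _ k).2 rfl, zero_smul]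
  have h1 : ι (F.eval (algebraMap ℂ C (-p))) * E = (signPoly ε σ).eval (-p) • E :=
    eval_mul hε hF σ _
  have h2 : χ * ι (F.eval (algebraMap ℂ C p)) * χ =
      ∑ τ, (signPoly ε τ).eval p • (χ * ι (sectorProj ε F τ) * χ) := by
    conv_lhs => rw [← mul_one (ι (F.eval (algebraMap ℂ C p))), ← map_one ι,
      ← hF.sum_sectorProj hε, map_sum, Finset.mul_sum, Finset.mul_sum, Finset.sum_mul]
    refine Finset.sum_congr rfl fun τ _ => ?_
    rw [eval_mul hε hF, mul_smul_comm, smul_mul_assoc]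
  -- In the sum over sectors, those with `τ k = σ k` have eigenvalue zero at `p`. Among the others
  -- `eq_update` leaves only the single flip at `k`.
  have h3 : E * (χ * ι (F.eval (algebraMap ℂ C p)) * χ) * E =
      (signPoly ε (Function.update σ k (-σ k))).eval p •
        (E * χ * ι (sectorProj ε F (Function.update σ k (-σ k))) * χ * E) := by
    rw [h2, Finset.mul_sum, Finset.sum_mul, Finset.sum_eq_single (Function.update σ k (-σ k))]
    · simp only [mul_smul_comm, smul_mul_assoc, mul_assoc]
    · intro τ _ hτ
      by_cases hk : τ k = σ k
      · rw [(hε.eval_signPoly_eq_zero τ _ k).2 hk, zero_smul, mul_zero, zero_mul]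
      · have : ι (sectorProj ε F τ) * χ * E = 0 := by
          by_contra h
          exact hτ (eq_update hε hF hχ σ τ k hk h)
        rw [mul_smul_comm, smul_mul_assoc, mul_assoc, mul_assoc, mul_assoc, ← mul_assoc _ χ E, this,
          mul_zero, mul_zero, smul_zero]
    · simp
  have h4 := congrArg (fun x => E * x * E) (hχ.anticomm p)
  simp only [mul_add, add_mul, mul_smul_comm, smul_mul_assoc, mul_one, hEE, hg] at h4
  have h5 : E * (χ * ι (F.eval (algebraMap ℂ C p)) * χ * ι (F.eval (algebraMap ℂ C (-p)))) * E =
      (signPoly ε σ).eval (-p) • (E * (χ * ι (F.eval (algebraMap ℂ C p)) * χ) * E) := by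
    rw [mul_assoc E _ E, mul_assoc _ _ E, h1, mul_smul_comm, mul_smul_comm, ← mul_assoc]
  have h6 : E * (ι (F.eval (algebraMap ℂ C p)) * χ * ι (F.eval (algebraMap ℂ C (-p))) * χ) * E =
      0 := by
    simp only [← mul_assoc, h0, zero_mul]
  rw [← h4, h6, zero_add, h5, h3, smul_smul]

variable (tr : A →ₗ[ℂ] ℂ)

/-- All sectors have the same trace. -/
lemma trace_update (htr : ∀ x y, tr (x * y) = tr (y * x)) (hε : IsGeneric ε) (hF : IsFamily ε F)
    (hχ : IsEdgeFor ε F ι χ g) (σ : Fin n → ℤˣ) (k : Fin n) :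
    tr (ι (sectorProj ε F (Function.update σ k (-σ k)))) = tr (ι (sectorProj ε F σ)) := by
  have h1 := congrArg tr (compress hε hF hχ σ k)
  have h2 := congrArg tr (compress hε hF hχ (Function.update σ k (-σ k)) k)
  set τ := Function.update σ k (-σ k) with hτ
  have hτk : τ k = -σ k := by rw [hτ, Function.update_self]
  have hτσ : Function.update τ k (-τ k) = σ := by
    rw [hτk, neg_neg, hτ, Function.update_idem, Function.update_eq_self]
  rw [hτσ, hτk] at h2
  -- Cyclicity identifies the traces of the two compressions, from `σ` through `τ` and from `τ`
  -- through `σ`. Their scalar prefactors agree up to order, so division by the nonzero value of `g`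
  -- equates the traces of the sectors.
  have cyc : ∀ σ τ : Fin n → ℤˣ, tr (ι (sectorProj ε F σ) * χ * ι (sectorProj ε F τ) * χ *
      ι (sectorProj ε F σ)) = tr (ι (sectorProj ε F σ) * χ * (ι (sectorProj ε F τ) * χ)) := by
    intro σ τ
    rw [htr, ← mul_assoc, ← mul_assoc, ← mul_assoc, ← map_mul, hF.sectorProj_sq hε, mul_assoc]
  rw [map_smul, map_smul, cyc] at h1 h2
  rw [htr] at h2
  have hs : -((((-σ k : ℤˣ) : ℤ) : ℂ) * (ε k)⁻¹) = ((σ k : ℤ) : ℂ) * (ε k)⁻¹ := by simp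
  have hs' : (((-σ k : ℤˣ) : ℤ) : ℂ) * (ε k)⁻¹ = -(((σ k : ℤ) : ℂ) * (ε k)⁻¹) := by simp
  rw [hs, hs', mul_comm (Polynomial.eval _ _)] at h2
  have := h1.symm.trans h2
  rw [smul_eq_mul, smul_eq_mul] at this
  exact (mul_left_cancel₀ (hχ.ne_zero k) this).symm

lemma trace_sectorProj (htr : ∀ x y, tr (x * y) = tr (y * x)) (hε : IsGeneric ε)
    (hF : IsFamily ε F) (hχ : IsEdgeFor ε F ι χ g) (σ : Fin n → ℤˣ) :
    2 ^ n * tr (ι (sectorProj ε F σ)) = tr 1 := by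
  have key : ∀ (σ : Fin n → ℤˣ) (s : Finset (Fin n)),
      tr (ι (sectorProj ε F (fun k => if k ∈ s then σ k else 1))) = tr (ι (sectorProj ε F 1)) := by
    intro σ s
    induction s using Finset.induction_on with
    | empty => rfl
    | insert k s hk ih =>
      rw [← ih]
      set ρ : Fin n → ℤˣ := fun k => if k ∈ s then σ k else 1 with hρ
      have h1 : (fun l => if l ∈ insert k s then σ l else 1) = Function.update ρ k (σ k) := by
        funext l
        by_cases hl : l = k
        · subst hl; simp
        · simp [hl, hρ]
      have h2 : ρ k = 1 := by simp [hρ, hk]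
      rw [h1]
      rcases Int.units_eq_one_or (σ k) with h | h
      · rw [h, ← h2, Function.update_eq_self]
      · rw [h, ← h2]
        exact trace_update tr htr hε hF hχ ρ k
  have hall : ∀ σ, tr (ι (sectorProj ε F σ)) = tr (ι (sectorProj ε F 1)) := fun σ => by
    simpa using key σ Finset.univ
  have h1 := congrArg (fun x => tr (ι x)) (hF.sum_sectorProj hε)
  simp only [map_sum, map_one, hall, Finset.sum_const, nsmul_eq_mul, Finset.card_univ,
    Fintype.card_pi, Fintype.card_units_int, Finset.prod_const, Fintype.card_fin] at h1
  rw [hall, ← h1]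
  norm_num

/-- The moments of `T(w)` are those of independent uniformly distributed signs. -/
lemma trace_pow (htr : ∀ x y, tr (x * y) = tr (y * x)) (hε : IsGeneric ε) (hF : IsFamily ε F)
    (hχ : IsEdgeFor ε F ι χ g) (w : ℂ) (j : ℕ) :
    2 ^ n * tr (ι (F.eval (algebraMap ℂ C w)) ^ j) =
      tr 1 * ∑ σ, (signPoly ε σ).eval w ^ j := by
  have hpow : ∀ σ, ι (F.eval (algebraMap ℂ C w)) ^ j * ι (sectorProj ε F σ) =
      (signPoly ε σ).eval w ^ j • ι (sectorProj ε F σ) := by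
    intro σ
    induction j with
    | zero => simp
    | succ j ih => rw [pow_succ, mul_assoc, eval_mul hε hF, mul_smul_comm, ih, smul_smul, pow_succ,
        mul_comm]
  have h1 : ι (F.eval (algebraMap ℂ C w)) ^ j =
      ∑ σ, (signPoly ε σ).eval w ^ j • ι (sectorProj ε F σ) := by
    rw [← mul_one (_ ^ j), ← map_one ι, ← hF.sum_sectorProj hε, map_sum, Finset.mul_sum]
    exact Finset.sum_congr rfl fun σ _ => hpow σ
  rw [h1, map_sum, Finset.mul_sum, Finset.mul_sum]
  refine Finset.sum_congr rfl fun σ _ => ?_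
  rw [map_smul, smul_eq_mul, ← trace_sectorProj tr htr hε hF hχ σ]
  ring

end IsEdgeFor

end EdgeTrace

end SignSectors

/-! ### Moments of the transfer matrix through values of `P_M`. -/

section Moments

/-- The even part of `(1 + z) ^ j` as a product. -/
lemma exists_even_part (j : ℕ) : ∃ c : Multiset ℂ, ∀ z : ℂ,
    (1 - z) ^ j + (1 + z) ^ j = 2 * (c.map fun r => 1 - r * z ^ 2).prod := by
  have h : ∀ j : ℕ, ∃ A B : ℂ[X], A.coeff 0 = 1 ∧
      ∀ z : ℂ, (1 + z) ^ j = A.eval (z ^ 2) + z * B.eval (z ^ 2) := by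
    intro j
    induction j with
    | zero => exact ⟨1, 0, by simp, by simp⟩
    | succ j ih =>
      obtain ⟨A, B, h0, h⟩ := ih
      refine ⟨A + Polynomial.X * B, A + B, by simp [h0], fun z => ?_⟩
      rw [pow_succ, h]
      simp
      ring
  obtain ⟨A, B, h0, h⟩ := h j
  refine ⟨A.roots.map (·⁻¹), fun z => ?_⟩
  have h1 := h z
  have h2 := h (-z)
  rw [Multiset.map_map]
  have h3 := eval_eq_prod_of_splits A (IsAlgClosed.splits A) h0 (z ^ 2)
  simp only [Function.comp_def]
  rw [← h3, h1, sub_eq_add_neg, h2]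
  simp
  ring

/-- The zeros of the even part of `(1 + z) ^ j`. -/
noncomputable def evenPart (j : ℕ) : Multiset ℂ := (exists_even_part j).choose

lemma evenPart_spec (j : ℕ) (z : ℂ) :
    (1 - z) ^ j + (1 + z) ^ j = 2 * ((evenPart j).map fun r => 1 - r * z ^ 2).prod :=
  (exists_even_part j).choose_spec z

/-- The sum over signs factorises over the modes; each factor is twice the even part of `(1 + z) ^
j` at `z = ε_k w`. Interchanging the product over modes with the product over the zeros `r` leaves
values of `∏ (1 - x ε_k²)` at `x = r w²`, with no reference to individual roots. -/
lemma sum_signPoly_pow {n : ℕ} (ε : Fin n → ℂ) (w : ℂ) (j : ℕ) :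
    ∑ σ, (signPoly ε σ).eval w ^ j =
      2 ^ n * ((evenPart j).map fun r => ∏ k, (1 - (r * w ^ 2) * ε k ^ 2)).prod := by
  have h1 : ∀ σ : Fin n → ℤˣ, (signPoly ε σ).eval w ^ j =
      ∏ k, (1 - ((σ k : ℤ) : ℂ) * ε k * w) ^ j := fun σ => by
    rw [eval_signPoly, Finset.prod_pow]
  simp only [h1]
  have h2 := (Finset.prod_univ_sum (fun _ : Fin n => (Finset.univ : Finset ℤˣ))
    (fun k s => (1 - ((s : ℤ) : ℂ) * ε k * w) ^ j)).symm
  rw [Fintype.piFinset_univ] at h2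
  rw [h2]
  have h3 : ∀ k, ∑ s : ℤˣ, (1 - ((s : ℤ) : ℂ) * ε k * w) ^ j =
      2 * ((evenPart j).map fun r => 1 - (r * w ^ 2) * ε k ^ 2).prod := by
    intro k
    have : (Finset.univ : Finset ℤˣ) = {1, -1} := by decide
    rw [this, Finset.sum_pair (by decide)]
    have h := evenPart_spec j (ε k * w)
    rw [show (fun r => 1 - (r * w ^ 2) * ε k ^ 2) = fun r => 1 - r * (ε k * w) ^ 2 by
      funext r; ring, ← h]
    simp
  simp only [h3, Finset.prod_mul_distrib, Finset.prod_const, Finset.card_univ, Fintype.card_fin]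
  rw [Multiset.prod_map_prod]

universe u

open scoped IsMulCommutative in
/-- A polynomial with pairwise commuting coefficients comes from a commutative subalgebra. -/
lemma exists_commutative_lift {A : Type u} [Ring A] [Algebra ℂ A] (G : A[X])
    (hG : ∀ i j, Commute (G.coeff i) (G.coeff j)) :
    ∃ (C : Type u) (_ : CommRing C) (_ : Algebra ℂ C) (ι : C →ₐ[ℂ] A) (F : C[X]),
      Function.Injective ι ∧ F.map (ι : C →+* A) = G ∧
        ∀ c, ι c ∈ Algebra.adjoin ℂ (Set.range G.coeff) := by
  have hcomm : ∀ x ∈ Set.range G.coeff, ∀ y ∈ Set.range G.coeff, x * y = y * x := by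
    rintro _ ⟨i, rfl⟩ _ ⟨j, rfl⟩
    exact hG i j
  have := Algebra.isMulCommutative_adjoin ℂ hcomm
  let ι : Algebra.adjoin ℂ (Set.range G.coeff) →ₐ[ℂ] A := Subalgebra.val _
  have hl : G ∈ Polynomial.lifts (ι : Algebra.adjoin ℂ (Set.range G.coeff) →+* A) := by
    rw [Polynomial.lifts_iff_coeff_lifts]
    intro n
    exact ⟨⟨G.coeff n, Algebra.subset_adjoin ⟨n, rfl⟩⟩, rfl⟩
  obtain ⟨F, hF⟩ := (Polynomial.mem_lifts G).1 hl
  exact ⟨Algebra.adjoin ℂ (Set.range G.coeff), inferInstance, inferInstance, ι, F,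
    Subtype.val_injective, hF, fun c => c.2⟩

variable {A : Type*} [Ring A] [Algebra ℂ A] {b : ℕ → A} {a : ℕ → ℝ}

/-- Moments of the transfer matrix and a projection to a sector, for nonvanishing couplings. -/
theorem IsScaled.generic_moments (hb : IsScaled b a) {m : ℕ} {χ : A} (hχ : IsEdge b m χ)
    (ha : ∀ j, j ≤ m → a j ≠ 0) (tr : A →ₗ[ℂ] ℂ) (htr : ∀ x y, tr (x * y) = tr (y * x)) :
    (∃ e ∈ Algebra.adjoin ℂ (Set.range b), e * e = e ∧ 2 ^ ((m + 3) / 3) * tr e = tr 1) ∧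
    ∀ (w : ℂ) (j : ℕ), tr (transferSeq b w (m + 3) ^ j) =
      tr 1 * ((evenPart j).map fun r => polyVal a (r * w ^ 2) (m + 3)).prod := by
  -- The sector analysis needs a commutative coefficient ring. Relations in `C` are checked in `A`
  -- through the injection `ι`.
  obtain ⟨C, _, _, ι, F, hι, hF, hmem⟩ := exists_commutative_lift (transferPoly b (m + 3))
    (fun i j => hb.commute_coeff (m + 3) i j)
  obtain ⟨n, v, hn, hv, hroots, hval⟩ := exists_roots_polyShift a (m + 3)
  have hdeg := natDegree_polyShift a (m + 3) fun j hj => ha j (by omega)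
  have heval : ∀ u : ℂ, ι (F.eval (algebraMap ℂ C u)) = transferSeq b u (m + 3) := by
    intro u
    rw [← eval_transferPoly, ← hF, Polynomial.eval_map, ← ι.commutes]
    exact (Polynomial.eval₂_at_apply (ι : C →+* A) _).symm
  have hcoeff : ∀ s, ι (F.coeff s) = (transferPoly b (m + 3)).coeff s := by
    intro s; rw [← hF, Polynomial.coeff_map]; rfl
  rw [hn] at hdeg
  set ε : Fin n → ℂ := fun i => ((v i : ℝ) : ℂ)⁻¹ with hεdef
  have hε : IsGeneric ε := by
    refine ⟨fun k => inv_ne_zero (by exact_mod_cast (hv k).ne'), fun k l h => ?_⟩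
    have hnd := nodup_roots_polyShift a m ha
    rw [hroots] at hnd
    simp only [hεdef, inv_pow, inv_inj] at h
    exact Multiset.inj_on_of_nodup_map hnd k (Finset.mem_univ k) l (Finset.mem_univ l)
      (by exact_mod_cast h)
  have hfam : IsFamily ε F := by
    refine ⟨?_, ?_, fun u => ?_⟩
    · rw [← Polynomial.natDegree_map_eq_of_injective (f := (ι : C →+* A)) hι, hF, hdeg]
      exact natDegree_transferPoly b (m + 3)
    · apply hι
      rw [hcoeff, coeff_zero_transferPoly, map_one]
    · apply hι
      rw [map_mul, heval, heval, hb.inversion, ι.commutes, ← hval, Algebra.algebraMap_eq_smul_one]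
  have hedge : IsEdgeFor ε F ι χ
      (fun u => 4 * polyVal a (u ^ 2) (m + 2) - 2 * polyVal a (u ^ 2) (m + 3)) := by
    refine ⟨fun u => ?_, fun u => ?_, fun u => by simp, fun k => ?_⟩
    · rw [heval, hcoeff, IsScaled.edge_commutator hχ, smul_neg, smul_smul,
        div_mul_cancel₀ _ (two_ne_zero' ℂ), sub_neg_eq_add, ← sub_eq_add_neg]
      exact hb.edge_exchange hχ u
    · rw [heval, heval]
      exact hb.edge_anticomm hχ u
    · have e1 : ((ε k)⁻¹) ^ 2 = ((v k ^ 2 : ℝ) : ℂ) := by simp [hεdef]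
      have hr : v k ^ 2 ∈ (polyShift a (m + 3)).roots := by
        rw [hroots]; exact Multiset.mem_map_of_mem (fun i => v i ^ 2) (Finset.mem_univ k)
      have e2 : polyVal a ((ε k)⁻¹ ^ 2) (m + 3) = 0 := by
        have : (polyShift a (m + 3)).eval (v k ^ 2) = 0 := Polynomial.isRoot_of_mem_roots hr
        rw [e1, polyVal_ofReal, this, Complex.ofReal_zero]
      -- Consecutive polynomials have no common root when the couplings do not vanish.
      have e3 : polyVal a ((ε k)⁻¹ ^ 2) (m + 2) ≠ 0 := by
        have := polyShift_eval_ne_zero a m ha (v k ^ 2) hr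
        rw [e1, polyVal_ofReal]
        exact_mod_cast this
      simp only [e2]
      simpa using e3
  constructor
  · refine ⟨ι (sectorProj ε F 1), ?_, ?_, ?_⟩
    · have hle : Algebra.adjoin ℂ (Set.range (transferPoly b (m + 3)).coeff) ≤
          Algebra.adjoin ℂ (Set.range b) := by
        refine Algebra.adjoin_le ?_
        rintro _ ⟨s, rfl⟩
        exact coeff_transferPoly_mem b _ (fun j => Algebra.subset_adjoin (Set.mem_range_self j)) _ _
      exact hle (hmem _)
    · rw [← map_mul, hfam.sectorProj_sq hε]
    · rw [← hdeg]
      exact IsEdgeFor.trace_sectorProj tr htr hε hfam hedge 1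
  · intro w j
    have h1 := IsEdgeFor.trace_pow tr htr hε hfam hedge w j
    rw [sum_signPoly_pow, heval] at h1
    have h2 : (2 : ℂ) ^ n ≠ 0 := pow_ne_zero _ two_ne_zero
    apply mul_left_cancel₀ h2
    rw [h1]
    simp only [hval, hεdef]
    ring

end Moments

/-! ### From finite families to sequences. -/

section Extension

/-- Extension of a finite family by zero. -/
noncomputable def ext {M : ℕ} {X : Type*} [Zero X] (f : Fin M → X) (k : ℕ) : X :=
  if hk : k < M then f ⟨k, hk⟩ else 0

lemma ext_of_lt {M : ℕ} {X : Type*} [Zero X] (f : Fin M → X) {k : ℕ} (hk : k < M) :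
    ext f k = f ⟨k, hk⟩ := dif_pos hk

lemma ext_of_le {M : ℕ} {X : Type*} [Zero X] (f : Fin M → X) {k : ℕ} (hk : M ≤ k) :
    ext f k = 0 := dif_neg (not_lt.2 hk)

lemma poly_eq_polyShift {M : ℕ} (α : Fin M → ℝ) : poly α = polyShift (ext α) (M + 2) :=
  polySeq_eq_polyShift _ M

variable {M : ℕ} {A : Type*} [Ring A] [Algebra ℂ A]

/-- The scaled generators `α_k h_k`, extended by zero. -/
noncomputable def scaled (g : Fin M → A) (α : Fin M → ℝ) (k : ℕ) : A :=
  ((ext α k : ℝ) : ℂ) • ext g k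

/-- The defining relations of the FFD algebra for a family of elements of an algebra. -/
structure IsRep (g : Fin M → A) : Prop where
  sq : ∀ j, g j * g j = 1
  anticomm : ∀ j k : Fin M, j.val < k.val → k.val ≤ j.val + 2 → g j * g k + g k * g j = 0
  comm : ∀ j k : Fin M, j.val + 2 < k.val → g j * g k = g k * g j

lemma isRep_h : IsRep (h : Fin M → FFD M) := ⟨h_sq, h_anticomm, h_comm⟩

lemma IsRep.map {B : Type*} [Ring B] [Algebra ℂ B] {g : Fin M → A} (hg : IsRep g)
    (f : A →ₐ[ℂ] B) : IsRep (fun j => f (g j)) :=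
  ⟨fun j => by rw [← map_mul, hg.sq, map_one],
    fun j k h1 h2 => by rw [← map_mul, ← map_mul, ← map_add, hg.anticomm j k h1 h2, map_zero],
    fun j k h1 => by rw [← map_mul, ← map_mul, hg.comm j k h1]⟩

lemma IsRep.isScaled {g : Fin M → A} (hg : IsRep g) (α : Fin M → ℝ) :
    IsScaled (scaled g α) (ext α) := by
  refine ⟨fun k => ?_, fun j k h1 h2 => ?_, fun j k h1 => ?_⟩
  · by_cases hk : k < M
    · rw [scaled, smul_mul_smul_comm, ext_of_lt g hk, hg.sq, pow_two]
    · simp [scaled, ext_of_le α (not_lt.1 hk)]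
  · by_cases hk : k < M
    · rw [scaled, scaled, smul_mul_smul_comm, smul_mul_smul_comm, ext_of_lt g hk,
        ext_of_lt g (h1.trans hk), mul_comm ((ext α k : ℝ) : ℂ), ← smul_neg]
      congr 1
      exact eq_neg_of_add_eq_zero_left (hg.anticomm ⟨j, h1.trans hk⟩ ⟨k, hk⟩ h1 h2)
    · simp [scaled, ext_of_le α (not_lt.1 hk)]
  · by_cases hk : k < M
    · have hj : j < M := by omega
      rw [scaled, scaled, smul_mul_smul_comm, smul_mul_smul_comm, ext_of_lt g hk,
        ext_of_lt g hj, mul_comm ((ext α k : ℝ) : ℂ)]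
      congr 1
      exact hg.comm ⟨j, hj⟩ ⟨k, hk⟩ h1
    · simp [scaled, ext_of_le α (not_lt.1 hk)]

lemma map_transferSeq {B : Type*} [Ring B] [Algebra ℂ B] (f : A →ₐ[ℂ] B) (b : ℕ → A) (u : ℂ)
    (k : ℕ) : f (transferSeq b u k) = transferSeq (fun j => f (b j)) u k := by
  induction k using three_step_induction with
  | h0 => simp
  | h1 => simp
  | h2 => simp
  | h k h1 h2 => rw [transferSeq_add_three, transferSeq_add_three, map_sub, map_smul, map_mul, h1,
      h2]

lemma map_scaled {B : Type*} [Ring B] [Algebra ℂ B] (f : A →ₐ[ℂ] B) (g : Fin M → A)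
    (α : Fin M → ℝ) (k : ℕ) : f (scaled g α k) = scaled (fun j => f (g j)) α k := by
  rw [scaled, scaled, map_smul]
  by_cases hk : k < M
  · rw [ext_of_lt g hk, ext_of_lt (fun j => f (g j)) hk]
  · rw [ext_of_le g (not_lt.1 hk), ext_of_le (fun j => f (g j)) (not_lt.1 hk), map_zero]

end Extension

/-! ### Removing the assumption of nonvanishing couplings. -/

section Continuity

variable {M : ℕ} {κ : Type*} [Fintype κ] [DecidableEq κ]

lemma continuous_ext (k : ℕ) : Continuous fun α : Fin M → ℝ => ext α k := by
  by_cases hk : k < M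
  · simp only [ext, dif_pos hk]; fun_prop
  · simp only [ext, dif_neg hk]; fun_prop

lemma continuous_transferSeq (g : Fin M → Matrix κ κ ℂ) (w : ℂ) (k : ℕ) :
    Continuous fun α : Fin M → ℝ => transferSeq (scaled g α) w k := by
  induction k using three_step_induction with
  | h0 => exact continuous_const
  | h1 => exact continuous_const
  | h2 => exact continuous_const
  | h k h1 h2 =>
    simp only [transferSeq_add_three]
    have h3 : Continuous fun α : Fin M → ℝ => scaled g α k :=
      (Complex.continuous_ofReal.comp (continuous_ext k)).smul continuous_const
    exact h2.sub ((h3.mul h1).const_smul w)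

lemma continuous_polyVal (x : ℂ) (k : ℕ) :
    Continuous fun α : Fin M → ℝ => polyVal (ext α) x k := by
  induction k using three_step_induction with
  | h0 => simp only [polyVal_zero]; exact continuous_const
  | h1 => simp only [polyVal_one]; exact continuous_const
  | h2 => simp only [polyVal_two]; exact continuous_const
  | h k h1 h2 =>
    simp only [polyVal_add_three]
    exact h2.sub ((continuous_const.mul
      ((Complex.continuous_ofReal.comp (continuous_ext k)).pow 2)).mul h1)

lemma dense_ne_zero : Dense {α : Fin M → ℝ | ∀ j, α j ≠ 0} := by
  have h : {α : Fin M → ℝ | ∀ j, α j ≠ 0} = Set.pi Set.univ fun _ => ({0} : Set ℝ)ᶜ := by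
    ext α; simp
  rw [h]
  exact dense_pi _ fun j _ => dense_compl_singleton 0

/-- An operator that anticommutes with the last generator and commutes with the others. -/
structure IsLastEdge {A : Type*} [Ring A] (g : Fin M → A) (χ : A) : Prop where
  sq : χ * χ = 1
  comm : ∀ j : Fin M, j.val + 1 < M → Commute χ (g j)
  anticomm : ∀ j : Fin M, j.val + 1 = M → χ * g j = -(g j * χ)

lemma IsLastEdge.isEdge {A : Type*} [Ring A] [Algebra ℂ A] {m : ℕ} {g : Fin (m + 1) → A} {χ : A}
    (hχ : IsLastEdge g χ) (α : Fin (m + 1) → ℝ) : IsEdge (scaled g α) m χ := by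
  refine ⟨hχ.sq, fun j hj => ?_, ?_⟩
  · rw [scaled, ext_of_lt g (show j < m + 1 by omega)]
    exact (hχ.comm ⟨j, _⟩ (by simpa using hj)).smul_right _
  · rw [scaled, ext_of_lt g (show m < m + 1 by omega), mul_smul_comm, smul_mul_assoc,
      hχ.anticomm ⟨m, _⟩ rfl, smul_neg]

/-- Moments of the transfer matrix in a representation with an edge operator. -/
theorem IsRep.trace_transferSeq_pow {g : Fin M → Matrix κ κ ℂ} (hg : IsRep g) {χ : Matrix κ κ ℂ}
    (hχ : IsLastEdge g χ) (α : Fin M → ℝ) (w : ℂ) (j : ℕ) :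
    (transferSeq (scaled g α) w (M + 2) ^ j).trace =
      Fintype.card κ *
        ((evenPart j).map fun r => polyVal (ext α) (r * w ^ 2) (M + 2)).prod := by
  cases M with
  | zero => simp
  | succ m =>
    have hcont : Continuous fun α : Fin (m + 1) → ℝ =>
        (transferSeq (scaled g α) w (m + 1 + 2) ^ j).trace :=
      ((continuous_transferSeq g w _).pow j).matrix_trace
    have hcont' : Continuous fun α : Fin (m + 1) → ℝ => (Fintype.card κ : ℂ) *
        ((evenPart j).map fun r => polyVal (ext α) (r * w ^ 2) (m + 1 + 2)).prod :=
      continuous_const.mul (continuous_multiset_prod _ fun r _ => continuous_polyVal _ _)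
    -- Both sides are continuous in the couplings and agree on the dense set where none vanishes.
    refine congrFun (hcont.ext_on dense_ne_zero hcont' fun β hβ => ?_) α
    have := ((hg.isScaled β).generic_moments (hχ.isEdge β) (fun i hi => by
      rw [ext_of_lt β (show i < m + 1 by omega)]; exact hβ _)
      (Matrix.traceLinearMap κ ℂ ℂ) (fun x y => Matrix.trace_mul_comm x y)).2 w j
    simpa using this

/-- A projection of relative trace `2 ^ (-S)`. -/
theorem IsRep.exists_projection {g : Fin M → Matrix κ κ ℂ} (hg : IsRep g) {χ : Matrix κ κ ℂ}
    (hχ : IsLastEdge g χ) : ∃ e ∈ Algebra.adjoin ℂ (Set.range g), e * e = e ∧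
      2 ^ ((M + 2) / 3) * e.trace = Fintype.card κ := by
  cases M with
  | zero => exact ⟨1, one_mem _, one_mul 1, by simp⟩
  | succ m =>
    -- All couplings are set to one: a generic choice, for which the number of modes is `(M + 2) /
    -- 3`.
    obtain ⟨e, he, h1, h2⟩ := ((hg.isScaled 1).generic_moments (hχ.isEdge 1) (fun i hi => by
      rw [ext_of_lt 1 (show i < m + 1 by omega)]; exact one_ne_zero)
      (Matrix.traceLinearMap κ ℂ ℂ) (fun x y => Matrix.trace_mul_comm x y)).1
    refine ⟨e, ?_, h1, h2.trans (Matrix.trace_one)⟩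
    have hle : Algebra.adjoin ℂ (Set.range (scaled g 1)) ≤ Algebra.adjoin ℂ (Set.range g) := by
      refine Algebra.adjoin_le ?_
      rintro _ ⟨k, rfl⟩
      by_cases hk : k < m + 1
      · rw [scaled, ext_of_lt g hk]
        exact Subalgebra.smul_mem _ (Algebra.subset_adjoin (Set.mem_range_self _)) _
      · rw [scaled, ext_of_le g (not_lt.1 hk), smul_zero]
        exact zero_mem _
    exact hle he

end Continuity

/-! ### An edge operator by doubling the representation. -/

section Doubling

variable {M : ℕ}

/-- The automorphism of the FFD algebra that multiplies the generators by signs. -/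
noncomputable def signHom (s : Fin M → ℤˣ) : FFD M →ₐ[ℂ] FFD M :=
  RingQuot.liftAlgHom ℂ ⟨FreeAlgebra.lift ℂ (fun j : Fin M => ((s j : ℤ) : ℂ) • h j), by
    intro x y hxy
    induction hxy with
    | sq j =>
      simp only [map_mul, FreeAlgebra.lift_ι_apply, map_one, smul_mul_smul_comm, h_sq,
        unit_cast_sq, one_smul]
    | anticomm j k h1 h2 =>
      simp only [map_add, map_mul, FreeAlgebra.lift_ι_apply, map_zero, smul_mul_smul_comm]
      rw [mul_comm ((s k : ℤ) : ℂ), ← smul_add, h_anticomm j k h1 h2, smul_zero]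
    | comm j k h1 =>
      simp only [map_mul, FreeAlgebra.lift_ι_apply, smul_mul_smul_comm, h_comm j k h1,
        mul_comm ((s k : ℤ) : ℂ)]⟩

lemma signHom_h (s : Fin M → ℤˣ) (j : Fin M) : signHom s (h j) = ((s j : ℤ) : ℂ) • h j := by
  simp [signHom, h]

/-- The sign pattern that flips the last generator. -/
def lastSign (M : ℕ) (j : Fin M) : ℤˣ := if j.val + 1 = M then -1 else 1

lemma trace_fromBlocks {ι : Type*} [Fintype ι] (X Y Z W : Matrix ι ι ℂ) :
    (Matrix.fromBlocks X Y Z W).trace = X.trace + W.trace := by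
  simp [Matrix.trace]

variable {ι : Type*} [Fintype ι] [DecidableEq ι]

/-- The direct sum of two matrix representations. -/
noncomputable def directSum {B : Type*} [Ring B] [Algebra ℂ B] (ρ₁ ρ₂ : B →ₐ[ℂ] Matrix ι ι ℂ) :
    B →ₐ[ℂ] Matrix (ι ⊕ ι) (ι ⊕ ι) ℂ :=
  AlgHom.ofLinearMap
    { toFun := fun x => Matrix.fromBlocks (ρ₁ x) 0 0 (ρ₂ x)
      map_add' := fun x y => by simp [Matrix.fromBlocks_add]
      map_smul' := fun c x => by simp [Matrix.fromBlocks_smul] }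
    (by simp [Matrix.fromBlocks_one])
    (fun x y => by simp [Matrix.fromBlocks_multiply])

lemma directSum_apply {B : Type*} [Ring B] [Algebra ℂ B] (ρ₁ ρ₂ : B →ₐ[ℂ] Matrix ι ι ℂ) (x : B) :
    directSum ρ₁ ρ₂ x = Matrix.fromBlocks (ρ₁ x) 0 0 (ρ₂ x) := rfl

/-- The representation twisted by the sign of the last generator. -/
noncomputable def twist (ρ : FFD M →ₐ[ℂ] Matrix ι ι ℂ) : FFD M →ₐ[ℂ] Matrix ι ι ℂ :=
  ρ.comp (signHom (lastSign M))

/-- The two summands differ by the sign of the last generator, so exchanging the blocks anticommutes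
with that generator and commutes with the others. -/
lemma isLastEdge_swap (ρ : FFD M →ₐ[ℂ] Matrix ι ι ℂ) :
    IsLastEdge (fun j => directSum ρ (twist ρ) (h j)) (Matrix.fromBlocks 0 1 1 0) := by
  refine ⟨by simp [Matrix.fromBlocks_multiply, Matrix.fromBlocks_one], fun j hj => ?_,
    fun j hj => ?_⟩
  · simp [Commute, SemiconjBy, directSum_apply, twist, signHom_h, lastSign, hj.ne,
      Matrix.fromBlocks_multiply]
  · simp [directSum_apply, twist, signHom_h, lastSign, hj, Matrix.fromBlocks_multiply,
      Matrix.fromBlocks_neg]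

/-- The transfer matrix as an element of the FFD algebra, in recursive form. -/
noncomputable def transfer (α : Fin M → ℝ) (w : ℂ) : FFD M := transferSeq (scaled h α) w (M + 2)

lemma trace_transfer_pow (ρ : FFD M →ₐ[ℂ] Matrix ι ι ℂ) (α : Fin M → ℝ) (w : ℂ) (j : ℕ) :
    (ρ (transfer α w) ^ j).trace + (twist ρ (transfer α w) ^ j).trace = 2 * Fintype.card ι *
        ((evenPart j).map fun r => polyVal (ext α) (r * w ^ 2) (M + 2)).prod := by
  have h1 := (isRep_h.map (directSum ρ (twist ρ))).trace_transferSeq_pow (isLastEdge_swap ρ) α w j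
  have h2 : transferSeq (scaled (fun j => directSum ρ (twist ρ) (h j)) α) w (M + 2) =
      directSum ρ (twist ρ) (transfer α w) := by
    rw [transfer, map_transferSeq]
    congr 1
    funext k
    rw [map_scaled]
  rw [h2, ← map_pow, directSum_apply, trace_fromBlocks, Fintype.card_sum, map_pow,
    map_pow] at h1
  rw [h1]
  push_cast
  ring

lemma exists_projection (ρ : FFD M →ₐ[ℂ] Matrix ι ι ℂ) : ∃ e : FFD M, ρ e * ρ e = ρ e ∧
    2 ^ ((M + 2) / 3) * ((ρ e).trace + (twist ρ e).trace) = 2 * Fintype.card ι := by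
  obtain ⟨e, he, h1, h2⟩ := (isRep_h.map (directSum ρ (twist ρ))).exists_projection
    (isLastEdge_swap ρ)
  have hle : Algebra.adjoin ℂ (Set.range fun j : Fin M => directSum ρ (twist ρ) (h j)) ≤
      (directSum ρ (twist ρ)).range := by
    refine Algebra.adjoin_le ?_
    rintro _ ⟨j, rfl⟩
    exact ⟨h j, rfl⟩
  obtain ⟨x, rfl⟩ := hle he
  refine ⟨x, ?_, ?_⟩
  · change directSum ρ (twist ρ) x * directSum ρ (twist ρ) x = directSum ρ (twist ρ) x at h1
    rw [directSum_apply, Matrix.fromBlocks_multiply] at h1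
    simpa using (Matrix.fromBlocks_inj.1 h1).1
  · change 2 ^ ((M + 2) / 3) * (directSum ρ (twist ρ) x).trace = _ at h2
    rw [directSum_apply, trace_fromBlocks, Fintype.card_sum] at h2
    rw [h2]
    push_cast
    ring

end Doubling

/-! ### The transfer matrix as a sum over admissible sets; conservation of the Hamiltonian. -/

section Charges

/-- The admissible subsets of the first `m` natural numbers. -/
def admSet (m : ℕ) : Finset (Finset ℕ) :=
  (Finset.range m).powerset.filter (fun A => ∀ a ∈ A, ∀ b ∈ A, a < b → a + 2 < b)

lemma mem_admSet {m : ℕ} {A : Finset ℕ} :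
    A ∈ admSet m ↔ (∀ a ∈ A, a < m) ∧ ∀ a ∈ A, ∀ b ∈ A, a < b → a + 2 < b := by
  simp [admSet, Finset.subset_iff]

/-- Cases on whether the largest index `m` is used: if so, the other elements lie below `m - 2`.
Truncated subtraction gives the right empty range for `m ≤ 2`. -/
lemma sum_admSet_succ {X : Type*} [AddCommMonoid X] (f : Finset ℕ → X) (m : ℕ) :
    ∑ A ∈ admSet (m + 1), f A =
      ∑ A ∈ admSet m, f A + ∑ A ∈ admSet (m - 2), f (insert m A) := by
  classical
  have hm : m ∉ Finset.range m := Finset.notMem_range_self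
  rw [admSet, Finset.sum_filter, Finset.range_add_one, Finset.sum_powerset_insert hm,
    ← Finset.sum_filter, ← Finset.sum_filter]
  congr 1
  refine Finset.sum_congr ?_ fun _ _ => rfl
  ext A
  simp only [Finset.mem_filter, Finset.mem_powerset, mem_admSet, Finset.subset_iff,
    Finset.mem_range, Finset.mem_insert]
  constructor
  · rintro ⟨h1, h2⟩
    refine ⟨fun a ha => ?_, fun a ha b hb => h2 a (Or.inr ha) b (Or.inr hb)⟩
    have := h2 a (Or.inr ha) m (Or.inl rfl) (h1 ha)
    omega
  · rintro ⟨h1, h2⟩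
    refine ⟨fun a ha => by have := h1 a ha; omega, ?_⟩
    rintro a (rfl | ha) b (rfl | hb) hab
    · omega
    · have := h1 b hb; omega
    · have := h1 a ha; omega
    · exact h2 a ha b hb hab

lemma card_le_of_mem_admSet (m : ℕ) : ∀ A ∈ admSet m, A.card ≤ (m + 2) / 3 := by
  classical
  induction m using Nat.strong_induction_on with
  | _ m ih =>
    intro A hA
    rw [mem_admSet] at hA
    cases m with
    | zero =>
      have : A = ∅ := Finset.eq_empty_of_forall_notMem fun a ha => by have := hA.1 a ha; omega
      simp [this]
    | succ m =>
      by_cases hm : m ∈ A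
      · have h1 := ih (m - 2) (by omega) (A.erase m) (mem_admSet.2 ⟨fun a ha => ?_,
          fun a ha b hb => hA.2 a (Finset.mem_of_mem_erase ha) b (Finset.mem_of_mem_erase hb)⟩)
        · rw [Finset.card_erase_of_mem hm] at h1
          omega
        · have h1 := Finset.mem_of_mem_erase ha
          have h2 := Finset.ne_of_mem_erase ha
          have h3 := hA.1 a h1
          have := hA.2 a h1 m hm (by omega)
          omega
      · have h1 := ih m (by omega) A (mem_admSet.2 ⟨fun a ha => ?_, hA.2⟩)
        · omega
        · have := hA.1 a ha
          have : a ≠ m := fun h => hm (h ▸ ha)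
          omega

lemma sort_insert_of_lt (A : Finset ℕ) (m : ℕ) (h : ∀ a ∈ A, a < m) :
    (insert m A).sort (· ≤ ·) = A.sort (· ≤ ·) ++ [m] := by
  have hm : m ∉ A := fun hm => lt_irrefl _ (h m hm)
  have hnd : (A.sort (· ≤ ·) ++ [m]).Nodup := by
    rw [List.nodup_append]
    refine ⟨A.sort_nodup _, List.nodup_singleton m, ?_⟩
    intro a ha b hb
    rw [List.mem_singleton] at hb
    rw [Finset.mem_sort] at ha
    exact fun hab => hm (hb ▸ hab ▸ ha)
  have h1 : (A.sort (· ≤ ·) ++ [m]).toFinset = insert m A := by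
    ext a; simp
  rw [← h1, List.toFinset_sort (· ≤ ·) hnd, List.pairwise_append]
  refine ⟨A.pairwise_sort _, List.pairwise_singleton _ _, ?_⟩
  intro a ha b hb
  rw [List.mem_singleton] at hb
  rw [Finset.mem_sort] at ha
  exact hb ▸ (h a ha).le

variable {A : Type*} [Ring A] [Algebra ℂ A] {b : ℕ → A} {a : ℕ → ℝ}

/-- Truncated subtraction does no harm because the first three transfer matrices are all `1`. -/
lemma transferSeq_sub_two (b : ℕ → A) (u : ℂ) (m : ℕ) :
    transferSeq b u (m - 2 + 2) = transferSeq b u m := by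
  match m with
  | 0 => simp
  | 1 => simp
  | m + 2 => rfl

/-- The transfer matrix as a sum over admissible sets. -/
lemma IsScaled.sum_admSet (hb : IsScaled b a) (v : ℂ) (m : ℕ) :
    ∑ B ∈ admSet m, (-v) ^ B.card • ((B.sort (· ≤ ·)).map b).prod = transferSeq b v (m + 2) := by
  induction m using Nat.strong_induction_on with
  | _ m ih =>
    cases m with
    | zero => simp [admSet, Finset.filter_singleton]
    | succ m =>
      rw [sum_admSet_succ, ih m (by omega), show m + 1 + 2 = m + 3 from rfl,
        transferSeq_add_three, sub_eq_add_neg]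
      congr 1
      have h1 : ∀ B ∈ admSet (m - 2), (-v) ^ (insert m B).card •
          (((insert m B).sort (· ≤ ·)).map b).prod =
          (-v) • (((-v) ^ B.card • ((B.sort (· ≤ ·)).map b).prod) * b m) := by
        intro B hB
        rw [mem_admSet] at hB
        have hlt : ∀ x ∈ B, x < m := fun x hx => by have := hB.1 x hx; omega
        rw [sort_insert_of_lt B m hlt, Finset.card_insert_of_notMem fun h => lt_irrefl _ (hlt m h),
          List.map_append, List.prod_append, pow_succ']
        simp [smul_smul]
      rw [Finset.sum_congr rfl h1, ← Finset.smul_sum, ← Finset.sum_mul, ih (m - 2) (by omega),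
        transferSeq_sub_two, hb.commute_self, neg_smul]

variable {M : ℕ}

lemma map_mem_admSet {A : Finset (Fin M)} :
    A.map Fin.valEmbedding ∈ admSet M ↔ ∀ a ∈ A, ∀ b ∈ A, a < b → a.val + 2 < b.val := by
  rw [mem_admSet]
  simp

lemma transferMatrix_eq (α : Fin M → ℝ) (v : ℂ) : transferMatrix α v = transfer α v := by
  classical
  rw [transfer, ← (isRep_h.isScaled α).sum_admSet v M, transferMatrix]
  have h1 : ∀ s, (-v) ^ s • charge α s = ∑ A ∈ admSet M with A.card = s,
      (-v) ^ A.card • ((A.sort (· ≤ ·)).map (scaled h α)).prod := by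
    intro s
    rw [charge, Finset.smul_sum]
    refine Finset.sum_bij (fun A _ => A.map Fin.valEmbedding) ?_ ?_ ?_ ?_
    · intro A hA
      simp only [admissible, Finset.mem_filter, Finset.mem_powersetCard] at hA
      rw [Finset.mem_filter, map_mem_admSet, Finset.card_map]
      exact ⟨hA.2, hA.1.2⟩
    · intro A _ B _ h
      exact Finset.map_injective _ h
    · intro B hB
      rw [Finset.mem_filter] at hB
      have hlt := (mem_admSet.1 hB.1).1
      have he : (B.attachFin hlt).map Fin.valEmbedding = B := by
        ext x
        simp only [Finset.mem_map, Finset.mem_attachFin, Fin.valEmbedding_apply]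
        exact ⟨fun ⟨y, hy, h⟩ => h ▸ hy, fun hx => ⟨⟨x, hlt x hx⟩, hx, rfl⟩⟩
      refine ⟨B.attachFin hlt, ?_, he⟩
      simp only [admissible, Finset.mem_filter, Finset.mem_powersetCard]
      refine ⟨⟨Finset.subset_univ _, by rw [Finset.card_attachFin, hB.2]⟩, ?_⟩
      rw [← map_mem_admSet, he]
      exact hB.1
    · intro A hA
      simp only [admissible, Finset.mem_filter, Finset.mem_powersetCard] at hA
      rw [Finset.card_map, hA.1.2, ← Finset.map_sort Fin.valEmbedding A (· ≤ ·) (· ≤ ·)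
        (fun a _ b _ => Iff.rfl), List.map_map]
      congr 3
      funext j
      simp [scaled, ext_of_lt _ j.isLt]
  rw [Finset.sum_congr rfl fun s _ => h1 s]
  refine Finset.sum_fiberwise_of_maps_to (fun A hA => ?_) _
  have := card_le_of_mem_admSet M A hA
  rw [Finset.mem_range]
  omega

lemma coeff_one_transferPoly_scaled {g : Fin M → A} (α : Fin M → ℝ) (k : ℕ) :
    (transferPoly (scaled g α) (k + 2)).coeff 1 = -∑ j ∈ Finset.range k, scaled g α j := by
  induction k with
  | zero => simp [transferPoly, Polynomial.coeff_one]
  | succ k ih =>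
    rw [show k + 1 + 2 = k + 3 from rfl, coeff_succ_transferPoly, ih, coeff_zero_transferPoly,
      Finset.sum_range_succ, mul_one]
    abel

lemma hamiltonian_eq (α : Fin M → ℝ) :
    hamiltonian α = ∑ j ∈ Finset.range M, scaled h α j := by
  rw [hamiltonian, Finset.sum_range]
  exact Finset.sum_congr rfl fun j _ => by simp [scaled, ext_of_lt _ j.isLt]

/-- The transfer matrix commutes with the Hamiltonian. -/
lemma commute_transfer_hamiltonian (α : Fin M → ℝ) (u : ℂ) :
    Commute (transfer α u) (hamiltonian α) := by
  have h1 := coeff_one_transferPoly_scaled (g := h) α M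
  have h2 : hamiltonian α = -(transferPoly (scaled h α) (M + 2)).coeff 1 := by
    rw [h1, neg_neg, hamiltonian_eq]
  rw [h2, transfer, ← eval_transferPoly, Polynomial.eval_eq_sum_range]
  refine Commute.neg_right (Commute.sum_left _ _ _ fun i _ => ?_)
  refine Commute.mul_left ((isRep_h.isScaled α).commute_coeff _ _ _) ?_
  rw [← map_pow]
  exact Algebra.commutes _ _

end Charges

/-! ### A concrete representation, showing that the FFD algebra is not zero. -/

section Nontrivial

/-- The eigenvalue of the Pauli matrix `Z` for a bit. -/
noncomputable def bitSign (x : Bool) : ℂ := if x then -1 else 1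

lemma bitSign_not (x : Bool) : bitSign (!x) = -bitSign x := by cases x <;> simp [bitSign]

lemma bitSign_sq (x : Bool) : bitSign x ^ 2 = 1 := by cases x <;> simp [bitSign]

/-- The operator `X_j Z_{j+1} Z_{j+2}` on functions of bit strings. -/
noncomputable def spinOp (j : ℕ) : Module.End ℂ ((ℕ → Bool) → ℂ) where
  toFun f x := bitSign (x (j + 1)) * bitSign (x (j + 2)) * f (Function.update x j (!x j))
  map_add' f g := by funext x; simp [mul_add]
  map_smul' c f := by funext x; simp; ring

lemma spinOp_apply (j : ℕ) (f : (ℕ → Bool) → ℂ) (x : ℕ → Bool) : spinOp j f x =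
    bitSign (x (j + 1)) * bitSign (x (j + 2)) * f (Function.update x j (!x j)) := rfl

lemma isRep_spinOp (M : ℕ) : IsRep (fun j : Fin M => spinOp j.val) := by
  have hsq : ∀ j, spinOp j * spinOp j = 1 := fun j => by
    refine LinearMap.ext fun f => funext fun x => ?_
    rw [Module.End.mul_apply, spinOp_apply, spinOp_apply, Module.End.one_apply,
      Function.update_of_ne (by omega), Function.update_of_ne (by omega), Function.update_self,
      Function.update_idem, Bool.not_not, Function.update_eq_self]
    linear_combination f x * (bitSign (x (j + 2)) ^ 2 * bitSign_sq (x (j + 1)) +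
      bitSign_sq (x (j + 2)))
  -- In this order the bit at `k` is flipped before the signs at `j + 1` and `j + 2` are read, which
  -- costs a minus sign exactly when `k` is one of them.
  have hprod : ∀ j k, j < k → ∀ f x, (spinOp k * spinOp j) f x =
      bitSign (x (j + 1)) * bitSign (x (j + 2)) * bitSign (x (k + 1)) * bitSign (x (k + 2)) *
      (if k ≤ j + 2 then -1 else 1) *
      f (Function.update (Function.update x k (!x k)) j (!x j)) := by
    intro j k hjk f x
    rw [Module.End.mul_apply, spinOp_apply, spinOp_apply, Function.update_of_ne (a := j) (by omega)]
    obtain rfl | rfl | h : k = j + 1 ∨ k = j + 2 ∨ j + 2 < k := by omega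
    · rw [Function.update_self, Function.update_of_ne (by omega), bitSign_not, if_pos (by omega)]
      ring
    · rw [Function.update_self, Function.update_of_ne (by omega), bitSign_not, if_pos (by omega)]
      ring
    · rw [Function.update_of_ne (by omega), Function.update_of_ne (by omega), if_neg (by omega)]
      ring
  have hprod' : ∀ j k, j < k → ∀ f x, (spinOp j * spinOp k) f x =
      bitSign (x (j + 1)) * bitSign (x (j + 2)) * bitSign (x (k + 1)) * bitSign (x (k + 2)) *
      f (Function.update (Function.update x k (!x k)) j (!x j)) := by
    intro j k hjk f x
    rw [Module.End.mul_apply, spinOp_apply, spinOp_apply, Function.update_of_ne (by omega),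
      Function.update_of_ne (by omega), Function.update_of_ne (by omega),
      Function.update_comm (by omega)]
    ring
  refine ⟨fun j => hsq j.val, fun j k h1 h2 => LinearMap.ext fun f => funext fun x => ?_,
    fun j k h1 => LinearMap.ext fun f => funext fun x => ?_⟩
  · rw [LinearMap.add_apply, Pi.add_apply, hprod _ _ h1, hprod' _ _ h1, if_pos h2]
    simp
  · rw [hprod j.val k.val (by omega), hprod' j.val k.val (by omega), if_neg (by omega), mul_one]

/-- The homomorphism from the FFD algebra given by a family that satisfies the relations. -/
noncomputable def IsRep.lift {M : ℕ} {A : Type*} [Ring A] [Algebra ℂ A] {g : Fin M → A}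
    (hg : IsRep g) : FFD M →ₐ[ℂ] A :=
  RingQuot.liftAlgHom ℂ ⟨FreeAlgebra.lift ℂ g, by
    intro x y hxy
    induction hxy with
    | sq j => simp [hg.sq]
    | anticomm j k h1 h2 => simp [hg.anticomm j k h1 h2]
    | comm j k h1 => simp [hg.comm j k h1]⟩

/-- Needed to exclude faithful representations by empty matrices. -/
instance (M : ℕ) : Nontrivial (FFD M) := (isRep_spinOp M).lift.toRingHom.domain_nontrivial

end Nontrivial

/-! ### Factorisation of the transfer matrix at `v = i` into gates. -/

section Circuit

variable {M : ℕ}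

/-- The gates as a sequence, with trivial gates at the end. -/
noncomputable def gateSeq (φ : Fin M → ℝ) (k : ℕ) : FFD M :=
  (Real.cos (ext φ k) : ℂ) • (1 : FFD M) + (Complex.I * (Real.sin (ext φ k) : ℂ)) • ext h k

lemma gateSeq_val (φ : Fin M → ℝ) (j : Fin M) : gateSeq φ j.val = gate φ j := by
  simp [gateSeq, gate, ext_of_lt _ j.isLt]

/-- The product of the first `m` gates in increasing order. -/
noncomputable def leftProd (φ : Fin M → ℝ) : ℕ → FFD M
  | 0 => 1
  | (m + 1) => leftProd φ m * gateSeq φ m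

/-- The product of the first `m` gates in decreasing order. -/
noncomputable def rightProd (φ : Fin M → ℝ) : ℕ → FFD M
  | 0 => 1
  | (m + 1) => gateSeq φ m * rightProd φ m

lemma staircase_eq (φ : Fin M → ℝ) : staircase φ = leftProd φ M := by
  have key : ∀ m, (List.ofFn fun j : Fin m => gateSeq φ j.val).prod = leftProd φ m := by
    intro m
    induction m with
    | zero => simp [leftProd]
    | succ m ih =>
      rw [List.ofFn_succ_last, List.prod_append, leftProd, ← ih]
      simp
  rw [← key, staircase]
  congr 2
  funext j
  rw [gateSeq_val]

lemma transpose_one : transpose (1 : FFD M) = 1 := by simp [transpose]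

lemma transpose_gateSeq (φ : Fin M → ℝ) (k : ℕ) : transpose (gateSeq φ k) = gateSeq φ k := by
  rw [gateSeq, map_add, map_smul, map_smul, transpose_one]
  by_cases hk : k < M
  · rw [ext_of_lt h hk, transpose_h]
  · rw [ext_of_le h (not_lt.1 hk), map_zero]

lemma transpose_leftProd (φ : Fin M → ℝ) (m : ℕ) :
    transpose (leftProd φ m) = rightProd φ m := by
  induction m with
  | zero => exact transpose_one
  | succ m ih => rw [leftProd, transpose_mul, transpose_gateSeq, ih, rightProd]

lemma circuit_eq (φ : Fin M → ℝ) : circuit φ = leftProd φ M * rightProd φ M := by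
  rw [circuit, staircase_eq, transpose_leftProd]

lemma ext_h_sq {k : ℕ} (hk : k < M) : (ext h k : FFD M) * ext h k = 1 := by
  rw [ext_of_lt h hk, h_sq]

lemma ext_h_comm {j k : ℕ} (h1 : j + 2 < k) (hk : k < M) :
    Commute (ext h j : FFD M) (ext h k) := by
  have hj : j < M := by omega
  rw [ext_of_lt h hk, ext_of_lt h hj]
  exact h_comm ⟨j, hj⟩ ⟨k, hk⟩ h1

/-- Conjugation by `c + s x` fixes the elements that anticommute with the involution `x`. -/
lemma conj_eq_of_anticomm {A : Type*} [Ring A] [Algebra ℂ A] {x y : A} (hx : x * x = 1)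
    (hxy : x * y + y * x = 0) {c s : ℂ} (hcs : c * c - s * s = 1) :
    (c • (1 : A) + s • x) * y * (c • (1 : A) + s • x) = y := by
  have e1 : x * y = -(y * x) := eq_neg_of_add_eq_zero_left hxy
  have e2 : y * x * x = y := by rw [mul_assoc, hx, mul_one]
  simp only [add_mul, mul_add, smul_mul_assoc, mul_smul_comm, one_mul, mul_one, e1, neg_mul, e2]
  have e5 := congrArg (fun c : ℂ => c • y) hcs
  simp only [one_smul] at e5
  conv_rhs => rw [← e5]
  module

/-- Conjugation by a gate fixes the generators that anticommute with it. -/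
lemma gateSeq_conj (φ : Fin M → ℝ) {j k : ℕ} (h1 : j < k) (h2 : k ≤ j + 2) (hk : k < M) :
    gateSeq φ j * ext h k * gateSeq φ j = ext h k := by
  refine conj_eq_of_anticomm (ext_h_sq (h1.trans hk)) ?_ ?_
  · rw [ext_of_lt h hk, ext_of_lt h (h1.trans hk)]
    exact h_anticomm ⟨j, h1.trans hk⟩ ⟨k, hk⟩ h1 h2
  · have h' : ((Real.cos (ext φ j) : ℝ) : ℂ) ^ 2 + ((Real.sin (ext φ j) : ℝ) : ℂ) ^ 2 = 1 := by
      exact_mod_cast Real.cos_sq_add_sin_sq (ext φ j)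
    linear_combination h' - ((Real.sin (ext φ j) : ℝ) : ℂ) ^ 2 * Complex.I_sq

/-- The two innermost gates on each side belong to generators that anticommute with generator `k`
and disappear by `gateSeq_conj`. All earlier gates commute with it, so it can be pulled out in front
of the shorter circuit. -/
lemma leftProd_conj (φ : Fin M → ℝ) {k : ℕ} (hk : k < M) :
    leftProd φ k * ext h k * rightProd φ k =
      ext h k * (leftProd φ (k - 2) * rightProd φ (k - 2)) := by
  match k with
  | 0 => simp [leftProd, rightProd]
  | 1 =>
    simp only [leftProd, rightProd, one_mul, mul_one]
    exact (gateSeq_conj φ (show 0 < 1 by omega) (by omega) hk).trans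
      (by simp [leftProd, rightProd])
  | k + 2 =>
    have e1 := gateSeq_conj φ (show k + 1 < k + 2 by omega) (by omega) hk
    have e2 := gateSeq_conj φ (show k < k + 2 by omega) (by omega) hk
    have e3 : ∀ m, m ≤ k → Commute (leftProd φ m) (ext h (k + 2) : FFD M) := by
      intro m
      induction m with
      | zero => exact fun _ => Commute.one_left _
      | succ m ih =>
        intro hm
        have hm' := ext_h_comm (show m + 2 < k + 2 by omega) hk
        refine (ih (by omega)).mul_left ?_
        exact ((Commute.one_left _).smul_left _).add_left (hm'.smul_left _)
    calc leftProd φ (k + 2) * ext h (k + 2) * rightProd φ (k + 2)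
        = leftProd φ k * (gateSeq φ k * (gateSeq φ (k + 1) * ext h (k + 2) * gateSeq φ (k + 1)) *
          gateSeq φ k) * rightProd φ k := by
          simp only [leftProd, rightProd, mul_assoc]
      _ = _ := by
        rw [e1, e2, (e3 k le_rfl).eq, mul_assoc]
        rfl

/-- The normalisation `∏ 1 / cos (2 φ_j)` over the first `m` angles. -/
noncomputable def normProd (φ : Fin M → ℝ) (m : ℕ) : ℝ :=
  ∏ k ∈ Finset.range m, (Real.cos (2 * ext φ k))⁻¹

lemma normProd_succ (φ : Fin M → ℝ) (m : ℕ) :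
    normProd φ (m + 1) = normProd φ m * (Real.cos (2 * ext φ m))⁻¹ := Finset.prod_range_succ _ _

lemma normProd_eq (φ : Fin M → ℝ) : normProd φ M = ∏ j, (Real.cos (2 * φ j))⁻¹ := by
  rw [normProd, Finset.prod_range]
  exact Finset.prod_congr rfl fun j _ => by rw [ext_of_lt φ j.isLt]

variable {φ α : Fin M → ℝ}

/-- The cosines in the coupling relation cancel the last two factors of the normalisation; the
convention that earlier angles are zero matches truncated subtraction. -/
lemma normProd_mul_previous (hφ : ∀ j, Real.cos (2 * φ j) ≠ 0) (j : Fin M) :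
    normProd φ j.val * (Real.cos (2 * previous φ j 1) * Real.cos (2 * previous φ j 2)) =
      normProd φ (j.val - 2) := by
  obtain ⟨k, hk⟩ := j
  match k with
  | 0 => simp [normProd, previous]
  | 1 =>
    have := hφ ⟨0, by omega⟩
    simp [normProd, previous, ext_of_lt φ (show 0 < M by omega), this]
  | k + 2 =>
    have h1 := hφ ⟨k, by omega⟩
    have h2 := hφ ⟨k + 1, by omega⟩
    simp only [normProd_succ, ext_of_lt φ (show k < M by omega),
      ext_of_lt φ (show k + 1 < M by omega), previous]
    simp
    field_simp

lemma previous_cos_ne_zero (hφ : ∀ j, Real.cos (2 * φ j) ≠ 0) (j : Fin M) (r : ℕ) :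
    Real.cos (2 * previous φ j r) ≠ 0 := by
  rw [previous]
  split_ifs
  · exact hφ _
  · simp

lemma existsUnique_coupling (hφ : ∀ j, Real.cos (2 * φ j) ≠ 0) :
    ∃! α : Fin M → ℝ, CouplingRelation φ α := by
  have hne := fun j r => previous_cos_ne_zero hφ j r
  refine ⟨fun j => -Real.tan (2 * φ j) / (Real.cos (2 * previous φ j 1) *
    Real.cos (2 * previous φ j 2)), fun j => ?_, fun β hβ => ?_⟩
  · have := hne j 1
    have := hne j 2
    field_simp
  · funext j
    have := hne j 1
    have := hne j 2
    rw [hβ j]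
    field_simp

lemma tan_mul_normProd (hφ : ∀ j, Real.cos (2 * φ j) ≠ 0) (hα : CouplingRelation φ α)
    (j : Fin M) : Real.tan (2 * φ j) * normProd φ j.val = -α j * normProd φ (j.val - 2) := by
  rw [hα j, ← normProd_mul_previous hφ j]
  ring

/-- The factorisation of the transfer matrix at `v = i` into gates. -/
lemma transferSeq_I_eq (hφ : ∀ j, Real.cos (2 * φ j) ≠ 0) (hα : CouplingRelation φ α) (m : ℕ)
    (hm : m ≤ M) : transferSeq (scaled h α) Complex.I (m + 2) =
      (normProd φ m : ℂ) • (leftProd φ m * rightProd φ m) := by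
  induction m using Nat.strong_induction_on with
  | _ m ih =>
    cases m with
    | zero => simp [normProd, leftProd, rightProd]
    | succ k =>
      have hk : k < M := hm
      have h1 := ih k (by omega) (by omega)
      have h2 := ih (k - 2) (by omega) (by omega)
      rw [transferSeq_sub_two] at h2
      rw [show k + 1 + 2 = k + 3 from rfl, transferSeq_add_three, h1, h2, leftProd, rightProd]
      -- The two innermost gates of the circuit merge into one gate of double angle.
      have e1 : gateSeq φ k * gateSeq φ k = ((Real.cos (2 * ext φ k) : ℝ) : ℂ) • (1 : FFD M) +
          (Complex.I * ((Real.sin (2 * ext φ k) : ℝ) : ℂ)) • ext h k := by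
        simp only [gateSeq, add_mul, mul_add, smul_mul_assoc, mul_smul_comm, one_mul, mul_one,
          ext_h_sq hk, Real.cos_two_mul', Real.sin_two_mul]
        push_cast
        have : (Complex.I * Complex.sin ((ext φ k : ℝ) : ℂ)) *
            (Complex.I * Complex.sin ((ext φ k : ℝ) : ℂ)) =
            -Complex.sin ((ext φ k : ℝ) : ℂ) ^ 2 := by
          linear_combination Complex.sin ((ext φ k : ℝ) : ℂ) ^ 2 * Complex.I_sq
        simp only [smul_add, smul_smul, this]
        module
      have e2 : leftProd φ k * gateSeq φ k * (gateSeq φ k * rightProd φ k) =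
          ((Real.cos (2 * ext φ k) : ℝ) : ℂ) • (leftProd φ k * rightProd φ k) +
          (Complex.I * ((Real.sin (2 * ext φ k) : ℝ) : ℂ)) •
            (ext h k * (leftProd φ (k - 2) * rightProd φ (k - 2))) := by
        rw [mul_assoc, ← mul_assoc (gateSeq φ k), e1, ← leftProd_conj φ hk]
        simp only [add_mul, mul_add, smul_mul_assoc, mul_smul_comm, one_mul, mul_assoc]
      have hc : Real.cos (2 * ext φ k) ≠ 0 := by rw [ext_of_lt φ hk]; exact hφ _
      have e3 := tan_mul_normProd hφ hα ⟨k, hk⟩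
      rw [Real.tan_eq_sin_div_cos] at e3
      have e4 : normProd φ (k + 1) * Real.cos (2 * ext φ k) = normProd φ k := by
        rw [normProd_succ]; field_simp
      -- The normalised sine is the tangent times the previous normalisation, which the coupling
      -- relation turns into the coefficient of the transfer recursion.
      have e5 : normProd φ (k + 1) * Real.sin (2 * ext φ k) =
          -ext α k * normProd φ (k - 2) := by
        rw [normProd_succ, ext_of_lt φ hk, ext_of_lt α hk, ← e3]; ring
      have e4' : (normProd φ (k + 1) : ℂ) * ((Real.cos (2 * ext φ k) : ℝ) : ℂ) = normProd φ k := by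
        exact_mod_cast e4
      have e5' : (normProd φ (k + 1) : ℂ) * ((Real.sin (2 * ext φ k) : ℝ) : ℂ) =
          -(ext α k : ℝ) * normProd φ (k - 2) := by
        exact_mod_cast e5
      rw [e2, smul_add, smul_smul, smul_smul, e4', scaled, smul_mul_assoc, mul_smul_comm, smul_smul,
        smul_smul, sub_eq_add_neg, ← neg_smul]
      congr 2
      linear_combination -Complex.I * e5'

lemma transfer_I_eq (hφ : ∀ j, Real.cos (2 * φ j) ≠ 0) (hα : CouplingRelation φ α) :
    transfer α Complex.I = ((∏ j, (Real.cos (2 * φ j))⁻¹ : ℝ) : ℂ) • circuit φ := by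
  rw [transfer, transferSeq_I_eq hφ hα M le_rfl, normProd_eq, circuit_eq]

lemma circuit_eq_smul (hφ : ∀ j, Real.cos (2 * φ j) ≠ 0) (hα : CouplingRelation φ α) :
    circuit φ = ((∏ j, Real.cos (2 * φ j) : ℝ) : ℂ) • transfer α Complex.I := by
  rw [transfer_I_eq hφ hα, smul_smul, ← Complex.ofReal_mul, ← Finset.prod_mul_distrib,
    Finset.prod_eq_one fun j _ => mul_inv_cancel₀ (hφ j), Complex.ofReal_one, one_smul]

/-- By `1 / cos² = 1 + tan²` and the coupling relation, the squared normalisation satisfies the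
recursion of `P_m` at `x = -1`, which is `v²` for `v = i`. -/
lemma normProd_sq (hφ : ∀ j, Real.cos (2 * φ j) ≠ 0) (hα : CouplingRelation φ α) (m : ℕ)
    (hm : m ≤ M) : normProd φ m ^ 2 = (polyShift (ext α) (m + 2)).eval (-1) := by
  induction m using Nat.strong_induction_on with
  | _ m ih =>
    cases m with
    | zero => simp [normProd, polyShift]
    | succ k =>
      have hk : k < M := hm
      have h1 := ih k (by omega) (by omega)
      have h2 := ih (k - 2) (by omega) (by omega)
      have h3 : polyShift (ext α) (k - 2 + 2) = polyShift (ext α) k := by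
        match k with
        | 0 => simp [polyShift]
        | 1 => simp [polyShift]
        | k + 2 => rfl
      have hc := hφ ⟨k, hk⟩
      have e3 := tan_mul_normProd hφ hα ⟨k, hk⟩
      rw [h3] at h2
      simp only [show k + 1 + 2 = k + 3 from rfl, polyShift_add_three, Polynomial.eval_sub,
        Polynomial.eval_mul, Polynomial.eval_X, Polynomial.eval_C, ← h1, ← h2, normProd_succ,
        ext_of_lt φ hk, ext_of_lt α hk]
      have e4 : (Real.cos (2 * φ ⟨k, hk⟩))⁻¹ ^ 2 = 1 + Real.tan (2 * φ ⟨k, hk⟩) ^ 2 := by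
        rw [Real.tan_eq_sin_div_cos]
        have := Real.cos_sq_add_sin_sq (2 * φ ⟨k, hk⟩)
        field_simp
        linarith
      rw [mul_pow, e4]
      simp only at e3
      linear_combination (Real.tan (2 * φ ⟨k, hk⟩) * normProd φ k -
        α ⟨k, hk⟩ * normProd φ (k - 2)) * e3

end Circuit

/-! ### Gates as exponentials; unitarity of the circuit. -/

section Unitary

variable {M : ℕ} {ι : Type*} [Fintype ι] [DecidableEq ι]

open scoped Nat in
/-- The exponential of a multiple of an involution. -/
lemma exp_smul_of_sq_eq_one (X : Matrix ι ι ℂ) (hX : X * X = 1) (z : ℂ) :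
    NormedSpace.exp (z • X) = Complex.cosh z • (1 : Matrix ι ι ℂ) + Complex.sinh z • X := by
  open scoped Matrix.Norms.Operator in
  have h1 := NormedSpace.exp_series_hasSum_exp' (𝕂 := ℂ) (z • X)
  have h2 : HasSum (fun n => ((n !)⁻¹ : ℂ) • (z • X) ^ n)
      (Complex.cosh z • (1 : Matrix ι ι ℂ) + Complex.sinh z • X) := by
    have hp : ∀ k, X ^ (2 * k) = 1 := fun k => by rw [pow_mul, pow_two, hX, one_pow]
    refine HasSum.even_add_odd ?_ ?_
    · refine ((Complex.hasSum_cosh z).smul_const (1 : Matrix ι ι ℂ)).congr_fun fun k => ?_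
      rw [smul_pow, hp, smul_smul, div_eq_inv_mul]
    · refine ((Complex.hasSum_sinh z).smul_const X).congr_fun fun k => ?_
      rw [smul_pow, pow_succ X, hp, one_mul, smul_smul, div_eq_inv_mul]
  exact h1.unique h2

lemma map_gate_eq_exp (ρ : FFD M →ₐ[ℂ] Matrix ι ι ℂ) (φ : Fin M → ℝ) (j : Fin M) :
    ρ (gate φ j) = NormedSpace.exp ((Complex.I * (φ j : ℂ)) • ρ (h j)) := by
  rw [exp_smul_of_sq_eq_one _ (by rw [← map_mul, h_sq, map_one]), gate, map_add, map_smul,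
    map_smul, map_one, mul_comm Complex.I (φ j : ℂ), Complex.cosh_mul_I, Complex.sinh_mul_I,
    Complex.ofReal_cos, Complex.ofReal_sin, mul_comm Complex.I]

lemma map_gateSeq_mem_unitary (ρ : FFD M →ₐ[ℂ] Matrix ι ι ℂ) (hρ : ∀ j, (ρ (h j)).IsHermitian)
    (φ : Fin M → ℝ) (k : ℕ) : ρ (gateSeq φ k) ∈ Matrix.unitaryGroup ι ℂ := by
  by_cases hk : k < M
  · rw [Matrix.mem_unitaryGroup_iff, gateSeq, ext_of_lt φ hk, ext_of_lt h hk, map_add, map_smul,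
      map_smul, map_one, star_add, star_smul, star_smul, star_one, Matrix.star_eq_conjTranspose,
      (hρ ⟨k, hk⟩).eq]
    have h1 : ρ (h ⟨k, hk⟩) * ρ (h ⟨k, hk⟩) = 1 := by rw [← map_mul, h_sq, map_one]
    have h2 := Real.cos_sq_add_sin_sq (φ ⟨k, hk⟩)
    have h3 : (Real.cos (φ ⟨k, hk⟩) : ℂ) ^ 2 + (Real.sin (φ ⟨k, hk⟩) : ℂ) ^ 2 = 1 := by
      exact_mod_cast h2
    simp only [add_mul, mul_add, smul_mul_assoc, mul_smul_comm, one_mul, mul_one, h1, star_mul',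
      Complex.star_def, Complex.conj_I, Complex.conj_ofReal]
    have h4 := congrArg (fun c : ℂ => c • (1 : Matrix ι ι ℂ)) h3
    simp only [one_smul] at h4
    conv_rhs => rw [← h4]
    have h5 : -Complex.I * (Real.sin (φ ⟨k, hk⟩) : ℂ) * (Complex.I * (Real.sin (φ ⟨k, hk⟩) : ℂ)) =
        (Real.sin (φ ⟨k, hk⟩) : ℂ) ^ 2 := by
      linear_combination -(Real.sin (φ ⟨k, hk⟩) : ℂ) ^ 2 * Complex.I_sq
    simp only [smul_add, smul_smul, h5]
    module
  · simp [gateSeq, ext_of_le φ (not_lt.1 hk), one_mem]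

lemma map_circuit_mem_unitary (ρ : FFD M →ₐ[ℂ] Matrix ι ι ℂ) (hρ : ∀ j, (ρ (h j)).IsHermitian)
    (φ : Fin M → ℝ) : ρ (circuit φ) ∈ Matrix.unitaryGroup ι ℂ := by
  have h1 : ∀ m, ρ (leftProd φ m) ∈ Matrix.unitaryGroup ι ℂ := fun m => by
    induction m with
    | zero => rw [leftProd, map_one]; exact one_mem _
    | succ m ih => rw [leftProd, map_mul]; exact mul_mem ih (map_gateSeq_mem_unitary ρ hρ φ m)
  have h2 : ∀ m, ρ (rightProd φ m) ∈ Matrix.unitaryGroup ι ℂ := fun m => by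
    induction m with
    | zero => rw [rightProd, map_one]; exact one_mem _
    | succ m ih => rw [rightProd, map_mul]; exact mul_mem (map_gateSeq_mem_unitary ρ hρ φ m) ih
  rw [circuit_eq, map_mul]
  exact mul_mem (h1 _) (h2 _)

end Unitary

/-! ### Recovering multiplicities from moments. -/

section PowerSums

/-- A finite complex measure is determined by its moments. -/
lemma finsupp_eq_of_moments {f g : ℂ →₀ ℂ}
    (hfg : ∀ j : ℕ, (f.sum fun z c => c * z ^ j) = g.sum fun z c => c * z ^ j) : f = g := by
  -- The sequences `j ↦ z ^ j` are distinct monoid homomorphisms from `ℕ`, hence linearly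
  -- independent by Dedekind's lemma.
  have hli : LinearIndependent ℂ (fun (z : ℂ) (j : Multiplicative ℕ) => z ^ j.toAdd) := by
    have h1 := (linearIndependent_monoidHom (Multiplicative ℕ) ℂ).comp
      (fun z : ℂ => powersHom ℂ z) (powersHom ℂ).injective
    exact h1
  refine hli.finsuppLinearCombination_injective ?_
  funext j
  have := hfg j.toAdd
  simpa [Finsupp.linearCombination_apply, Finsupp.sum, Finset.sum_apply] using this

lemma exists_finsupp_family {κ : Type*} [Fintype κ] (z : κ → ℂ) :
    ∃ g : ℂ →₀ ℂ, (∀ x, g x = (Nat.card {σ // z σ = x} : ℂ)) ∧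
      ∀ j : ℕ, ∑ σ, z σ ^ j = g.sum fun x c => c * x ^ j := by
  classical
  refine ⟨∑ σ, Finsupp.single (z σ) 1, fun x => ?_, fun j => ?_⟩
  · rw [Finsupp.finsetSum_apply, Nat.card_eq_fintype_card, Fintype.card_subtype]
    simp [Finsupp.single_apply]
  · rw [← Finsupp.sum_finsetSum_index (by simp) (fun x c d => add_mul c d _)]
    simp

end PowerSums

/-! ### Degeneracies of unitary matrices and traces of their powers. -/

section UnitarySpectrum

open scoped ComplexOrder in
/-- The kernel of a normal matrix equals the kernel of its square. -/
lemma mulVec_eq_zero_of_normal {ι : Type*} [Fintype ι] {N : Matrix ι ι ℂ}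
    (hN : Commute N N.conjTranspose) {x : ι → ℂ}
    (hx : (N * N).mulVec x = 0) : N.mulVec x = 0 := by
  have h1 : (N.conjTranspose * N).mulVec (N.mulVec x) = 0 := by
    rw [Matrix.mulVec_mulVec, mul_assoc, ← Matrix.mulVec_mulVec, hx, Matrix.mulVec_zero]
  have h2 : (N.conjTranspose * N).mulVec x = 0 := by
    have h3 : (N.conjTranspose * N).conjTranspose * (N.conjTranspose * N) =
        N.conjTranspose * (N.conjTranspose * (N * N)) := by
      rw [Matrix.conjTranspose_mul, Matrix.conjTranspose_conjTranspose]
      simp only [mul_assoc]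
      congr 1
      rw [← mul_assoc, hN.eq, mul_assoc]
    rw [← Matrix.conjTranspose_mul_self_mulVec_eq_zero (N.conjTranspose * N) x, h3,
      ← Matrix.mulVec_mulVec, ← Matrix.mulVec_mulVec, hx, Matrix.mulVec_zero, Matrix.mulVec_zero]
  exact (Matrix.conjTranspose_mul_self_mulVec_eq_zero N x).1 h2

variable {ι : Type*} [Fintype ι] [DecidableEq ι]

/-- A shift of a unitary matrix by a scalar is normal, so it has no nilpotent part. The eigenspaces
thus exhaust the space, and traces of powers count geometric multiplicities. -/
lemma unitary_maxGenEigenspace {U : Matrix ι ι ℂ} (hU : U ∈ Matrix.unitaryGroup ι ℂ) (z : ℂ) :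
    Module.End.maxGenEigenspace (Matrix.toLin' U) z =
      Module.End.eigenspace (Matrix.toLin' U) z := by
  have hUc : Commute U U.conjTranspose := by
    have h1 := Matrix.mem_unitaryGroup_iff.1 hU
    have h2 := Matrix.mem_unitaryGroup_iff'.1 hU
    exact h1.trans h2.symm
  have hN : Commute (U - z • 1) (U - z • 1).conjTranspose := by
    rw [Matrix.conjTranspose_sub, Matrix.conjTranspose_smul, Matrix.conjTranspose_one]
    refine (hUc.sub_right ?_).sub_left (((Commute.one_left _).smul_left _).sub_right ?_)
    · exact (Commute.one_right _).smul_right _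
    · exact ((Commute.one_right _).smul_right _).smul_left _
  have hT : Matrix.toLin' U - z • (1 : Module.End ℂ (ι → ℂ)) = Matrix.toLin' (U - z • 1) := by
    rw [map_sub, map_smul, Matrix.toLin'_one]
    rfl
  have hstep : ∀ k : ℕ, ∀ x, ((Matrix.toLin' U - z • (1 : Module.End ℂ (ι → ℂ))) ^ (k + 1)) x = 0 →
      (Matrix.toLin' U - z • (1 : Module.End ℂ (ι → ℂ))) x = 0 := by
    intro k
    induction k with
    | zero => intro x hx; simpa using hx
    | succ k ih =>
      intro x hx
      rw [pow_succ, Module.End.mul_apply] at hx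
      have h1 := ih _ hx
      rw [hT, Matrix.toLin'_apply, Matrix.toLin'_apply, Matrix.mulVec_mulVec] at h1
      rw [hT, Matrix.toLin'_apply]
      exact mulVec_eq_zero_of_normal hN h1
  refine le_antisymm (fun x hx => ?_) (Module.End.eigenspace_le_maxGenEigenspace)
  rw [Module.End.mem_maxGenEigenspace] at hx
  obtain ⟨k, hk⟩ := hx
  have h1 := hstep k x (by rw [pow_succ', Module.End.mul_apply, hk, map_zero])
  rw [Module.End.mem_eigenspace_iff]
  simpa [sub_eq_zero] using h1

lemma exists_finsupp_degeneracy {U : Matrix ι ι ℂ} (hU : U ∈ Matrix.unitaryGroup ι ℂ) :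
    ∃ f : ℂ →₀ ℂ, (∀ z, f z = (degeneracy U z : ℂ)) ∧
      ∀ j : ℕ, (U ^ j).trace = f.sum fun z c => c * z ^ j := by
  let T : Module.End ℂ (ι → ℂ) := Matrix.toLin' U
  have hfin : {z | T.eigenspace z ≠ ⊥}.Finite := T.finite_hasEigenvalue
  have hint : DirectSum.IsInternal T.eigenspace := by
    rw [DirectSum.isInternal_submodule_iff_iSupIndep_and_iSup_eq_top]
    refine ⟨T.eigenspaces_iSupIndep, ?_⟩
    rw [← Module.End.iSup_maxGenEigenspace_eq_top T]
    exact iSup_congr fun z => (unitary_maxGenEigenspace hU z).symm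
  have hsupp : ∀ z, (degeneracy U z : ℂ) ≠ 0 → z ∈ hfin.toFinset := fun z hz => by
    rw [Set.Finite.mem_toFinset]
    intro h0
    apply hz
    have h0' : Module.End.eigenspace (Matrix.toLin' U) z = ⊥ := h0
    rw [degeneracy, h0', finrank_bot, Nat.cast_zero]
  refine ⟨Finsupp.onFinset hfin.toFinset (fun z => (degeneracy U z : ℂ)) hsupp,
    fun z => rfl, fun j => ?_⟩
  have hpow : ∀ z, ∀ x ∈ T.eigenspace z, ∀ i : ℕ, (T ^ i) x = z ^ i • x := fun z x hx i => by
    induction i with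
    | zero => simp
    | succ i ih =>
      rw [pow_succ', Module.End.mul_apply, ih, map_smul, Module.End.mem_eigenspace_iff.1 hx,
        smul_smul, pow_succ]
  have hmaps : ∀ z, Set.MapsTo (T ^ j) (T.eigenspace z) (T.eigenspace z) := fun z x hx => by
    rw [hpow z x hx]
    exact Submodule.smul_mem _ _ hx
  rw [Finsupp.onFinset_sum _ (fun z => zero_mul _), ← Matrix.trace_toLin'_eq,
    Matrix.toLin'_pow, LinearMap.trace_eq_sum_trace_restrict' hint hfin hmaps]
  refine Finset.sum_congr rfl fun z _ => ?_
  have h1 : (T ^ j).restrict (hmaps z) = z ^ j • LinearMap.id :=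
    LinearMap.ext fun x => Subtype.ext (hpow z x x.2 j)
  rw [h1, map_smul, LinearMap.trace_id, smul_eq_mul, mul_comm]
  rfl

lemma mem_spectrum_iff_degeneracy_ne_zero (U : Matrix ι ι ℂ) (z : ℂ) :
    z ∈ spectrum ℂ U ↔ degeneracy U z ≠ 0 := by
  rw [← Matrix.spectrum_toLin', ← Module.End.hasEigenvalue_iff_mem_spectrum, degeneracy, Ne,
    Submodule.finrank_eq_zero]
  rfl

/-- Two unitary matrices with prescribed common moments. -/
lemma degeneracy_add_of_moments {κ : Type*} [Fintype κ] {U U' : Matrix ι ι ℂ}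
    (hU : U ∈ Matrix.unitaryGroup ι ℂ) (hU' : U' ∈ Matrix.unitaryGroup ι ℂ) (z : κ → ℂ)
    {a b : ℕ} (hm : ∀ j : ℕ, (a : ℂ) * ((U ^ j).trace + (U' ^ j).trace) = b * ∑ σ, z σ ^ j)
    (x : ℂ) : a * (degeneracy U x + degeneracy U' x) = b * Nat.card {σ // z σ = x} := by
  obtain ⟨f, hf, hf'⟩ := exists_finsupp_degeneracy hU
  obtain ⟨f₂, hf₂, hf₂'⟩ := exists_finsupp_degeneracy hU'
  obtain ⟨g, hg, hg'⟩ := exists_finsupp_family z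
  have h1 : (a : ℂ) • (f + f₂) = (b : ℂ) • g := by
    refine finsupp_eq_of_moments fun j => ?_
    rw [Finsupp.sum_smul_index (by simp), Finsupp.sum_smul_index (by simp)]
    simp only [mul_assoc]
    rw [← Finsupp.mul_sum, ← Finsupp.mul_sum, Finsupp.sum_add_index' (by simp)
      (fun x c d => add_mul c d _), ← hf', ← hf₂', ← hg', hm]
  have h2 := DFunLike.congr_fun h1 x
  simp only [Finsupp.smul_apply, Finsupp.add_apply, hf, hf₂, hg, smul_eq_mul] at h2
  exact_mod_cast h2

end UnitarySpectrum

/-! ### Eigenvalues of the circuit in Hermitian representations. -/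

section Spectrum

variable {M n : ℕ} {φ α : Fin M → ℝ} {v ε : Fin n → ℝ}

/-- The predicted eigenvalues of the circuit. -/
noncomputable def modeValue (φ : Fin M → ℝ) (ε : Fin n → ℝ) (σ : Fin n → ℤˣ) : ℂ :=
  (Real.sign ((∏ j, Real.cos (2 * φ j)) * ∏ k, Real.cos (ε k)) : ℂ) * modeProduct ε σ

lemma cos_ne_zero_of_tan_eq {x y : ℝ} (hy : 0 < y) (h : Real.tan x = 1 / y) :
    Real.cos x ≠ 0 := fun h0 => by
  rw [Real.tan_eq_sin_div_cos, h0, div_zero] at h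
  exact (one_div_pos.2 hy).ne h

/-- Both products have square `1 / P_M(-1)`: on one side by `normProd_sq`, on the other by
factorising over the roots and using `1 + tan² = 1 / cos²`. Hence they agree up to the sign of their
product. -/
lemma prod_cos_eq_sign_mul (hφ : ∀ j, Real.cos (2 * φ j) ≠ 0) (hα : CouplingRelation φ α)
    (hP : ∀ x : ℂ, polyVal (ext α) x (M + 2) = ∏ i, (1 - x * ((v i : ℂ)⁻¹) ^ 2))
    (hv : ∀ k, 0 < v k) (hε : ∀ k, Real.tan (ε k) = 1 / v k) :
    ∏ j, Real.cos (2 * φ j) =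
      Real.sign ((∏ j, Real.cos (2 * φ j)) * ∏ k, Real.cos (ε k)) * ∏ k, Real.cos (ε k) := by
  have hcos := fun k => cos_ne_zero_of_tan_eq (hv k) (hε k)
  set c := ∏ j, Real.cos (2 * φ j) with hc
  set p := ∏ k, Real.cos (ε k) with hp
  have hc0 : c ≠ 0 := Finset.prod_ne_zero_iff.2 fun j _ => hφ j
  have hp0 : p ≠ 0 := Finset.prod_ne_zero_iff.2 fun k _ => hcos k
  have h1 : (c⁻¹) ^ 2 = ∏ i, (1 + ((v i)⁻¹) ^ 2) := by
    have h2 := normProd_sq hφ hα M le_rfl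
    rw [normProd_eq, Finset.prod_inv_distrib, ← hc] at h2
    have h3 := hP ((-1 : ℝ) : ℂ)
    rw [polyVal_ofReal, ← h2] at h3
    have h4 : ((c⁻¹ ^ 2 : ℝ) : ℂ) = ((∏ i, (1 + ((v i)⁻¹) ^ 2) : ℝ) : ℂ) := by
      rw [h3]
      push_cast
      exact Finset.prod_congr rfl fun i _ => by ring
    exact_mod_cast h4
  have h2 : ∏ i, (1 + ((v i)⁻¹) ^ 2) = (p⁻¹) ^ 2 := by
    rw [hp, ← Finset.prod_inv_distrib, ← Finset.prod_pow]
    refine Finset.prod_congr rfl fun k _ => ?_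
    rw [← one_div (v k), ← hε k, Real.tan_eq_sin_div_cos]
    have := Real.cos_sq_add_sin_sq (ε k)
    have := hcos k
    field_simp
    linarith
  have h3 : c ^ 2 = p ^ 2 := by
    have := h1.trans h2
    rw [inv_pow, inv_pow] at this
    exact inv_injective this
  rcases sq_eq_sq_iff_eq_or_eq_neg.1 h3 with h4 | h4
  · rw [h4, Real.sign_of_pos (mul_self_pos.2 hp0), one_mul]
  · rw [h4, neg_mul, Real.sign_of_neg (neg_neg_of_pos (mul_self_pos.2 hp0)), neg_one_mul]

/-- `exp (i σ ε) = cos ε (1 + i σ tan ε)` with `tan ε = 1 / v`. The signs are reversed because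
`signPoly` has factors `1 - σ_k u / v_k`. -/
lemma modeValue_eq (hφ : ∀ j, Real.cos (2 * φ j) ≠ 0) (hα : CouplingRelation φ α)
    (hP : ∀ x : ℂ, polyVal (ext α) x (M + 2) = ∏ i, (1 - x * ((v i : ℂ)⁻¹) ^ 2))
    (hv : ∀ k, 0 < v k) (hε : ∀ k, Real.tan (ε k) = 1 / v k) (σ : Fin n → ℤˣ) :
    modeValue φ ε σ = ((∏ j, Real.cos (2 * φ j) : ℝ) : ℂ) *
      (signPoly (fun k => ((v k : ℂ)⁻¹)) (-σ)).eval Complex.I := by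
  have hcos := fun k => cos_ne_zero_of_tan_eq (hv k) (hε k)
  rw [prod_cos_eq_sign_mul hφ hα hP hv hε, modeValue, Complex.ofReal_mul, mul_assoc]
  congr 1
  rw [modeProduct, eval_signPoly, Complex.ofReal_prod, ← Finset.prod_mul_distrib]
  refine Finset.prod_congr rfl fun k _ => ?_
  have h1 : ((v k : ℂ)⁻¹) * (Real.cos (ε k) : ℝ) = ((Real.sin (ε k) : ℝ) : ℂ) := by
    rw [← Complex.ofReal_inv, ← one_div, ← hε k, ← Complex.ofReal_mul,
      Real.tan_mul_cos (hcos k)]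
  rcases Int.units_eq_one_or (σ k) with h | h
  · rw [Pi.neg_apply, h]
    simp only [Units.val_neg, Units.val_one, Int.cast_neg, Int.cast_one, one_mul]
    rw [mul_comm Complex.I, Complex.exp_mul_I, ← Complex.ofReal_cos, ← Complex.ofReal_sin, ← h1]
    ring
  · rw [Pi.neg_apply, h]
    simp only [Units.val_neg, Units.val_one, Int.cast_neg, Int.cast_one, neg_neg, one_mul]
    rw [mul_comm Complex.I, Complex.exp_mul_I, neg_one_mul, Complex.cos_neg, Complex.sin_neg,
      ← Complex.ofReal_cos, ← Complex.ofReal_sin, ← h1]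
    ring

lemma sum_modeValue_pow (hφ : ∀ j, Real.cos (2 * φ j) ≠ 0) (hα : CouplingRelation φ α)
    (hP : ∀ x : ℂ, polyVal (ext α) x (M + 2) = ∏ i, (1 - x * ((v i : ℂ)⁻¹) ^ 2))
    (hv : ∀ k, 0 < v k) (hε : ∀ k, Real.tan (ε k) = 1 / v k) (j : ℕ) :
    ∑ σ, modeValue φ ε σ ^ j = ((∏ j, Real.cos (2 * φ j) : ℝ) : ℂ) ^ j * (2 ^ n *
      ((evenPart j).map fun r => polyVal (ext α) (r * Complex.I ^ 2) (M + 2)).prod) := by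
  simp only [modeValue_eq hφ hα hP hv hε, mul_pow, hP]
  have h1 : ∀ f : (Fin n → ℤˣ) → ℂ, ∑ σ, f (-σ) = ∑ σ, f σ :=
    fun f => Fintype.sum_equiv (Equiv.neg _) _ _ fun _ => rfl
  rw [← Finset.mul_sum, ← sum_signPoly_pow,
    h1 fun σ => (signPoly (fun k => ((v k : ℂ)⁻¹)) σ).eval Complex.I ^ j]

variable {ι : Type*} [Fintype ι] [DecidableEq ι]

lemma trace_circuit_pow (hφ : ∀ j, Real.cos (2 * φ j) ≠ 0) (hα : CouplingRelation φ α)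
    (hP : ∀ x : ℂ, polyVal (ext α) x (M + 2) = ∏ i, (1 - x * ((v i : ℂ)⁻¹) ^ 2))
    (hv : ∀ k, 0 < v k) (hε : ∀ k, Real.tan (ε k) = 1 / v k)
    (ρ : FFD M →ₐ[ℂ] Matrix ι ι ℂ) (j : ℕ) :
    ((2 ^ n : ℕ) : ℂ) * ((ρ (circuit φ) ^ j).trace + (twist ρ (circuit φ) ^ j).trace) =
      ((2 * Fintype.card ι : ℕ) : ℂ) * ∑ σ, modeValue φ ε σ ^ j := by
  rw [sum_modeValue_pow hφ hα hP hv hε, circuit_eq_smul hφ hα, map_smul, map_smul, smul_pow,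
    smul_pow, Matrix.trace_smul, Matrix.trace_smul, ← smul_add, trace_transfer_pow, smul_eq_mul]
  push_cast
  ring

lemma twist_isHermitian (ρ : FFD M →ₐ[ℂ] Matrix ι ι ℂ) (hρ : ∀ j, (ρ (h j)).IsHermitian)
    (j : Fin M) : (twist ρ (h j)).IsHermitian := by
  rw [twist, AlgHom.comp_apply, signHom_h, map_smul, Matrix.IsHermitian,
    Matrix.conjTranspose_smul, (hρ j).eq]
  simp

/-- The spectrum in an arbitrary representation is contained in the spectrum in a faithful one. -/
lemma spectrum_subset_of_injective {A κ : Type*} [Ring A] [Algebra ℂ A] [Fintype κ]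
    [DecidableEq κ] (ρ : A →ₐ[ℂ] Matrix ι ι ℂ) (hρ : Function.Injective ρ)
    (ρ' : A →ₐ[ℂ] Matrix κ κ ℂ) (a : A) : spectrum ℂ (ρ' a) ⊆ spectrum ℂ (ρ a) := by
  intro z hz
  rw [Matrix.mem_spectrum_iff_isRoot_charpoly]
  -- Cayley–Hamilton lifts along the injective `ρ` to a polynomial identity for `a` itself, which
  -- passes to every other representation.
  have h1 : Polynomial.aeval a (ρ a).charpoly = 0 := by
    apply hρ
    rw [map_zero, ← Polynomial.aeval_algHom_apply, Matrix.aeval_self_charpoly]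
  have h2 : Polynomial.aeval (ρ' a) (ρ a).charpoly = 0 := by
    rw [Polynomial.aeval_algHom_apply, h1, map_zero]
  have h3 := spectrum.subset_polynomial_aeval (ρ' a) (ρ a).charpoly ⟨z, hz, rfl⟩
  rw [h2] at h3
  by_contra h4
  refine h3 ?_
  rw [spectrum.mem_resolventSet_iff, sub_zero]
  exact (isUnit_iff_ne_zero.2 h4).map (algebraMap ℂ (Matrix κ κ ℂ))

theorem degeneracy_add (hφ : ∀ j, Real.cos (2 * φ j) ≠ 0) (hα : CouplingRelation φ α)
    (hP : ∀ x : ℂ, polyVal (ext α) x (M + 2) = ∏ i, (1 - x * ((v i : ℂ)⁻¹) ^ 2))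
    (hv : ∀ k, 0 < v k) (hε : ∀ k, Real.tan (ε k) = 1 / v k)
    (ρ : FFD M →ₐ[ℂ] Matrix ι ι ℂ) (hρ : ∀ j, (ρ (h j)).IsHermitian) (z : ℂ) :
    2 ^ n * (degeneracy (ρ (circuit φ)) z + degeneracy (twist ρ (circuit φ)) z) =
      2 * Fintype.card ι * Nat.card {σ // modeValue φ ε σ = z} :=
  degeneracy_add_of_moments (map_circuit_mem_unitary ρ hρ φ)
    (map_circuit_mem_unitary (twist ρ) (twist_isHermitian ρ hρ) φ) _
    (trace_circuit_pow hφ hα hP hv hε ρ) z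

lemma card_pos_of_injective (ρ : FFD M →ₐ[ℂ] Matrix ι ι ℂ) (hρ : Function.Injective ρ) :
    0 < Fintype.card ι := by
  by_contra h0
  have : IsEmpty ι := Fintype.card_eq_zero_iff.1 (by omega)
  have h1 : (1 : FFD M) ≠ 0 := one_ne_zero
  exact h1 (hρ (Subsingleton.elim _ _))

/-- `degeneracy_add` decides only whether `z` is an eigenvalue in the representation or its twist.
Faithfulness puts the spectrum of the twist inside that of the representation. -/
theorem spectrum_circuit (hφ : ∀ j, Real.cos (2 * φ j) ≠ 0) (hα : CouplingRelation φ α)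
    (hP : ∀ x : ℂ, polyVal (ext α) x (M + 2) = ∏ i, (1 - x * ((v i : ℂ)⁻¹) ^ 2))
    (hv : ∀ k, 0 < v k) (hε : ∀ k, Real.tan (ε k) = 1 / v k)
    (ρ : FFD M →ₐ[ℂ] Matrix ι ι ℂ) (hinj : Function.Injective ρ)
    (hρ : ∀ j, (ρ (h j)).IsHermitian) :
    spectrum ℂ (ρ (circuit φ)) = {z | ∃ σ : Fin n → ℤˣ, z = modeValue φ ε σ} := by
  ext z
  have h1 := degeneracy_add hφ hα hP hv hε ρ hρ z
  have h2 := card_pos_of_injective ρ hinj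
  have h3 : (∃ σ : Fin n → ℤˣ, z = modeValue φ ε σ) ↔
      Nat.card {σ : Fin n → ℤˣ // modeValue φ ε σ = z} ≠ 0 := by
    rw [← Nat.pos_iff_ne_zero, Nat.card_pos_iff, nonempty_subtype]
    simp only [eq_comm (a := z)]
    exact ⟨fun h => ⟨h, inferInstance⟩, fun h => h.1⟩
  have h4 : degeneracy (twist ρ (circuit φ)) z ≠ 0 → degeneracy (ρ (circuit φ)) z ≠ 0 := by
    rw [← mem_spectrum_iff_degeneracy_ne_zero, ← mem_spectrum_iff_degeneracy_ne_zero]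
    exact fun h => spectrum_subset_of_injective ρ hinj (twist ρ) _ h
  rw [Set.mem_ofPred_eq, h3, mem_spectrum_iff_degeneracy_ne_zero]
  constructor
  · intro h5 h6
    rw [h6, mul_zero] at h1
    have : 0 < 2 ^ n := by positivity
    simp at h1
    exact h5 h1.1
  · intro h5 h6
    have h7 : degeneracy (twist ρ (circuit φ)) z = 0 := by
      by_contra h8
      exact h4 h8 h6
    rw [h6, h7, add_zero, mul_zero] at h1
    have : 0 < 2 * Fintype.card ι * Nat.card {σ : Fin n → ℤˣ // modeValue φ ε σ = z} := by
      have := Nat.pos_of_ne_zero h5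
      positivity
    omega

end Spectrum

/-! ### Pauli strings: exact degeneracies and the free fermionic spectrum. -/

section Pauli

lemma exists_pauli_mul (a b : Fin 4) : ∃ (c : ℂ) (d : Fin 4), pauli a * pauli b = c • pauli d := by
  refine ⟨(![![1, 1, 1, 1], ![1, 1, Complex.I, -Complex.I], ![1, -Complex.I, 1, Complex.I],
    ![1, Complex.I, -Complex.I, 1]] : Fin 4 → Fin 4 → ℂ) a b,
    (![![0, 1, 2, 3], ![1, 0, 3, 2], ![2, 3, 0, 1], ![3, 2, 1, 0]] : Fin 4 → Fin 4 → Fin 4) a b, ?_⟩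
  fin_cases a <;> fin_cases b <;> ext i j <;> fin_cases i <;> fin_cases j <;>
    simp [pauli, Matrix.mul_apply]

lemma pauli_isHermitian (a : Fin 4) : (pauli a).IsHermitian := by
  fin_cases a <;> ext i j <;> fin_cases i <;> fin_cases j <;>
    simp [pauli, Matrix.conjTranspose_apply]

lemma trace_pauli {a : Fin 4} (ha : a ≠ 0) : (pauli a).trace = 0 := by
  fin_cases a <;> simp_all [pauli, Matrix.trace]

variable {L : ℕ}

lemma exists_pauliString_mul (s t : Fin L → Fin 4) :
    ∃ (c : ℂ) (r : Fin L → Fin 4), pauliString s * pauliString t = c • pauliString r := by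
  choose c d hcd using exists_pauli_mul
  refine ⟨∏ k, c (s k) (t k), fun k => d (s k) (t k), ?_⟩
  ext x z
  simp only [Matrix.mul_apply, pauliString, Matrix.of_apply, Matrix.smul_apply, smul_eq_mul,
    ← Finset.prod_mul_distrib]
  have h1 : ∀ k, c (s k) (t k) * pauli (d (s k) (t k)) (x k) (z k) =
      ∑ y : Fin 2, pauli (s k) (x k) y * pauli (t k) y (z k) := fun k => by
    rw [← Matrix.mul_apply, hcd, Matrix.smul_apply, smul_eq_mul]
  simp only [h1]
  rw [Finset.prod_univ_sum, Fintype.piFinset_univ]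

lemma pauliString_zero : pauliString (fun _ : Fin L => 0) = 1 := by
  ext x y
  simp only [pauliString, Matrix.of_apply, pauli, Matrix.cons_val_zero, Matrix.one_apply,
    funext_iff]
  exact Fintype.prod_ite_zero.trans (by simp)

lemma pauliString_isHermitian (s : Fin L → Fin 4) : (pauliString s).IsHermitian := by
  ext x y
  rw [Matrix.conjTranspose_apply, pauliString, Matrix.of_apply, Matrix.of_apply, star_prod]
  exact Finset.prod_congr rfl fun k _ => (pauli_isHermitian (s k)).apply _ _

lemma trace_pauliString (s : Fin L → Fin 4) :
    (pauliString s).trace = ∏ k, (pauli (s k)).trace := by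
  simp only [Matrix.trace, Matrix.diag_apply, pauliString, Matrix.of_apply]
  rw [Finset.prod_univ_sum, Fintype.piFinset_univ]

variable {M : ℕ}

lemma adjoin_range_h : Algebra.adjoin ℂ (Set.range (h : Fin M → FFD M)) = ⊤ := by
  have h1 := FreeAlgebra.adjoin_range_ι ℂ (Fin M)
  have h2 := congrArg (Subalgebra.map (RingQuot.mkAlgHom ℂ (FFDRel M))) h1
  rw [AlgHom.map_adjoin, Algebra.map_top, ← Set.range_comp,
    (AlgHom.range_eq_top _).2 (RingQuot.mkAlgHom_surjective ℂ _)] at h2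
  exact h2

variable (ρ : FFD M →ₐ[ℂ] Matrix (Fin L → Fin 2) (Fin L → Fin 2) ℂ)

/-- A word in the generators is represented by a multiple of a Pauli string, and the sign
automorphism only rescales it. If the string is not the identity, both traces vanish; if it is,
faithfulness makes the word a scalar, which the automorphism fixes. -/
lemma trace_twist_of_pauli (hinj : Function.Injective ρ)
    (hs : ∀ j, ∃ s : Fin L → Fin 4, ρ (h j) = pauliString s) (a : FFD M) :
    (twist ρ a).trace = (ρ a).trace := by
  have hword : ∀ m ∈ Submonoid.closure (Set.range (h : Fin M → FFD M)),
      (∃ (c : ℂ) (s : Fin L → Fin 4), ρ m = c • pauliString s) ∧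
      ∃ d : ℂ, signHom (lastSign M) m = d • m := by
    intro m hm
    induction hm using Submonoid.closure_induction with
    | mem x hx =>
      obtain ⟨j, rfl⟩ := hx
      obtain ⟨s, hs⟩ := hs j
      exact ⟨⟨1, s, by rw [hs, one_smul]⟩, _, signHom_h _ j⟩
    | one => exact ⟨⟨1, fun _ => 0, by rw [map_one, pauliString_zero, one_smul]⟩, 1, by
        rw [map_one, one_smul]⟩
    | mul x y _ _ hx hy =>
      obtain ⟨⟨c, s, h1⟩, d, h2⟩ := hx
      obtain ⟨⟨c', s', h1'⟩, d', h2'⟩ := hy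
      obtain ⟨e, r, h3⟩ := exists_pauliString_mul s s'
      refine ⟨⟨c * c' * e, r, ?_⟩, d * d', ?_⟩
      · rw [map_mul, h1, h1', smul_mul_smul_comm, h3, smul_smul]
      · rw [map_mul, h2, h2', smul_mul_smul_comm]
  have hmem : a ∈ Submodule.span ℂ
      (Submonoid.closure (Set.range (h : Fin M → FFD M)) : Set (FFD M)) := by
    rw [← Algebra.adjoin_eq_span, adjoin_range_h]
    trivial
  induction hmem using Submodule.span_induction with
  | mem m hm =>
    obtain ⟨⟨c, s, h1⟩, d, h2⟩ := hword m hm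
    rw [twist, AlgHom.comp_apply]
    by_cases h0 : ∀ k, s k = 0
    · have h3 : m = algebraMap ℂ (FFD M) c := by
        apply hinj
        rw [h1, AlgHom.commutes, show s = fun _ => 0 from funext h0, pauliString_zero,
          Algebra.algebraMap_eq_smul_one]
      rw [h3, AlgHom.commutes]
    · obtain ⟨k, hk⟩ := not_forall.1 h0
      have h3 : (pauliString s).trace = 0 := by
        rw [trace_pauliString]
        exact Finset.prod_eq_zero (Finset.mem_univ k) (trace_pauli hk)
      rw [h2, map_smul, h1, Matrix.trace_smul, Matrix.trace_smul, h3, smul_zero, smul_zero]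
  | zero => rw [map_zero, map_zero]
  | add x y _ _ hx hy => rw [map_add, map_add, Matrix.trace_add, Matrix.trace_add, hx, hy]
  | smul c x _ hx => rw [map_smul, map_smul, Matrix.trace_smul, Matrix.trace_smul, hx]

lemma trace_of_idempotent {ι : Type*} [Fintype ι] [DecidableEq ι] {E : Matrix ι ι ℂ}
    (hE : E * E = E) : ∃ r : ℕ, E.trace = r := by
  have h1 : IsIdempotentElem (Matrix.toLin' E) :=
    (Matrix.toLin'_mul E E).symm.trans (congrArg _ hE)
  exact ⟨_, (Matrix.trace_toLin'_eq E).symm.trans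
    (LinearMap.IsIdempotentElem.isProj_range _ h1).trace⟩

/-- The projection of relative trace `2 ^ (-S)` has integral rank, so `2 ^ S` divides `2 ^ L`. This
makes the subtraction in the degeneracy `2 ^ (L - n)` genuine. -/
lemma length_le_of_pauli (hinj : Function.Injective ρ)
    (hs : ∀ j, ∃ s : Fin L → Fin 4, ρ (h j) = pauliString s) : (M + 2) / 3 ≤ L := by
  obtain ⟨e, h1, h2⟩ := exists_projection ρ
  obtain ⟨r, hr⟩ := trace_of_idempotent h1
  rw [trace_twist_of_pauli ρ hinj hs, hr] at h2
  have h3 : 2 ^ ((M + 2) / 3) * r = 2 ^ L := by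
    have h4 : ((2 ^ ((M + 2) / 3) * r : ℕ) : ℂ) = ((2 ^ L : ℕ) : ℂ) := by
      have h5 : Fintype.card (Fin L → Fin 2) = 2 ^ L := by simp
      rw [h5] at h2
      push_cast at h2 ⊢
      linear_combination h2 / 2
    exact_mod_cast h4
  exact (Nat.pow_dvd_pow_iff_le_right (by norm_num)).1 (Dvd.intro _ h3)

variable {n : ℕ} {φ α : Fin M → ℝ} {v ε : Fin n → ℝ} {ρ}

theorem degeneracy_of_pauli (hφ : ∀ j, Real.cos (2 * φ j) ≠ 0) (hα : CouplingRelation φ α)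
    (hP : ∀ x : ℂ, polyVal (ext α) x (M + 2) = ∏ i, (1 - x * ((v i : ℂ)⁻¹) ^ 2))
    (hv : ∀ k, 0 < v k) (hn : n ≤ (M + 2) / 3) (hε : ∀ k, Real.tan (ε k) = 1 / v k)
    (hinj : Function.Injective ρ) (hs : ∀ j, ∃ s : Fin L → Fin 4, ρ (h j) = pauliString s)
    (z : ℂ) : degeneracy (ρ (circuit φ)) z =
      2 ^ (L - n) * Nat.card {σ // modeValue φ ε σ = z} := by
  have hρ : ∀ j, (ρ (h j)).IsHermitian := fun j => by
    obtain ⟨s, hs⟩ := hs j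
    rw [hs]
    exact pauliString_isHermitian s
  have hL := length_le_of_pauli ρ hinj hs
  have hU := map_circuit_mem_unitary ρ hρ φ
  -- Since the twist has the same traces, the circuit matrix itself can play both roles, and the
  -- factor two cancels.
  have h1 := degeneracy_add_of_moments hU hU (modeValue φ ε) (fun j => by
    have h2 := trace_circuit_pow hφ hα hP hv hε ρ j
    rwa [← map_pow, ← map_pow, trace_twist_of_pauli ρ hinj hs, map_pow] at h2) z
  have h3 : Fintype.card (Fin L → Fin 2) = 2 ^ n * 2 ^ (L - n) := by
    rw [← pow_add, Nat.add_sub_cancel' (hn.trans hL)]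
    simp
  rw [h3] at h1
  have h4 : 0 < 2 * 2 ^ n := by positivity
  refine Nat.eq_of_mul_eq_mul_left h4 ?_
  linarith

lemma modeProduct_pi (σ : Fin 1 → ℤˣ) : modeProduct (fun _ => Real.pi) σ = -1 := by
  rw [modeProduct, Fin.prod_univ_one]
  rcases Int.units_eq_one_or (σ 0) with h | h <;> rw [h]
  · simp [mul_comm Complex.I]
  · simp [mul_comm Complex.I, Complex.exp_neg]

lemma modeValue_of_pos (hc : 0 < (∏ j, Real.cos (2 * φ j)) * ∏ k, Real.cos (ε k))
    (σ : Fin n → ℤˣ) : modeValue φ ε σ = modeProduct ε σ := by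
  rw [modeValue, Real.sign_of_pos hc, Complex.ofReal_one, one_mul]

theorem hasFreeFermionicSpectrum_of_pauli (hφ : ∀ j, Real.cos (2 * φ j) ≠ 0)
    (hα : CouplingRelation φ α)
    (hP : ∀ x : ℂ, polyVal (ext α) x (M + 2) = ∏ i, (1 - x * ((v i : ℂ)⁻¹) ^ 2))
    (hv : ∀ k, 0 < v k) (hn : n ≤ (M + 2) / 3)
    (hinj : Function.Injective ρ) (hs : ∀ j, ∃ s : Fin L → Fin 4, ρ (h j) = pauliString s) :
    HasFreeFermionicSpectrum (ρ (circuit φ)) := by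
  have hρ : ∀ j, (ρ (h j)).IsHermitian := fun j => by
    obtain ⟨s, hs⟩ := hs j
    rw [hs]
    exact pauliString_isHermitian s
  refine ⟨map_circuit_mem_unitary ρ hρ φ, ?_⟩
  have hp : 0 < ∏ k, Real.cos (Real.arctan (1 / v k)) :=
    Finset.prod_pos fun k _ => Real.cos_arctan_pos _
  have hc0 : (∏ j, Real.cos (2 * φ j)) ≠ 0 := Finset.prod_ne_zero_iff.2 fun j _ => hφ j
  have key : ∀ ε : Fin n → ℝ, (∀ k, Real.tan (ε k) = 1 / v k) →
      0 < (∏ j, Real.cos (2 * φ j)) * ∏ k, Real.cos (ε k) →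
      ∃ (n : ℕ) (ε : Fin n → ℝ) (D : ℕ), 0 < D ∧ ∀ z : ℂ, degeneracy (ρ (circuit φ)) z =
        D * Nat.card {σ : Fin n → ℤˣ // modeProduct ε σ = z} := fun ε hε hpos => by
    refine ⟨n, ε, 2 ^ (L - n), by positivity, fun z => ?_⟩
    rw [degeneracy_of_pauli hφ hα hP hv hn hε hinj hs]
    simp only [modeValue_of_pos hpos]
  rcases lt_or_gt_of_ne hc0 with hc | hc
  · cases n with
    | zero =>
      have hM : 0 < M := by
        rcases Nat.eq_zero_or_pos M with h0 | h0
        · subst h0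
          norm_num at hc
        · exact h0
      have hL := length_le_of_pauli ρ hinj hs
      -- With no modes and sign `-1`, the circuit is `-1`. One mode of angle `π` reproduces this:
      -- both signs give `-1`, so the degeneracy `2 ^ L` is shared as `2 · 2 ^ (L - 1)`. Here `L ≥
      -- 1` because `M > 0`.
      refine ⟨1, fun _ => Real.pi, 2 ^ (L - 1), by positivity, fun z => ?_⟩
      have h1 : ∀ σ, modeValue φ (fun _ : Fin 0 => (0 : ℝ)) σ = -1 := fun σ => by
        simp [modeValue, modeProduct, Real.sign_of_neg hc]
      rw [degeneracy_of_pauli (ε := fun _ => 0) hφ hα hP hv hn (fun k => k.elim0) hinj hs]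
      simp only [h1, modeProduct_pi]
      obtain ⟨l, rfl⟩ : ∃ l, L = l + 1 := ⟨L - 1, by omega⟩
      by_cases hz : -1 = z
      · simp [hz, pow_succ]
      · simp [hz]
    | succ n =>
      -- The sign `-1` is absorbed by shifting one angle by `π`, which preserves its tangent and
      -- reverses its cosine.
      refine key (fun k => if k = 0 then Real.arctan (1 / v k) + Real.pi else
        Real.arctan (1 / v k)) (fun k => ?_) ?_
      · split_ifs
        · rw [Real.tan_add_pi, Real.tan_arctan]
        · rw [Real.tan_arctan]
      · rw [Fin.prod_univ_succ] at hp ⊢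
        simp only [if_true, Fin.succ_ne_zero, if_false, Real.cos_add_pi, neg_mul]
        nlinarith
  · exact key _ (fun k => Real.tan_arctan _) (mul_pos hc hp)

end Pauli

end FFD

theorem mainTheorem2 (M : ℕ) (φ : Fin M → ℝ) (hφ : ∀ j, Real.cos (2 * φ j) ≠ 0) :
    (∃! α : Fin M → ℝ, FFD.CouplingRelation φ α) ∧
    ∀ α : Fin M → ℝ, FFD.CouplingRelation φ α →
      FFD.transferMatrix α Complex.I =
          ((∏ j, (Real.cos (2 * φ j))⁻¹ : ℝ) : ℂ) • FFD.circuit φ ∧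
      Commute (FFD.circuit φ) (FFD.hamiltonian α) ∧
      ∃ (n : ℕ) (v : Fin n → ℝ),
        n ≤ (M + 2) / 3 ∧ ((∀ j, α j ≠ 0) → n = (M + 2) / 3) ∧
        (∀ k, 0 < v k) ∧
        (FFD.poly α).natDegree = n ∧
        (FFD.poly α).roots = Finset.univ.val.map (fun k => v k ^ 2) ∧
        -- arbitrary faithful Hermitian representations
        (∀ {ι : Type*} [Fintype ι] [DecidableEq ι] (ρ : FFD M →ₐ[ℂ] Matrix ι ι ℂ),
          Function.Injective ρ → (∀ j, (ρ (FFD.h j)).IsHermitian) →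
            (∀ j, ρ (FFD.gate φ j) =
              NormedSpace.exp ((Complex.I * (φ j : ℂ)) • ρ (FFD.h j))) ∧
            ρ (FFD.circuit φ) ∈ Matrix.unitaryGroup ι ℂ ∧
            ∀ ε : Fin n → ℝ, (∀ k, Real.tan (ε k) = 1 / v k) →
              spectrum ℂ (ρ (FFD.circuit φ)) =
                {z : ℂ | ∃ σ : Fin n → ℤˣ,
                  z = (Real.sign ((∏ j, Real.cos (2 * φ j)) * ∏ k, Real.cos (ε k)) : ℂ) *
                    FFD.modeProduct ε σ}) ∧
        -- faithful representations by Pauli strings on a chain of qubits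
        (∀ (L : ℕ) (ρ : FFD M →ₐ[ℂ] Matrix (Fin L → Fin 2) (Fin L → Fin 2) ℂ),
          Function.Injective ρ →
          (∀ j, ∃ s : Fin L → Fin 4, ρ (FFD.h j) = FFD.pauliString s) →
            FFD.HasFreeFermionicSpectrum (ρ (FFD.circuit φ)) ∧
            ∀ ε : Fin n → ℝ, (∀ k, Real.tan (ε k) = 1 / v k) →
              ∃ D : ℕ, 0 < D ∧ ∀ z : ℂ,
                FFD.degeneracy (ρ (FFD.circuit φ)) z = D * Nat.card {σ : Fin n → ℤˣ //
                  (Real.sign ((∏ j, Real.cos (2 * φ j)) * ∏ k, Real.cos (ε k)) : ℂ) *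
                    FFD.modeProduct ε σ = z}) := by
  refine ⟨FFD.existsUnique_coupling hφ, fun α hα => ⟨?_, ?_, ?_⟩⟩
  · rw [FFD.transferMatrix_eq, FFD.transfer_I_eq hφ hα]
  · rw [FFD.circuit_eq_smul hφ hα]
    exact (FFD.commute_transfer_hamiltonian α Complex.I).smul_left _
  · obtain ⟨n, v, hdeg, hv, hroots, hP⟩ := FFD.exists_roots_polyShift (FFD.ext α) (M + 2)
    have hn : n ≤ (M + 2) / 3 := hdeg ▸ FFD.natDegree_polyShift_le (FFD.ext α) (M + 2)
    refine ⟨n, v, hn, fun hα0 => ?_, hv, ?_, ?_, ?_, ?_⟩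
    · rw [← hdeg]
      refine FFD.natDegree_polyShift _ _ fun j hj => ?_
      rw [FFD.ext_of_lt α (show j < M by omega)]
      exact hα0 _
    · rw [FFD.poly_eq_polyShift, hdeg]
    · rw [FFD.poly_eq_polyShift, hroots]
    · intro ι _ _ ρ hinj hρ
      exact ⟨FFD.map_gate_eq_exp ρ φ, FFD.map_circuit_mem_unitary ρ hρ φ, fun ε hε =>
        FFD.spectrum_circuit hφ hα hP hv hε ρ hinj hρ⟩
    · intro L ρ hinj hs
      exact ⟨FFD.hasFreeFermionicSpectrum_of_pauli hφ hα hP hv hn hinj hs, fun ε hε =>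
        ⟨2 ^ (L - n), by positivity, FFD.degeneracy_of_pauli hφ hα hP hv hn hε hinj hs⟩⟩
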